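/- **Setting.** Let $\mathcal W$ be the set of finite point patterns on a region $\Omega$ (with the $\sigma$-algebra generated by the counts $N_B$, $B\subseteq\Omega$ measurable), let $\nu$ be a $\sigma$-finite reference measure on $\mathcal W$, let $S_1,\dots,S_p$ be a measurable partition of $\Omega$ into pixels, and let $M\ge1$ be fixed. For $t=1,2,\dots$ let $W_t\in\mathcal W$ be the treatment pattern, $Y_t(w_1,\dots,w_t)\in\mathcal W$ the potential outcome patterns and $X_t(w_1,\dots,w_{t-1})$ the potential covariates (fixed, or jointly measurable random fields). Put $\overline W_t=(W_1,\dots,W_t)$, $Y_t=Y_t(\overline W_t)$, $X_t=X_t(\overline W_{t-1})$. The observed history is $\overline H_{t-1}=(\overline W_{t-1},Y_1,\dots,Y_{t-1},X_1,\dots,X_t)$; the complete history $\overline H_t^*$ consists of $\overline W_t$ and all potential outcomes and covariates of all periods (for $t\le 0$: of the latter only). The moderator $R_{it}\in\mathcal R$ of pixel $i$ is a measurable function of $X_t$; $z_1,\dots,z_L:\mathcal R\to\mathbb R$ are measurable, $z=(z_1,\dots,z_L)^\top$, and $Z_t$ is the $p\times L$ matrix with rows $z(R_{i,t-M+1})^\top$.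 Two stochastic interventions $F_{h'},F_{h''}$ have probability densities $f_{h'},f_{h''}$ with respect to $\nu$ (for instance Poisson processes) and are applied independently in each of $M$ consecutive periods. Let $$\tau_{ti}=\int N_{S_i}\big(Y_t(\overline W_{t-M},w)\big)\,dF_{h''}^{\otimes M}(w)-\int N_{S_i}\big(Y_t(\overline W_{t-M},w)\big)\,dF_{h'}^{\otimes M}(w),$$ let $\tau_t(r)$ be the average of $\tau_{ti}$ over the pixels with $R_{i,t-M+1}=r$, and let $\beta_t^*$ minimize $\sum_i(\tau_t(R_{i,t-M+1})-z(R_{i,t-M+1})^\top\beta)^2$. **Estimator.** Let $e_t(w\mid h;\gamma)$, $\gamma\in\Gamma$, with $\Gamma\subseteq\mathbb R^K$ open, be a measurable parametric family of conditional densities of $W_t$ given $\overline H_{t-1}=h$, correctly specified with true parameter $\gamma^*\in\Gamma$. Put $e_j(\cdot;\gamma)=e_j(\cdot\mid\overline H_{j-1};\gamma)$, $\psi_t(w,h;\gamma)=\partial_\gamma\log e_t(w\mid h;\gamma)$, $\psi_t(\gamma)=\psi_t(W_t,\overline H_{t-1};\gamma)$, and $$\rho_{th}(\gamma)=\prod_{j=t-M+1}^t\frac{f_h(W_j)}{e_j(W_j;\gamma)},\qquad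 A_t(\gamma)=(Z_t^\top Z_t)^{-1}Z_t^\top\Big(\big(\rho_{th''}(\gamma)-\rho_{th'}(\gamma)\big)N_{S_i}(Y_t)\Big)_{i=1}^p .$$ The IPW estimator of $\beta_t^*$ is $\hat\beta_t^I=A_t(\hat\gamma)$. Write $A_t=A_t(\gamma^*)$, $s_t(\gamma)=A_t(\gamma)-\beta_t^*$. **Assumptions.** 1. (Unconfoundedness) For all $t\ge1$ the conditional law of $W_t$ given $\overline H_{t-1}^*$ equals that given $\overline H_{t-1}$. 2. (Overlap) There is $\delta_W>0$ such that a.s., for all $t\ge1$, $w\in\mathcal W$ and $h\in\{h',h''\}$: $e_t(w;\gamma^*)>\delta_Wf_h(w)$ whenever $f_h(w)>0$. 3. (a) There are constants $\delta_Y,\delta_z$ such that a.s. $N_\Omega<\delta_Y$ for all potential outcomes and $|z_l|<\delta_z$ at all potential values of the moderators. (b) $Z_t^\top Z_t$ is non-singular uniformly in $t$: there is $c>0$ with $v^\top Z_t^\top Z_tv\ge c\|v\|^2$ a.s. for all $t\ge M$, $v\in\mathbb R^L$. There is a positive definite $\widetilde V^I$ with $\frac1{T-M+1}\sum_{t=M}^T\mathbb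 V[A_t\mid\overline H^*_{t-M}]\to\widetilde V^I$ in probability as $T\to\infty$. 4. For all $t,h,w$, $e_t(w\mid h;\cdot)$ is differentiable and $\psi_t(w,h;\cdot)$ is twice continuously differentiable on $\Gamma$. Moreover: (i) $\mathbb E\|\psi_t(\gamma^*)\|^2<\infty$; there is a positive definite $V_{ps}$ with $\frac1T\sum_{t=1}^T\mathbb E[\psi_t(\gamma^*)\psi_t(\gamma^*)^\top\mid\overline H^*_{t-M}]\to V_{ps}$ in probability; and $\frac1T\sum_{t=1}^T\mathbb E[\|\psi_t(\gamma^*)\|^2\mathbf 1\{\|\psi_t(\gamma^*)\|>\epsilon\sqrt T\}\mid\overline H^*_{t-M}]\to0$ in probability for every $\epsilon>0$. (ii) With $P_{kjt}=\partial_{\gamma_j}\psi_{t,k}(\gamma^*)$ and $D_{kjt}=P_{kjt}-\mathbb E[P_{kjt}\mid\overline H^*_{t-M}]$: $\mathbb E|P_{kjt}|<\infty$, and for all $k,j$ there is $r\in(0,2]$ with $\mathbb E|D_{kjt}|^{r}<\infty$ for all $t$ and $\frac1{T^{r}}\sum_{t=1}^T\mathbb E[|D_{kjt}|^{r}\mid\overline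 H^*_{t-M}]\to0$ in probability. (iii) In a neighbourhood of $\gamma^*$, the norm of the second derivative of $\psi_t(w,h;\cdot)$ is at most $\ddot\psi_t(w,h)$ for all $t,w,h$, where $\ddot\psi_t$ is measurable and $\sup_t\mathbb E[\ddot\psi_t(W_t,\overline H_{t-1})]<\infty$. 5. (a) There is $U\in\mathbb R^{K\times L}$ with $\frac1{T-M+1}\sum_{t=M}^T\mathbb E[\psi_t(\gamma^*)s_t(\gamma^*)^\top\mid\overline H^*_{t-M}]\to U$ in probability, and $\begin{bmatrix}\widetilde V^I&U^\top\\U&V_{ps}\end{bmatrix}$ is positive definite. (b) With $P_{jt}=\partial_{\gamma_j}s_t(\gamma^*)$, for every $j$ there is $r_j\in(0,2]$ with $\frac1{T-M+1}\sum_{t=M}^Tt^{-r_j}\|P_{jt}-\mathbb E[P_{jt}\mid\overline H^*_{t-M}]\|\to0$ in probability. **Conclusion.** The estimating equation $\sum_{t=M}^T\psi_t(\gamma)=0$ has, with probability tending to one as $T\to\infty$, a solution in every given neighbourhood of $\gamma^*$. Let $\hat\gamma=\hat\gamma_T$ be any consistent sequence of solutions (that is, $\hat\gamma_T$ solves the equation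 with probability tending to one, and $\hat\gamma_T\to\gamma^*$ in probability). Then $$\hat V^I=\frac1{T-M+1}\sum_{t=M}^T\hat\beta_t^I\hat\beta_t^{I\top},\qquad\hat\beta_t^I=A_t(\hat\gamma_T),$$ is a consistent estimator of the variance bound $V^{I*}$: $\hat V^I\to V^{I*}$ in probability, where $V^{I*}$ denotes the limit in probability of $\frac1{T-M+1}\sum_{t=M}^T\mathbb E[A_tA_t^\top\mid\overline H^*_{t-M}]$. -/

import Mathlib

open MeasureTheory Filter Topology

noncomputable section

namespace SpatioTemporal

/-- A finite (simple) point pattern on the region `S`. -/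
@[ext]
structure PointPattern (S : Type*) where
  /-- the finite set of the locations of the points -/
  locations : Finset S

/-- `N_B(w)`: the number of points of the pattern `w` that lie in `B`. -/
def PointPattern.count {S : Type*} (B : Set S) (w : PointPattern S) : ℕ :=
  ((w.locations : Set S) ∩ B).ncard

/-- The usual σ-algebra of point-process theory, generated by the counts `N_B`, `B` measurable. -/
instance PointPattern.instMeasurableSpace {S : Type*} [MeasurableSpace S] :
    MeasurableSpace (PointPattern S) :=
  ⨆ (B : Set S) (_ : MeasurableSet B), MeasurableSpace.comap (PointPattern.count B) ⊤

/-- Sequences indexed by the time periods `1, …, t`. -/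
abbrev Path (E : Type*) (t : ℕ) : Type _ := ↥(Set.Icc 1 t) → E

/-- Values of the observed history preceding the treatment at time `t`: treatments and outcomes
of the periods `1, …, t - 1`, covariates of the periods `1, …, t`. -/
abbrev History (S 𝒳 : Type*) (t : ℕ) : Type _ :=
  Path (PointPattern S) (t - 1) × Path (PointPattern S) (t - 1) × Path 𝒳 t

/-- Coefficients `(ZᵀZ)⁻¹ Zᵀ y` of the least squares regression of `y` on `Z`. -/
def ols {p L : ℕ} (Z : Matrix (Fin p) (Fin L) ℝ) (y : Fin p → ℝ) : Fin L → ℝ :=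
  (Z.transpose * Z)⁻¹.mulVec (Z.transpose.mulVec y)

/-- If `ZᵀZ` is non-singular, `ols Z y` is the unique minimizer of the sum of squares. -/
theorem ols_isArgmin {p L : ℕ} (Z : Matrix (Fin p) (Fin L) ℝ) (y : Fin p → ℝ)
    (hZ : IsUnit (Z.transpose * Z).det) (b : Fin L → ℝ) (hb : b ≠ ols Z y) :
    (y - Z.mulVec (ols Z y)) ⬝ᵥ (y - Z.mulVec (ols Z y)) <
      (y - Z.mulVec b) ⬝ᵥ (y - Z.mulVec b) := by
  set b0 := ols Z y with hb0
  have hn : Z.transpose.mulVec (y - Z.mulVec b0) = 0 := by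
    rw [Matrix.mulVec_sub, hb0, ols, Matrix.mulVec_mulVec, Matrix.mulVec_mulVec,
      Matrix.mul_nonsing_inv _ hZ, Matrix.one_mulVec, sub_self]
  set d := b0 - b with hd
  have hdec : y - Z.mulVec b = (y - Z.mulVec b0) + Z.mulVec d := by
    rw [hd, Matrix.mulVec_sub]; abel
  have hcross : (y - Z.mulVec b0) ⬝ᵥ Z.mulVec d = 0 := by
    rw [Matrix.dotProduct_mulVec, ← Matrix.mulVec_transpose, hn, zero_dotProduct]
  have hpos : 0 < Z.mulVec d ⬝ᵥ Z.mulVec d := by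
    have h0 : 0 ≤ Z.mulVec d ⬝ᵥ Z.mulVec d :=
      Finset.sum_nonneg fun i _ => mul_self_nonneg _
    refine lt_of_le_of_ne h0 fun h => hb ?_
    have hz : Z.mulVec d = 0 := dotProduct_self_eq_zero.mp h.symm
    have h1 : (Z.transpose * Z).mulVec d = 0 := by
      rw [← Matrix.mulVec_mulVec, hz, Matrix.mulVec_zero]
    have h2 : d = 0 := by
      have := congrArg (fun v => (Z.transpose * Z)⁻¹.mulVec v) h1
      simpa [Matrix.mulVec_mulVec, Matrix.nonsing_inv_mul _ hZ] using this
    exact (sub_eq_zero.mp h2).symm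
  have hcross' : Z.mulVec d ⬝ᵥ (y - Z.mulVec b0) = 0 := by rw [dotProduct_comm, hcross]
  rw [hdec, add_dotProduct, dotProduct_add, dotProduct_add, hcross, hcross']
  linarith

/-- The objects of the study. Time periods are `1, 2, 3, …`; index `0` is never used.
`p` pixels, `L` basis functions, `K` propensity score parameters. -/
structure Study (Ω S 𝒳 𝓡 : Type*) [MeasurableSpace S] (p L K : ℕ) where
  /-- observed treatment pattern `W_t` -/
  W : ℕ → Ω → PointPattern S
  /-- potential outcome pattern `Y_t(w_1, …, w_t)` -/
  Y : (t : ℕ) → Path (PointPattern S) t → Ω → PointPattern S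
  /-- potential covariates `X_t(w_1, …, w_{t-1})`, realized before `W_t` -/
  X : (t : ℕ) → Path (PointPattern S) (t - 1) → Ω → 𝒳
  /-- the pixels `S_i` -/
  pixel : Fin p → Set S
  /-- the moderator of pixel `i` at time `t`, a summary of the covariates of time `t` -/
  R : ℕ → Fin p → 𝒳 → 𝓡
  /-- the basis functions of the working model -/
  z : Fin L → 𝓡 → ℝ
  /-- the number of intervention periods -/
  M : ℕ
  /-- reference measure on treatment patterns for all densities -/
  ν : Measure (PointPattern S)
  /-- density of the intervention `F_{h'}` -/
  f₁ : PointPattern S → ℝ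
  /-- density of the intervention `F_{h''}` -/
  f₂ : PointPattern S → ℝ
  /-- the parameter set of the propensity score model -/
  Γ : Set (EuclideanSpace ℝ (Fin K))
  /-- the true parameter -/
  γs : EuclideanSpace ℝ (Fin K)
  /-- the propensity score model: `e t h w γ` is the density at `w` of `W_t` given that the
  observed history is `h`, under parameter `γ` -/
  e : (t : ℕ) → History S 𝒳 t → PointPattern S → EuclideanSpace ℝ (Fin K) → ℝ

/-- `(T - M + 1)⁻¹ ∑_{t = M}^T x_t`. -/
def timeAvg (M T : ℕ) (x : ℕ → ℝ) : ℝ :=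
  (∑ t ∈ Finset.Icc M T, x t) / ((T : ℝ) - (M : ℝ) + 1)

/-- Entrywise convergence in probability of random matrices to a constant matrix. -/
def TendstoInProb {Ω : Type*} [MeasurableSpace Ω] (P : Measure Ω) {m n : ℕ}
    (B : ℕ → Ω → Matrix (Fin m) (Fin n) ℝ) (C : Matrix (Fin m) (Fin n) ℝ) : Prop :=
  ∀ a b, TendstoInMeasure P (fun T ω => B T ω a b) atTop (fun _ => C a b)

namespace Study

variable {Ω S 𝒳 𝓡 : Type*} [MeasurableSpace S] {p L K : ℕ}
variable (D : Study Ω S 𝒳 𝓡 p L K)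

/-! Observed quantities -/

/-- The observed treatment path `(W_1, …, W_t)`. -/
def Wbar (t : ℕ) (ω : Ω) : Path (PointPattern S) t := fun s => D.W s ω

/-- The observed outcome `Y_t = Y_t(W_1, …, W_t)`. -/
def Yobs (t : ℕ) (ω : Ω) : PointPattern S := D.Y t (D.Wbar t ω) ω

/-- The observed covariates `X_t = X_t(W_1, …, W_{t-1})`. -/
def Xobs (t : ℕ) (ω : Ω) : 𝒳 := D.X t (D.Wbar (t - 1) ω) ω

/-- The observed history preceding the treatment at time `t`. -/
def hist (t : ℕ) (ω : Ω) : History S 𝒳 t :=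
  (D.Wbar (t - 1) ω, fun s => D.Yobs s ω, fun s => D.Xobs s ω)

/-! Information -/

/-- The σ-algebra generated by all potential outcomes and potential covariates. -/
@[reducible]
def potSigma [MeasurableSpace 𝒳] : MeasurableSpace Ω :=
  (⨆ (t : ℕ) (_ : 1 ≤ t) (w : Path (PointPattern S) t),
      MeasurableSpace.comap (D.Y t w) inferInstance) ⊔
    (⨆ (t : ℕ) (_ : 1 ≤ t) (w : Path (PointPattern S) (t - 1)),
      MeasurableSpace.comap (D.X t w) inferInstance)

/-- The σ-algebra of the complete history through time `t`: the treatments `W_1, …, W_t`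
and all potential outcomes and covariates. -/
@[reducible]
def fullSigma [MeasurableSpace 𝒳] (t : ℕ) : MeasurableSpace Ω :=
  MeasurableSpace.comap (D.Wbar t) inferInstance ⊔ D.potSigma

/-- The σ-algebra of the observed history preceding the treatment at time `t`. -/
@[reducible]
def obsSigma [MeasurableSpace 𝒳] (t : ℕ) : MeasurableSpace Ω :=
  MeasurableSpace.comap (D.hist t) inferInstance

/-! Estimands -/

/-- The stochastic intervention with density `f`. -/
def intervention (f : PointPattern S → ℝ) : Measure (PointPattern S) :=
  D.ν.withDensity fun w => ENNReal.ofReal (f w)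

/-- The path `(W_1, …, W_{t-M}, w_1, …, w_M)`. -/
def splice (t : ℕ) (ω : Ω) (w : Fin D.M → PointPattern S) : Path (PointPattern S) t :=
  fun s => if h : (s : ℕ) ≤ t - D.M then D.W s ω
    else w ⟨s - (t - D.M) - 1, by have := s.2.1; have := s.2.2; omega⟩

/-- `N_{ti}(F)`: the expected number of outcome events in pixel `i` at time `t` when the
treatments of the last `M` periods are drawn independently from the density `f`. -/
def expCount (f : PointPattern S → ℝ) (t : ℕ) (i : Fin p) (ω : Ω) : ℝ :=
  ∫ w : Fin D.M → PointPattern S,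
    ((D.Y t (D.splice t ω w) ω).count (D.pixel i) : ℝ)
      ∂(Measure.pi fun _ => D.intervention f)

/-- The pixel-level effect of `F_{h''}` versus `F_{h'}`. -/
def tau (t : ℕ) (i : Fin p) (ω : Ω) : ℝ := D.expCount D.f₂ t i ω - D.expCount D.f₁ t i ω

/-- The pre-intervention moderator `R_{i, t-M+1}`. -/
def moderator (t : ℕ) (i : Fin p) (ω : Ω) : 𝓡 :=
  D.R (t + 1 - D.M) i (D.Xobs (t + 1 - D.M) ω)

open Classical in
/-- The conditional average treatment effect at moderator value `r`. -/
def cate (t : ℕ) (r : 𝓡) (ω : Ω) : ℝ :=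
  (∑ i, if D.moderator t i ω = r then D.tau t i ω else 0) /
    ∑ i, if D.moderator t i ω = r then (1 : ℝ) else 0

/-- The design matrix `Z_t`, with rows `z(R_{i, t-M+1})`. -/
def Z (t : ℕ) (ω : Ω) : Matrix (Fin p) (Fin L) ℝ :=
  Matrix.of fun i l => D.z l (D.moderator t i ω)

/-- The coefficients `β_t^*` of the projection of the CATE on the working model. -/
def betaStar (t : ℕ) (ω : Ω) : Fin L → ℝ :=
  ols (D.Z t ω) fun i => D.cate t (D.moderator t i ω) ω

/-! Estimators -/

/-- The inverse probability weight `∏_{j = t-M+1}^t f(W_j) / e_j(W_j; γ)`. -/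
def weight (f : PointPattern S → ℝ) (t : ℕ) (γ : EuclideanSpace ℝ (Fin K)) (ω : Ω) : ℝ :=
  ∏ j ∈ Finset.Icc (t + 1 - D.M) t, f (D.W j ω) / D.e j (D.hist j ω) (D.W j ω) γ

/-- The contrast of the IPW pseudo-outcomes in pixel `i`. -/
def pseudoEffect (t : ℕ) (γ : EuclideanSpace ℝ (Fin K)) (ω : Ω) (i : Fin p) : ℝ :=
  D.weight D.f₂ t γ ω * ((D.Yobs t ω).count (D.pixel i) : ℝ) -
    D.weight D.f₁ t γ ω * ((D.Yobs t ω).count (D.pixel i) : ℝ)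

/-- The IPW regression coefficients `(Z_tᵀ Z_t)⁻¹ Z_tᵀ τ̂_t(γ)`: this is `A_t` at the true
parameter, and the IPW estimator of `β_t` at the estimated one. -/
def betaIPW (t : ℕ) (γ : EuclideanSpace ℝ (Fin K)) (ω : Ω) : Fin L → ℝ :=
  ols (D.Z t ω) (D.pseudoEffect t γ ω)

/-- The variance bound estimator `(T-M+1)⁻¹ ∑_{t=M}^T β̂_t β̂_tᵀ` at the estimates `γ̂_T`. -/
def Vhat (γhat : ℕ → Ω → EuclideanSpace ℝ (Fin K)) (T : ℕ) (ω : Ω) :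
    Matrix (Fin L) (Fin L) ℝ :=
  Matrix.of fun a b => timeAvg D.M T fun t =>
    D.betaIPW t (γhat T ω) ω a * D.betaIPW t (γhat T ω) ω b

/-! Score function -/

/-- The score `∂/∂γ log f(w | h; γ)`. -/
def psi (t : ℕ) (h : History S 𝒳 t) (w : PointPattern S) (γ : EuclideanSpace ℝ (Fin K)) :
    EuclideanSpace ℝ (Fin K) :=
  gradient (fun g => Real.log (D.e t h w g)) γ

/-- The score of period `t` at the observed data. -/
def psiObs (t : ℕ) (γ : EuclideanSpace ℝ (Fin K)) (ω : Ω) : EuclideanSpace ℝ (Fin K) :=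
  D.psi t (D.hist t ω) (D.W t ω) γ

/-- `∂ψ_k/∂γ_j` at the observed data of period `t` and the true parameter. -/
def psiDeriv (k j : Fin K) (t : ℕ) (ω : Ω) : ℝ :=
  fderiv ℝ (fun g => D.psiObs t g ω k) D.γs (EuclideanSpace.single j 1)

/-- `s_t(γ) = (Z_tᵀ Z_t)⁻¹ Z_tᵀ τ̂_t(γ) - β_t^*`. -/
def sFun (t : ℕ) (γ : EuclideanSpace ℝ (Fin K)) (ω : Ω) : Fin L → ℝ :=
  D.betaIPW t γ ω - D.betaStar t ω

/-- `∂s_l/∂γ_j` at the true parameter. -/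
def sDeriv (j : Fin K) (l : Fin L) (t : ℕ) (ω : Ω) : ℝ :=
  fderiv ℝ (fun g => D.sFun t g ω l) D.γs (EuclideanSpace.single j 1)

/-! Assumptions -/

variable [MeasurableSpace Ω] [MeasurableSpace 𝒳] [MeasurableSpace 𝓡]

/-- The standing conditions of the setting. -/
structure Setting (P : Measure Ω) : Prop where
  one_le_M : 1 ≤ D.M
  measurable_W : ∀ t, 1 ≤ t → Measurable (D.W t)
  measurable_Y : ∀ t, 1 ≤ t → ∀ w, Measurable (D.Y t w)
  measurable_X : ∀ t, 1 ≤ t → ∀ w, Measurable (D.X t w)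
  /-- the potential outcomes form a jointly measurable random field -/
  joint_Y : ∀ t, 1 ≤ t →
    @Measurable (Ω × Path (PointPattern S) t) (PointPattern S)
      (D.potSigma.prod inferInstance) _ fun q => D.Y t q.2 q.1
  /-- the potential covariates form a jointly measurable random field -/
  joint_X : ∀ t, 1 ≤ t →
    @Measurable (Ω × Path (PointPattern S) (t - 1)) 𝒳
      (D.potSigma.prod inferInstance) _ fun q => D.X t q.2 q.1
  measurable_pixel : ∀ i, MeasurableSet (D.pixel i)
  disjoint_pixel : Pairwise fun i i' => Disjoint (D.pixel i) (D.pixel i')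
  iUnion_pixel : ⋃ i, D.pixel i = Set.univ
  measurable_R : ∀ t i, Measurable (D.R t i)
  measurable_z : ∀ l, Measurable (D.z l)
  sigmaFinite : SigmaFinite D.ν
  f₁_measurable : Measurable D.f₁
  f₁_nonneg : ∀ w, 0 ≤ D.f₁ w
  f₁_prob : ∫⁻ w, ENNReal.ofReal (D.f₁ w) ∂D.ν = 1
  f₂_measurable : Measurable D.f₂
  f₂_nonneg : ∀ w, 0 ≤ D.f₂ w
  f₂_prob : ∫⁻ w, ENNReal.ofReal (D.f₂ w) ∂D.ν = 1
  isOpen_Γ : IsOpen D.Γ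
  γs_mem : D.γs ∈ D.Γ
  /-- for each parameter, the model is a family of probability densities -/
  e_measurable : ∀ t, 1 ≤ t → ∀ γ ∈ D.Γ,
    Measurable fun q : History S 𝒳 t × PointPattern S => D.e t q.1 q.2 γ
  e_nonneg : ∀ t, 1 ≤ t → ∀ γ ∈ D.Γ, ∀ h w, 0 ≤ D.e t h w γ
  e_prob : ∀ t, 1 ≤ t → ∀ γ ∈ D.Γ, ∀ h, ∫⁻ w, ENNReal.ofReal (D.e t h w γ) ∂D.ν = 1
  /-- correct specification: `e_t(· | h; γ^*)` is the density of `W_t` given the observed history -/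
  correct : ∀ t, 1 ≤ t → ∀ A : Set (PointPattern S), MeasurableSet A →
    P[(D.W t ⁻¹' A).indicator (fun _ => (1 : ℝ)) | D.obsSigma t] =ᵐ[P]
      fun ω => ∫ w in A, D.e t (D.hist t ω) w D.γs ∂D.ν

/-- Unconfoundedness: given the observed history, the treatment does not depend on the
potential outcomes and covariates. -/
def Unconfounded (P : Measure Ω) : Prop :=
  ∀ t, 1 ≤ t → ∀ A : Set (PointPattern S), MeasurableSet A →
    P[(D.W t ⁻¹' A).indicator (fun _ => (1 : ℝ)) | D.fullSigma (t - 1)] =ᵐ[P]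
      P[(D.W t ⁻¹' A).indicator (fun _ => (1 : ℝ)) | D.obsSigma t]

/-- Bounded relative overlap, for both interventions. -/
def Overlap (P : Measure Ω) : Prop :=
  ∃ δ : ℝ, 0 < δ ∧ ∀ᵐ ω ∂P, ∀ t, 1 ≤ t → ∀ w,
    (0 < D.f₁ w → δ * D.f₁ w < D.e t (D.hist t ω) w D.γs) ∧
    (0 < D.f₂ w → δ * D.f₂ w < D.e t (D.hist t ω) w D.γs)

/-- Bounded outcomes and moderators, for all potential values. -/
def Bounded (P : Measure Ω) : Prop :=
  ∃ δY δz : ℝ, ∀ᵐ ω ∂P, ∀ t, 1 ≤ t →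
    (∀ w, ((D.Y t w ω).count Set.univ : ℝ) < δY) ∧
    (∀ w i l, |D.z l (D.R t i (D.X t w ω))| < δz)

/-- The matrices `Z_tᵀ Z_t` are non-singular, uniformly in `t`. -/
def NonSingular (P : Measure Ω) : Prop :=
  ∃ c : ℝ, 0 < c ∧ ∀ᵐ ω ∂P, ∀ t, D.M ≤ t → ∀ v : Fin L → ℝ,
    c * (v ⬝ᵥ v) ≤ (D.Z t ω).mulVec v ⬝ᵥ (D.Z t ω).mulVec v

/-- The conditional covariance matrix of `A_t` given the complete history through `t - M`. -/
def condCovA (P : Measure Ω) (t : ℕ) (ω : Ω) : Matrix (Fin L) (Fin L) ℝ :=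
  Matrix.of fun a b =>
    P[fun ω => D.betaIPW t D.γs ω a * D.betaIPW t D.γs ω b | D.fullSigma (t - D.M)] ω -
      P[fun ω => D.betaIPW t D.γs ω a | D.fullSigma (t - D.M)] ω *
        P[fun ω => D.betaIPW t D.γs ω b | D.fullSigma (t - D.M)] ω

/-- The averaged conditional variances of `A_t` converge in probability to `Vt`. -/
def VarianceLimit (P : Measure Ω) (Vt : Matrix (Fin L) (Fin L) ℝ) : Prop :=
  TendstoInProb P
    (fun T ω => Matrix.of fun a b => timeAvg D.M T fun t => D.condCovA P t ω a b) Vt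

/-- `Vs` is the variance bound: the limit in probability of
`(T-M+1)⁻¹ ∑_{t=M}^T E[A_t A_tᵀ | H^*_{t-M}]`. -/
def IsVarianceBound (P : Measure Ω) (Vs : Matrix (Fin L) (Fin L) ℝ) : Prop :=
  TendstoInProb P
    (fun T ω => Matrix.of fun a b => timeAvg D.M T fun t =>
      (P[fun ω => D.betaIPW t D.γs ω a * D.betaIPW t D.γs ω b | D.fullSigma (t - D.M)]) ω) Vs

/-- Regularity conditions on the propensity score model. For `t < M` the complete history
through time `t - M` consists of the potential outcomes and covariates alone. -/
structure ScoreRegular (P : Measure Ω) (Vps : Matrix (Fin K) (Fin K) ℝ) : Prop where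
  differentiable : ∀ t, 1 ≤ t → ∀ h w, DifferentiableOn ℝ (D.e t h w) D.Γ
  smooth : ∀ t, 1 ≤ t → ∀ h w, ContDiffOn ℝ 2 (D.psi t h w) D.Γ
  sq_integrable : ∀ t, 1 ≤ t → Integrable (fun ω => ‖D.psiObs t D.γs ω‖ ^ 2) P
  information : TendstoInProb P
    (fun T ω => Matrix.of fun k j => (∑ t ∈ Finset.Icc 1 T,
      (P[fun ω => D.psiObs t D.γs ω k * D.psiObs t D.γs ω j | D.fullSigma (t - D.M)]) ω)
        / (T : ℝ)) Vps
  lindeberg : ∀ ε : ℝ, 0 < ε → TendstoInMeasure P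
    (fun (T : ℕ) ω => (∑ t ∈ Finset.Icc 1 T,
      (P[{ω | ε * √(T : ℝ) < ‖D.psiObs t D.γs ω‖}.indicator
          (fun ω => ‖D.psiObs t D.γs ω‖ ^ 2) | D.fullSigma (t - D.M)]) ω) / (T : ℝ))
    atTop (fun _ => (0 : ℝ))
  deriv_integrable : ∀ k j t, 1 ≤ t → Integrable (D.psiDeriv k j t) P
  deriv_stable : ∀ k j, ∃ r : ℝ, 0 < r ∧ r ≤ 2 ∧
    (∀ t, 1 ≤ t → Integrable (fun ω =>
      |D.psiDeriv k j t ω - (P[D.psiDeriv k j t | D.fullSigma (t - D.M)]) ω| ^ r) P) ∧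
    TendstoInMeasure P
      (fun (T : ℕ) ω => (∑ t ∈ Finset.Icc 1 T,
        (P[fun ω => |D.psiDeriv k j t ω - (P[D.psiDeriv k j t | D.fullSigma (t - D.M)]) ω| ^ r
          | D.fullSigma (t - D.M)]) ω) / (T : ℝ) ^ r)
      atTop (fun _ => (0 : ℝ))
  dominated : ∃ U ∈ 𝓝 D.γs, ∃ B : (t : ℕ) → History S 𝒳 t → PointPattern S → ℝ, ∃ C : ℝ,
    (∀ t, 1 ≤ t → Measurable fun q : History S 𝒳 t × PointPattern S => B t q.1 q.2) ∧
    (∀ t, 1 ≤ t → ∀ h w, ∀ γ ∈ U, ‖iteratedFDeriv ℝ 2 (D.psi t h w) γ‖ ≤ B t h w) ∧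
    (∀ t, 1 ≤ t → Integrable (fun ω => B t (D.hist t ω) (D.W t ω)) P) ∧
    (∀ t, 1 ≤ t → ∫ ω, B t (D.hist t ω) (D.W t ω) ∂P ≤ C)

/-- The averages of `E[ψ_t s_tᵀ | H^*_{t-M}]` converge in probability to `U`. -/
def CrossLimit (P : Measure Ω) (U : Matrix (Fin K) (Fin L) ℝ) : Prop :=
  TendstoInProb P
    (fun T ω => Matrix.of fun k l => timeAvg D.M T fun t =>
      (P[fun ω => D.psiObs t D.γs ω k * D.sFun t D.γs ω l | D.fullSigma (t - D.M)]) ω) U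

/-- The derivatives of `s_t` vary little around their conditional expectations. -/
def SDerivStable (P : Measure Ω) : Prop :=
  ∀ j : Fin K, ∃ r : ℝ, 0 < r ∧ r ≤ 2 ∧ TendstoInMeasure P
    (fun T ω => timeAvg D.M T fun t => (1 / (t : ℝ) ^ r) *
      √(∑ l, (D.sDeriv j l t ω - (P[D.sDeriv j l t | D.fullSigma (t - D.M)]) ω) ^ 2))
    atTop (fun _ => (0 : ℝ))

/-- `γ` solves the estimating equation `∑_{t=M}^T ψ_t(γ) = 0`. -/
def SolvesScore (T : ℕ) (γ : EuclideanSpace ℝ (Fin K)) (ω : Ω) : Prop :=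
  γ ∈ D.Γ ∧ ∑ t ∈ Finset.Icc D.M T, D.psiObs t γ ω = 0

end Study

end SpatioTemporal

end

/-! ### Taylor bounds, and the logarithm of a density that may vanish. -/

section Calculus

variable {F : Type*} [NormedAddCommGroup F] [InnerProductSpace ℝ F]

/-! Let X_t = log e_t(W_t; γ̂) − log e_t(W_t; γ*). The propensity score enters both inverse
probability weights through the same denominator and least squares is linear, so β̂_t is A_t
multiplied by exp(−∑ X_j), the sum running over the window of the last M periods
(`betaIPW_eq_exp_smul`). Overlap, bounded outcomes and coercivity of ZᵀZ bound the A_t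
(`exists_abs_betaIPW_mul_le`). If the sum of the X_t² up to T is bounded in probability, then the
window sums are small on average, and replacing γ̂ by γ* changes the average of β̂_t β̂_tᵀ by o(1)
(`abs_sum_exp_sub_one_mul_le`). The average of A_t A_tᵀ minus that of its conditional expectations
tends to zero by a weak law for bounded variables (`abs_sum_sub_condExp_le`).

The core is therefore the bound on ∑ X_t². Put u = γ̂ − γ* and d = ‖u‖. Taylor expansion gives X_t =
a_t + (b_t − q_t)/2 + O(B_t d³), where a_t is the score paired with u, b_t the quadratic form in u
of the centred score derivative, and −q_t that of its conditional expectation. The estimating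
equation paired with u reads ∑ (a_t + b_t − q_t + error) = 0. If ∑ q_t is at least of order T d²
while b_t and the errors contribute less, then ∑ a_t dominates T d²; as ∑ a_t is O(√T d), this
forces T d² = O(1). The same equation then bounds ∑ q_t, and because every q_t is nonnegative it
also bounds ∑ q_t², without any moment condition on an individual q_t. The remaining squares are
handled by T d² = O(1). This is `sum_sq_le_of_estimating_equation`.

Both properties of q_t come from the information inequality: the conditional second moment of the
score is at most minus the conditional mean of its derivative. No interchange of second derivatives
and integrals is available, so equality is not claimed. Instead, exp of the log likelihood ratio has
integral one, hence the integral of exp X − 1 − X equals minus that of X; dividing by ε² and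
applying Fatou gives the inequality (`integral_sq_score_add_deriv_le_zero`), and comparing terms of
order ε for both signs of ε shows that the score has mean zero. Unconfoundedness makes these
identities, proved for the model kernel at a fixed history, statements about conditional
expectations given the complete history.

The sums of a_t and b_t are controlled by a weak law for variables centred given the past M periods
back (`measure_abs_sum_gt_le`): stopping at a predictable time, as in Lenglart's inequality,
replaces moment bounds by bounds in probability on conditional moments, and truncation covers all
exponents r in (0, 2]. A root exists because the log likelihood, maximized over a small closed ball
around γ*, has its maximum in the interior: on the sphere the term −∑ q_t / 2 wins. -/

theorem norm_fderiv_sub_le_of_norm_iteratedFDeriv_two_le {ψ : F → F} {c : F} {r B : ℝ}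
    (hψ : ContDiffOn ℝ 2 ψ (Metric.ball c r))
    (hB : ∀ g ∈ Metric.ball c r, ‖iteratedFDeriv ℝ 2 ψ g‖ ≤ B) {x : F}
    (hx : x ∈ Metric.ball c r) : ‖fderiv ℝ ψ x - fderiv ℝ ψ c‖ ≤ B * ‖x - c‖ := by
  have hc : c ∈ Metric.ball c r := Metric.mem_ball_self (dist_nonneg.trans_lt hx)
  have h1 : ContDiffOn ℝ 1 (fderiv ℝ ψ) (Metric.ball c r) :=
    hψ.fderiv_of_isOpen Metric.isOpen_ball (by norm_num)
  refine (convex_ball c r).norm_image_sub_le_of_norm_fderiv_le (𝕜 := ℝ)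
    (fun y hy => (h1.differentiableOn (by norm_num)).differentiableAt
      (Metric.isOpen_ball.mem_nhds hy)) (fun y hy => ?_) hc hx
  have h2 := hB y hy
  rw [← norm_iteratedFDeriv_fderiv, ← norm_iteratedFDeriv_fderiv, norm_iteratedFDeriv_zero] at h2
  exact h2

theorem norm_sub_sub_fderiv_le_of_norm_iteratedFDeriv_two_le {ψ : F → F} {c : F} {r B : ℝ}
    (hψ : ContDiffOn ℝ 2 ψ (Metric.ball c r))
    (hB : ∀ g ∈ Metric.ball c r, ‖iteratedFDeriv ℝ 2 ψ g‖ ≤ B) {x : F}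
    (hx : x ∈ Metric.ball c r) :
    ‖ψ x - ψ c - fderiv ℝ ψ c (x - c)‖ ≤ B * ‖x - c‖ ^ 2 := by
  have hc : c ∈ Metric.ball c r := Metric.mem_ball_self (dist_nonneg.trans_lt hx)
  have hB0 : 0 ≤ B := (norm_nonneg _).trans (hB c hc)
  -- The mean value inequality is applied on the closed ball of radius `‖x - c‖`, where the
  -- derivative moves by at most `B * ‖x - c‖`.
  have hcl : ∀ y ∈ Metric.closedBall c ‖x - c‖, y ∈ Metric.ball c r := fun y hy => by
    rw [Metric.mem_closedBall] at hy
    rw [Metric.mem_ball, dist_eq_norm] at hx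
    exact lt_of_le_of_lt hy hx
  have := (convex_closedBall c ‖x - c‖).norm_image_sub_le_of_norm_fderiv_le' (𝕜 := ℝ) (f := ψ)
    (φ := fderiv ℝ ψ c) (C := B * ‖x - c‖) (x := c) (y := x)
    (fun y hy => (hψ.differentiableOn (by norm_num)).differentiableAt
      (Metric.isOpen_ball.mem_nhds (hcl y hy))) (fun y hy =>
      (norm_fderiv_sub_le_of_norm_iteratedFDeriv_two_le hψ hB (hcl y hy)).trans
        (mul_le_mul_of_nonneg_left (by simpa [dist_eq_norm] using hy) hB0))
    (by simp) (by simp [dist_eq_norm])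
  rw [sq, ← mul_assoc]; exact this

variable [CompleteSpace F]

/-- If `e ≥ 0` is differentiable on the open set `G`, then `∇e = e ∇(log e)` on `G`, zeros included. -/
theorem hasGradientAt_smul_gradient_log {e : F → ℝ} {G : Set F} (hG : IsOpen G)
    (hpos : ∀ g ∈ G, 0 ≤ e g) (hd : DifferentiableOn ℝ e G) {x : F} (hx : x ∈ G) :
    HasGradientAt e (e x • gradient (fun g => Real.log (e g)) x) x := by
  have hdx : DifferentiableAt ℝ e x := hd.differentiableAt (hG.mem_nhds hx)
  by_cases h0 : e x = 0
  -- A zero of a nonnegative function is a minimum, so the gradient vanishes there and the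
  -- meaningless value of the score is multiplied by zero.
  · have hmin : IsLocalMin e x := by
      filter_upwards [hG.mem_nhds hx] with g hg
      rw [h0]; exact hpos g hg
    have h1 := hmin.fderiv_eq_zero
    have h2 := hdx.hasFDerivAt
    rw [h1] at h2
    rw [h0, zero_smul, hasGradientAt_iff_hasFDerivAt, map_zero]
    exact h2
  · have h1 : HasFDerivAt (fun g => Real.log (e g)) ((e x)⁻¹ • fderiv ℝ e x) x :=
      hdx.hasFDerivAt.log h0
    have h2 : gradient (fun g => Real.log (e g)) x =
        (InnerProductSpace.toDual ℝ F).symm ((e x)⁻¹ • fderiv ℝ e x) := by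
      rw [gradient, h1.fderiv]
    rw [h2, map_smul, smul_smul, mul_inv_cancel₀ h0, one_smul]
    exact hdx.hasGradientAt

/-- A density that vanishes at one point of a convex set on which its score is continuous
vanishes throughout. -/
theorem eq_zero_of_continuousOn_gradient_log {e : F → ℝ} {G : Set F} (hG : IsOpen G)
    (hpos : ∀ g ∈ G, 0 ≤ e g) (hd : DifferentiableOn ℝ e G)
    (hψ : ContinuousOn (gradient (fun g => Real.log (e g))) G)
    {C : Set F} (hC : Convex ℝ C) (hCG : C ⊆ G) {x y : F} (hx : x ∈ C) (hy : y ∈ C)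
    (h0 : e x = 0) : e y = 0 := by
  set ψ := gradient (fun g => Real.log (e g)) with hψd
  set ℓ : ℝ → F := fun s => x + s • (y - x) with hℓ
  have hmem : ∀ s ∈ Set.Icc (0 : ℝ) 1, ℓ s ∈ C := fun s hs => by
    have := hC.add_smul_sub_mem hx hy hs
    simpa [hℓ] using this
  have hℓc : Continuous ℓ := by fun_prop
  have hψc : ContinuousOn (fun s => ‖ψ (ℓ s)‖ * ‖y - x‖) (Set.Icc 0 1) :=
    ((hψ.comp hℓc.continuousOn fun s hs => hCG (hmem s hs)).norm).mul continuousOn_const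
  obtain ⟨A, hA⟩ := (isCompact_Icc.image_of_continuousOn hψc).bddAbove
  have hder : ∀ s ∈ Set.Icc (0 : ℝ) 1, HasDerivAt (fun s => e (ℓ s))
      (inner ℝ (e (ℓ s) • ψ (ℓ s)) (y - x)) s := fun s hs => by
    have h1 := (hasGradientAt_smul_gradient_log hG hpos hd (hCG (hmem s hs))).hasFDerivAt
    have h2 : HasDerivAt (fun s : ℝ => x + s • (y - x)) (y - x) s := by
      simpa using ((hasDerivAt_id s).smul_const (y - x)).const_add x
    exact (h1.comp_hasDerivAt s h2).congr_deriv (InnerProductSpace.toDual_apply_apply ..)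
  -- Along the segment `e` solves a linear equation whose coefficient, the score paired with the
  -- direction, is bounded by compactness. Grönwall with initial value zero keeps it at zero.
  have := norm_le_gronwallBound_of_norm_deriv_right_le (f := fun s => e (ℓ s)) (δ := 0) (K := A)
    (ε := 0) (a := 0) (b := 1)
    (fun s hs => (hder s hs).continuousAt.continuousWithinAt)
    (fun s hs => (hder s (Set.Ico_subset_Icc_self hs)).hasDerivWithinAt) (by simp [hℓ, h0])
    (fun s hs => by
      have hs' := Set.Ico_subset_Icc_self hs
      have h1 : ‖ψ (ℓ s)‖ * ‖y - x‖ ≤ A := hA ⟨s, hs', rfl⟩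
      rw [real_inner_smul_left, norm_mul, add_zero, mul_comm]
      refine mul_le_mul_of_nonneg_right ((norm_inner_le_norm _ _).trans h1) (norm_nonneg _))
    1 (by simp)
  simpa [gronwallBound_ε0_δ0, hℓ] using this

/-- On a ball on which the score is continuous, `log e` has the score as its gradient. -/
theorem hasGradientAt_log_of_continuousOn {e : F → ℝ} {G : Set F} (hG : IsOpen G)
    (hpos : ∀ g ∈ G, 0 ≤ e g) (hd : DifferentiableOn ℝ e G)
    (hψ : ContinuousOn (gradient (fun g => Real.log (e g))) G)
    {c : F} {r : ℝ} (hB : Metric.ball c r ⊆ G) {x : F} (hx : x ∈ Metric.ball c r) :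
    HasGradientAt (fun g => Real.log (e g)) (gradient (fun g => Real.log (e g)) x) x := by
  refine DifferentiableAt.hasGradientAt ?_
  by_cases h0 : e x = 0
  -- Here `e` vanishes on the whole ball, and the convention `Real.log 0 = 0` makes the logarithm
  -- constant.
  · have : (fun g => Real.log (e g)) =ᶠ[𝓝 x] fun _ => 0 := by
      filter_upwards [Metric.isOpen_ball.mem_nhds hx] with g hg
      rw [eq_zero_of_continuousOn_gradient_log hG hpos hd hψ (convex_ball c r) hB hx hg h0,
        Real.log_zero]
    exact (differentiableAt_const (0 : ℝ)).congr_of_eventuallyEq this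
  · exact (hd.differentiableAt (hG.mem_nhds (hB hx))).log h0

/-- Zeros are all or nothing on a convex set, so the likelihood ratio can be written as an
exponential even where the density vanishes: both sides are then zero. -/
theorem eq_mul_exp_log_sub_log {e : F → ℝ} {G : Set F} (hG : IsOpen G)
    (hpos : ∀ g ∈ G, 0 ≤ e g) (hd : DifferentiableOn ℝ e G)
    (hψ : ContinuousOn (gradient (fun g => Real.log (e g))) G)
    {C : Set F} (hC : Convex ℝ C) (hCG : C ⊆ G) {c x : F} (hc : c ∈ C) (hx : x ∈ C) :
    e x = e c * Real.exp (Real.log (e x) - Real.log (e c)) := by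
  by_cases h0 : e c = 0
  · rw [eq_zero_of_continuousOn_gradient_log hG hpos hd hψ hC hCG hc hx h0, h0, zero_mul]
  · have h1 : e x ≠ 0 := fun h =>
      h0 (eq_zero_of_continuousOn_gradient_log hG hpos hd hψ hC hCG hx hc h)
    have p0 := lt_of_le_of_ne (hpos c (hCG hc)) (Ne.symm h0)
    have p1 := lt_of_le_of_ne (hpos x (hCG hx)) (Ne.symm h1)
    rw [Real.exp_sub, Real.exp_log p0, Real.exp_log p1]
    field_simp

/-- Second-order expansion of a function with gradient `ψ`. -/
theorem abs_sub_taylor_le_of_norm_iteratedFDeriv_two_le {g : F → ℝ} {ψ : F → F} {c : F} {r B : ℝ}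
    (hg : ∀ x ∈ Metric.ball c r, HasGradientAt g (ψ x) x)
    (hψ : ContDiffOn ℝ 2 ψ (Metric.ball c r))
    (hB : ∀ g ∈ Metric.ball c r, ‖iteratedFDeriv ℝ 2 ψ g‖ ≤ B) {x : F}
    (hx : x ∈ Metric.ball c r) :
    |g x - g c - (inner ℝ (ψ c) (x - c) + inner ℝ (fderiv ℝ ψ c (x - c)) (x - c) / 2)| ≤
      B * ‖x - c‖ ^ 3 := by
  have hc : c ∈ Metric.ball c r := Metric.mem_ball_self (dist_nonneg.trans_lt hx)
  have hB0 : 0 ≤ B := (norm_nonneg _).trans (hB c hc)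
  set δ := x - c with hδ
  have hmem : ∀ s ∈ Set.Icc (0 : ℝ) 1, c + s • δ ∈ Metric.ball c r := fun s hs => by
    simpa [hδ] using (convex_ball c r).add_smul_sub_mem hc hx hs
  -- Taylor remainder along the segment. Its derivative is the first-order remainder of `ψ` paired
  -- with `δ`, which is at most `B * ‖δ‖ ^ 3`.
  set q : ℝ → ℝ := fun s => g (c + s • δ) -
    (s * inner ℝ (ψ c) δ + s ^ 2 * (inner ℝ (fderiv ℝ ψ c δ) δ / 2)) with hq
  have hder : ∀ s ∈ Set.Icc (0 : ℝ) 1, HasDerivWithinAt q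
      (inner ℝ (ψ (c + s • δ) - ψ c - fderiv ℝ ψ c (s • δ)) δ) (Set.Icc 0 1) s := fun s hs => by
    have h2 : HasDerivAt (fun s : ℝ => c + s • δ) δ s := by
      simpa using ((hasDerivAt_id s).smul_const δ).const_add c
    have h1 : HasDerivAt (fun s => g (c + s • δ)) (inner ℝ (ψ (c + s • δ)) δ) s := by
      exact ((hg _ (hmem s hs)).hasFDerivAt.comp_hasDerivAt s h2).congr_deriv
        (InnerProductSpace.toDual_apply_apply ..)
    have h3 := h1.sub (((hasDerivAt_id s).mul_const (inner ℝ (ψ c) δ)).add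
      ((hasDerivAt_pow 2 s).mul_const (inner ℝ (fderiv ℝ ψ c δ) δ / 2)))
    refine (h3.congr_deriv ?_).hasDerivWithinAt
    rw [inner_sub_left, inner_sub_left, map_smul, real_inner_smul_left]
    simp only [Nat.cast_ofNat]
    ring
  have := norm_image_sub_le_of_norm_deriv_le_segment_01' (C := B * ‖δ‖ ^ 3) hder fun s hs => by
    have hs' := Set.Ico_subset_Icc_self hs
    refine (norm_inner_le_norm _ _).trans ?_
    have h4 := norm_sub_sub_fderiv_le_of_norm_iteratedFDeriv_two_le hψ hB (hmem s hs')
    rw [add_sub_cancel_left] at h4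
    have h5 : ‖s • δ‖ ≤ ‖δ‖ := by
      rw [norm_smul, Real.norm_of_nonneg hs'.1]
      exact mul_le_of_le_one_left (norm_nonneg _) hs'.2
    calc _ ≤ B * ‖s • δ‖ ^ 2 * ‖δ‖ := mul_le_mul_of_nonneg_right h4 (norm_nonneg _)
      _ ≤ B * ‖δ‖ ^ 2 * ‖δ‖ := by gcongr
      _ = _ := by ring
  have h6 : c + (1 : ℝ) • δ = x := by simp [hδ]
  simp only [hq, h6, Real.norm_eq_abs] at this
  convert this using 2
  simp
  ring

end Calculus

/-! ### Mean zero score and the information inequality for a one-dimensional family. -/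

section Bartlett

theorem nonpos_of_forall_mul_le_sq {A C ε₀ : ℝ} (h0 : 0 < ε₀)
    (h : ∀ ε, 0 < ε → ε < ε₀ → ε * A ≤ ε ^ 2 * C) : A ≤ 0 := by
  have h1 : Tendsto (fun ε : ℝ => ε * C) (𝓝[>] 0) (𝓝 0) := by
    have : Tendsto (fun ε : ℝ => ε * C) (𝓝 0) (𝓝 (0 * C)) := tendsto_id.mul_const C
    rw [zero_mul] at this
    exact this.mono_left nhdsWithin_le_nhds
  refine ge_of_tendsto h1 ?_
  filter_upwards [Ioo_mem_nhdsGT h0] with ε hε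
  have := h ε hε.1 hε.2
  exact le_of_mul_le_mul_left (by linarith [sq ε, this, mul_assoc ε ε C]) hε.1

variable {𝒲 : Type*} [MeasurableSpace 𝒲] {κ : Measure 𝒲}
  {X : ℝ → 𝒲 → ℝ} {a b B : 𝒲 → ℝ} {ε₀ : ℝ}

theorem integrable_of_abs_sub_taylor_le {ε : ℝ} (hε : |ε| < ε₀)
    (hX : ∀ ε, |ε| < ε₀ → Measurable (X ε))
    (hT : ∀ ε, |ε| < ε₀ → ∀ w, |X ε w - (ε * a w + ε ^ 2 * b w / 2)| ≤ |ε| ^ 3 * B w)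
    (ha : Integrable a κ) (hb : Integrable b κ) (hB : Integrable B κ) : Integrable (X ε) κ := by
  have h1 : Integrable (fun w => ε * a w + ε ^ 2 * b w / 2) κ :=
    (ha.const_mul ε).add ((hb.const_mul (ε ^ 2)).div_const 2)
  have h2 : Integrable (fun w => X ε w - (ε * a w + ε ^ 2 * b w / 2)) κ :=
    (hB.const_mul (|ε| ^ 3)).mono' ((hX ε hε).aestronglyMeasurable.sub h1.aestronglyMeasurable)
      (ae_of_all _ fun w => hT ε hε w)
  refine (h2.add h1).congr (ae_of_all _ fun w => ?_)
  simp

variable [IsProbabilityMeasure κ]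

/-- Normalization removes exp Y − 1 from the integral. The identity expresses the Kullback–Leibler
divergence −∫ Y as the integral of a nonnegative function, which is what Fatou's lemma needs later.
-/
theorem integral_exp_sub_one_sub {Y : 𝒲 → ℝ} (hY : Integrable Y κ)
    (hexp : ∫⁻ w, ENNReal.ofReal (Real.exp (Y w)) ∂κ = 1) :
    Integrable (fun w => Real.exp (Y w)) κ ∧ ∫ w, (Real.exp (Y w) - 1 - Y w) ∂κ = -∫ w, Y w ∂κ := by
  have h1 : Integrable (fun w => Real.exp (Y w)) κ :=
    ⟨Real.continuous_exp.comp_aestronglyMeasurable hY.aestronglyMeasurable, by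
      rw [hasFiniteIntegral_iff_ofReal (ae_of_all _ fun w => (Real.exp_pos _).le), hexp]
      exact ENNReal.one_lt_top⟩
  refine ⟨h1, ?_⟩
  have h2 : ∫ w, Real.exp (Y w) ∂κ = 1 := by
    rw [integral_eq_lintegral_of_nonneg_ae (ae_of_all _ fun w => (Real.exp_pos _).le)
      h1.aestronglyMeasurable, hexp, ENNReal.toReal_one]
  have h3 : Integrable (fun w => Real.exp (Y w) - 1) κ := h1.sub (integrable_const 1)
  rw [integral_sub h3 hY, integral_sub h1 (integrable_const _), h2]
  simp

/-- Minus the integral of the log likelihood ratio is a divergence, hence nonnegative; the lower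
Taylor bound on the ratio bounds it from above. -/
theorem integral_taylor_le_zero {ε : ℝ} (hε : |ε| < ε₀)
    (hX : ∀ ε, |ε| < ε₀ → Measurable (X ε))
    (hexp : ∀ ε, |ε| < ε₀ → ∫⁻ w, ENNReal.ofReal (Real.exp (X ε w)) ∂κ = 1)
    (hT : ∀ ε, |ε| < ε₀ → ∀ w, |X ε w - (ε * a w + ε ^ 2 * b w / 2)| ≤ |ε| ^ 3 * B w)
    (ha : Integrable a κ) (hb : Integrable b κ) (hB : Integrable B κ) :
    0 ≤ -∫ w, X ε w ∂κ ∧ -∫ w, X ε w ∂κ ≤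
      -(ε * ∫ w, a w ∂κ) - ε ^ 2 * (∫ w, b w ∂κ) / 2 + |ε| ^ 3 * ∫ w, B w ∂κ := by
  have hXi := integrable_of_abs_sub_taylor_le hε hX hT ha hb hB
  obtain ⟨h1, h2⟩ := integral_exp_sub_one_sub hXi (hexp ε hε)
  constructor
  · rw [← h2]
    exact integral_nonneg fun w => by have := Real.add_one_le_exp (X ε w); simp; linarith
  · have h3 : ∫ w, (ε * a w + ε ^ 2 * b w / 2 - |ε| ^ 3 * B w) ∂κ ≤ ∫ w, X ε w ∂κ := by
      refine integral_mono (((ha.const_mul ε).fun_add ((hb.const_mul (ε ^ 2)).div_const 2)).sub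
        (hB.const_mul _)) hXi fun w => ?_
      have := (abs_le.mp (hT ε hε w)).1
      simp only
      linarith
    rw [integral_sub ((ha.const_mul ε).fun_add ((hb.const_mul (ε ^ 2)).div_const 2))
        (hB.const_mul _), integral_add (ha.const_mul ε) ((hb.const_mul (ε ^ 2)).div_const 2),
      integral_const_mul, integral_div, integral_const_mul, integral_const_mul] at h3
    linarith

/-- The score has mean zero. -/
theorem integral_score_eq_zero (h0 : 0 < ε₀)
    (hX : ∀ ε, |ε| < ε₀ → Measurable (X ε))
    (hexp : ∀ ε, |ε| < ε₀ → ∫⁻ w, ENNReal.ofReal (Real.exp (X ε w)) ∂κ = 1)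
    (hT : ∀ ε, |ε| < ε₀ → ∀ w, |X ε w - (ε * a w + ε ^ 2 * b w / 2)| ≤ |ε| ^ 3 * B w)
    (ha : Integrable a κ) (hb : Integrable b κ) (hB : Integrable B κ) : ∫ w, a w ∂κ = 0 := by
  -- The linear term must be dominated by the higher-order ones for both signs of ε, which forces
  -- its coefficient to vanish.
  have key : ∀ ε, |ε| < ε₀ → 0 ≤ -(ε * ∫ w, a w ∂κ) - ε ^ 2 * (∫ w, b w ∂κ) / 2 +
      |ε| ^ 3 * ∫ w, B w ∂κ := fun ε hε =>
    let h := integral_taylor_le_zero hε hX hexp hT ha hb hB; h.1.trans h.2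
  have hb3 : ∀ ε, 0 < ε → ε < ε₀ → ε ^ 3 * ∫ w, B w ∂κ ≤ ε ^ 2 * (ε₀ * |∫ w, B w ∂κ|) := by
    intro ε h1 h2
    calc ε ^ 3 * ∫ w, B w ∂κ ≤ ε ^ 3 * |∫ w, B w ∂κ| := by
          gcongr; exact le_abs_self _
      _ = ε ^ 2 * (ε * |∫ w, B w ∂κ|) := by ring
      _ ≤ _ := by gcongr
  refine le_antisymm ?_ ?_
  · refine nonpos_of_forall_mul_le_sq (C := -(∫ w, b w ∂κ) / 2 + ε₀ * |∫ w, B w ∂κ|) h0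
      fun ε h1 h2 => ?_
    have := key ε (by rwa [abs_of_pos h1])
    rw [abs_of_pos h1] at this
    linarith [hb3 ε h1 h2]
  · rw [← neg_nonpos]
    refine nonpos_of_forall_mul_le_sq (C := -(∫ w, b w ∂κ) / 2 + ε₀ * |∫ w, B w ∂κ|) h0
      fun ε h1 h2 => ?_
    have := key (-ε) (by rwa [abs_neg, abs_of_pos h1])
    rw [abs_neg, abs_of_pos h1, neg_sq] at this
    linarith [hb3 ε h1 h2]

theorem tendsto_exp_sub_one_sub_div_sq {x ε : ℕ → ℝ} {c : ℝ} (hε : ∀ n, 0 < ε n)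
    (hε0 : Tendsto ε atTop (𝓝 0)) (hx : Tendsto x atTop (𝓝 c)) :
    Tendsto (fun n => (Real.exp (ε n * x n) - 1 - ε n * x n) / ε n ^ 2) atTop
      (𝓝 (c ^ 2 / 2)) := by
  have h1 : Tendsto (fun n => ε n * x n) atTop (𝓝 0) := by simpa using hε0.mul hx
  have h2 : Tendsto (fun n => ε n * |x n| ^ 3) atTop (𝓝 0) := by
    simpa using hε0.mul (hx.abs.pow 3)
  have h3 : Tendsto (fun n => x n ^ 2 / 2) atTop (𝓝 (c ^ 2 / 2)) := (hx.pow 2).div_const 2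
  have h4 : Tendsto (fun n => (Real.exp (ε n * x n) - 1 - ε n * x n) / ε n ^ 2 - x n ^ 2 / 2)
      atTop (𝓝 0) := by
    refine squeeze_zero_norm' ?_ h2
    have : ∀ᶠ n in atTop, |ε n * x n| ≤ 1 :=
      (h1.abs.eventually_lt_const (by simp : |(0 : ℝ)| < 1)).mono fun n h => h.le
    filter_upwards [this] with n hn
    have h5 := Real.exp_bound hn (n := 3) (by norm_num)
    have hp := hε n
    simp only [Finset.sum_range_succ, Finset.sum_range_zero, Nat.factorial] at h5
    have h6 : (Real.exp (ε n * x n) - 1 - ε n * x n) / ε n ^ 2 - x n ^ 2 / 2 =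
        (Real.exp (ε n * x n) - (1 + ε n * x n + (ε n * x n) ^ 2 / 2)) / ε n ^ 2 := by
      field_simp; ring
    rw [Real.norm_eq_abs, h6, abs_div, abs_of_pos (pow_pos hp 2), div_le_iff₀ (pow_pos hp 2)]
    have h7 : |Real.exp (ε n * x n) - (1 + ε n * x n + (ε n * x n) ^ 2 / 2)| ≤
        |ε n * x n| ^ 3 := by
      refine le_trans ?_ (h5.trans ?_)
      · apply le_of_eq; congr 1; norm_num
      · exact mul_le_of_le_one_right (pow_nonneg (abs_nonneg _) 3) (by norm_num [Nat.factorial])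
    refine h7.trans (le_of_eq ?_)
    rw [abs_mul, abs_of_pos hp]; ring
  simpa using h4.add h3

/-- The information inequality: the expected outer product of the score is at most minus
the expected derivative of the score. -/
theorem integral_sq_score_add_deriv_le_zero (h0 : 0 < ε₀)
    (hX : ∀ ε, |ε| < ε₀ → Measurable (X ε))
    (hexp : ∀ ε, |ε| < ε₀ → ∫⁻ w, ENNReal.ofReal (Real.exp (X ε w)) ∂κ = 1)
    (hT : ∀ ε, |ε| < ε₀ → ∀ w, |X ε w - (ε * a w + ε ^ 2 * b w / 2)| ≤ |ε| ^ 3 * B w)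
    (ha : Integrable a κ) (hb : Integrable b κ) (hB : Integrable B κ)
    (ha2 : Integrable (fun w => a w ^ 2) κ) : ∫ w, a w ^ 2 ∂κ + ∫ w, b w ∂κ ≤ 0 := by
  have hza := integral_score_eq_zero h0 hX hexp hT ha hb hB
  set ε : ℕ → ℝ := fun n => ε₀ / ((n : ℝ) + 2) with hεd
  have hε : ∀ n, 0 < ε n := fun n => by positivity
  have hεlt : ∀ n, |ε n| < ε₀ := fun n => by
    rw [abs_of_pos (hε n), hεd, div_lt_iff₀ (by positivity)]
    nlinarith [(Nat.cast_nonneg n : (0 : ℝ) ≤ n)]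
  have hε0 : Tendsto ε atTop (𝓝 0) :=
    tendsto_const_nhds.div_atTop (tendsto_atTop_add_const_right _ _ tendsto_natCast_atTop_atTop)
  set f : ℕ → 𝒲 → ℝ := fun n w => (Real.exp (X (ε n) w) - 1 - X (ε n) w) / ε n ^ 2 with hf
  have hf0 : ∀ n w, 0 ≤ f n w := fun n w => by
    have := Real.add_one_le_exp (X (ε n) w)
    exact div_nonneg (by linarith) (sq_nonneg _)
  have hlim : ∀ w, Tendsto (fun n => f n w) atTop (𝓝 (a w ^ 2 / 2)) := fun w => by
    have hx : Tendsto (fun n => X (ε n) w / ε n) atTop (𝓝 (a w)) := by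
      have h1 : Tendsto (fun n => ε n * b w / 2 + a w) atTop (𝓝 (a w)) := by
        simpa using ((hε0.mul_const (b w)).div_const 2).add_const (a w)
      have h2 : Tendsto (fun n => X (ε n) w / ε n - (ε n * b w / 2 + a w)) atTop (𝓝 0) := by
        refine squeeze_zero_norm (a := fun n => ε n ^ 2 * B w) (fun n => ?_)
          (by simpa using (hε0.pow 2).mul_const (B w))
        have hp := hε n
        have h3 := hT (ε n) (hεlt n) w
        rw [abs_of_pos hp] at h3
        have h4 : X (ε n) w / ε n - (ε n * b w / 2 + a w) =
            (X (ε n) w - (ε n * a w + ε n ^ 2 * b w / 2)) / ε n := by field_simp; ring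
        rw [Real.norm_eq_abs, h4, abs_div, abs_of_pos hp, div_le_iff₀ hp]
        exact h3.trans (le_of_eq (by ring))
      simpa using h2.add h1
    have := tendsto_exp_sub_one_sub_div_sq hε hε0 hx
    refine this.congr fun n => ?_
    rw [mul_div_cancel₀ _ (hε n).ne']
  -- The linear term of the upper bound is gone because the score has mean zero, so division by ε²
  -- leaves a bounded quantity.
  have hfi : ∀ n, ∫⁻ w, ENNReal.ofReal (f n w) ∂κ ≤
      ENNReal.ofReal (-(∫ w, b w ∂κ) / 2 + ε n * ∫ w, B w ∂κ) := fun n => by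
    have hXi := integrable_of_abs_sub_taylor_le (hεlt n) hX hT ha hb hB
    obtain ⟨h1, h2⟩ := integral_exp_sub_one_sub hXi (hexp _ (hεlt n))
    have h3 : Integrable (f n) κ := ((h1.sub (integrable_const 1)).sub hXi).div_const _
    rw [← ofReal_integral_eq_lintegral_ofReal h3 (ae_of_all _ (hf0 n))]
    refine ENNReal.ofReal_le_ofReal ?_
    have h4 := (integral_taylor_le_zero (hεlt n) hX hexp hT ha hb hB).2
    rw [hza, abs_of_pos (hε n)] at h4
    have hp := hε n
    rw [hf]
    simp only
    rw [integral_div, h2, div_le_iff₀ (pow_pos hp 2)]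
    linarith
  have hfatou : ∫⁻ w, ENNReal.ofReal (a w ^ 2 / 2) ∂κ ≤ ENNReal.ofReal (-(∫ w, b w ∂κ) / 2) := by
    calc ∫⁻ w, ENNReal.ofReal (a w ^ 2 / 2) ∂κ
        = ∫⁻ w, liminf (fun n => ENNReal.ofReal (f n w)) atTop ∂κ := by
          refine lintegral_congr fun w => ?_
          exact ((ENNReal.continuous_ofReal.tendsto _).comp (hlim w)).liminf_eq.symm
      _ ≤ liminf (fun n => ∫⁻ w, ENNReal.ofReal (f n w) ∂κ) atTop := by
          refine lintegral_liminf_le fun n => ?_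
          have := hX _ (hεlt n)
          exact ENNReal.measurable_ofReal.comp
            (((Real.measurable_exp.comp this).sub_const 1 |>.sub this).div_const _)
      _ ≤ liminf (fun n => ENNReal.ofReal (-(∫ w, b w ∂κ) / 2 + ε n * ∫ w, B w ∂κ)) atTop :=
          liminf_le_liminf (Eventually.of_forall hfi)
      _ = _ := by
          have h5 : Tendsto (fun n => -(∫ w, b w ∂κ) / 2 + ε n * ∫ w, B w ∂κ) atTop
              (𝓝 (-(∫ w, b w ∂κ) / 2)) := by
            simpa using (hε0.mul_const (∫ w, B w ∂κ)).const_add (-(∫ w, b w ∂κ) / 2)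
          exact ((ENNReal.continuous_ofReal.tendsto _).comp h5).liminf_eq
  rw [← ofReal_integral_eq_lintegral_ofReal (ha2.div_const 2)
    (ae_of_all _ fun w => div_nonneg (sq_nonneg _) (by norm_num)), integral_div] at hfatou
  have hn : 0 ≤ ∫ w, a w ^ 2 ∂κ := integral_nonneg fun w => sq_nonneg _
  -- `ENNReal.ofReal` truncates at zero, so the Fatou bound says something about the real integral
  -- only once its right-hand side is known to be nonnegative; nonnegativity of the divergence gives
  -- that.
  have hbn : 0 ≤ -(∫ w, b w ∂κ) / 2 := by
    have h5 : Tendsto (fun n => -(∫ w, b w ∂κ) / 2 + ε n * ∫ w, B w ∂κ) atTop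
        (𝓝 (-(∫ w, b w ∂κ) / 2)) := by
      simpa using (hε0.mul_const (∫ w, B w ∂κ)).const_add (-(∫ w, b w ∂κ) / 2)
    refine ge_of_tendsto' h5 fun n => ?_
    have h := integral_taylor_le_zero (hεlt n) hX hexp hT ha hb hB
    have h4 := h.1.trans h.2
    have hp := hε n
    rw [hza, abs_of_pos hp] at h4
    have : 0 ≤ ε n ^ 2 * (-(∫ w, b w ∂κ) / 2 + ε n * ∫ w, B w ∂κ) := by linarith
    exact nonneg_of_mul_nonneg_right this (pow_pos hp 2)
  have := (ENNReal.ofReal_le_ofReal_iff hbn).mp hfatou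
  linarith

end Bartlett

/-! ### Lenglart's inequality and a weak law for variables centred with a lag of M periods. -/

section LaggedMartingale

variable {Ω : Type*} {m0 : MeasurableSpace Ω} {P : Measure Ω}

/-- Terms are kept only while the running total stays below η. If the last total is below η it
bounds the kept terms; otherwise the last term is dropped and induction applies. -/
theorem sum_ite_partialSum_le {v : ℕ → ℝ} (hv : ∀ t, 0 ≤ v t) {η : ℝ} (hη : 0 ≤ η) (N T : ℕ) :
    ∑ t ∈ Finset.Icc N T, (if ∑ s ∈ Finset.Icc N t, v s ≤ η then v t else 0) ≤ η := by
  induction T with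
  | zero =>
    rcases Nat.eq_zero_or_pos N with rfl | hN
    · simp only [Finset.Icc_self, Finset.sum_singleton]
      split_ifs with h <;> assumption
    · rw [Finset.Icc_eq_empty (by omega)]; simpa
  | succ T ih =>
    by_cases hN : N ≤ T + 1
    · by_cases h : ∑ s ∈ Finset.Icc N (T + 1), v s ≤ η
      · refine le_trans (Finset.sum_le_sum fun t _ => ?_) h
        split_ifs
        exacts [le_rfl, hv t]
      · rw [Finset.sum_Icc_succ_top hN, if_neg h, add_zero]; exact ih
    · rw [Finset.Icc_eq_empty hN]; simpa

theorem measure_ge_le_ofReal_integral_div [IsFiniteMeasure P] {f : Ω → ℝ} (hf : Integrable f P)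
    (h0 : 0 ≤ᵐ[P] f) {c I : ℝ} (hc : 0 < c) (hI : ∫ ω, f ω ∂P ≤ I) :
    P {ω | c ≤ f ω} ≤ ENNReal.ofReal (I / c) := by
  have h1 := mul_meas_ge_le_integral_of_nonneg h0 hf c
  have h2 : P.real {ω | c ≤ f ω} ≤ I / c := by
    rw [le_div_iff₀ hc, mul_comm]; exact h1.trans hI
  rw [← ENNReal.ofReal_toReal (measure_ne_top P _)]
  exact ENNReal.ofReal_le_ofReal h2

/-- The event that the sum of the `v s`, `N ≤ s ≤ t`, is at most `η`. -/
def partialSumLe (v : ℕ → Ω → ℝ) (η : ℝ) (N t : ℕ) : Set Ω :=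
  {ω | ∑ s ∈ Finset.Icc N t, v s ω ≤ η}

theorem measurableSet_partialSumLe {v : ℕ → Ω → ℝ} {G : ℕ → MeasurableSpace Ω}
    (hG : Monotone G) (hv : ∀ t, Measurable[G t] (v t)) (η : ℝ) (N t : ℕ) :
    MeasurableSet[G t] (partialSumLe v η N t) := by
  have : Measurable[G t] fun ω => ∑ s ∈ Finset.Icc N t, v s ω :=
    Finset.measurable_fun_sum _ fun s hs =>
      (hv s).mono (hG (Finset.mem_Icc.mp hs).2) le_rfl
  exact @measurableSet_le _ _ _ _ _ (G t) _ _ _ _ _ this measurable_const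

theorem ae_mem_partialSumLe {v : ℕ → Ω → ℝ} (hv : ∀ t, 0 ≤ᵐ[P] v t) (η : ℝ) (N T : ℕ) :
    ∀ᵐ ω ∂P, ω ∈ partialSumLe v η N T → ∀ t ∈ Finset.Icc N T, ω ∈ partialSumLe v η N t := by
  filter_upwards [ae_all_iff.mpr hv] with ω hω hT t ht
  refine le_trans (Finset.sum_le_sum_of_subset_of_nonneg ?_ fun s _ _ => hω s) hT
  exact Finset.Icc_subset_Icc_right (Finset.mem_Icc.mp ht).2

variable [IsProbabilityMeasure P] {F : ℕ → MeasurableSpace Ω}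

/-- The event at time t is measurable with respect to `F (t - M)`, so under the integral `a t` may
be replaced by its conditional expectation; the stopped sum of these is at most η pointwise. -/
theorem sum_integral_indicator_partialSumLe_le (hF : ∀ t, F t ≤ m0) (hmono : Monotone F)
    (M : ℕ) {a : ℕ → Ω → ℝ} {N : ℕ} (ha : ∀ t, N ≤ t → Integrable (a t) P)
    (ha0 : ∀ t, 0 ≤ᵐ[P] a t) {η : ℝ} (hη : 0 ≤ η) (T : ℕ) :
    ∑ t ∈ Finset.Icc N T,
      ∫ ω, (partialSumLe (fun s => P[a s | F (s - M)]) η N t).indicator (a t) ω ∂P ≤ η := by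
  set v : ℕ → Ω → ℝ := fun s => P[a s | F (s - M)] with hv
  have hG : Monotone fun t => F (t - M) := fun s t h => hmono (Nat.sub_le_sub_right h M)
  have hvm : ∀ t, Measurable[F (t - M)] (v t) := fun t => stronglyMeasurable_condExp.measurable
  have hI : ∀ t, MeasurableSet[F (t - M)] (partialSumLe v η N t) := fun t =>
    measurableSet_partialSumLe hG hvm η N t
  have hv0 : ∀ t, 0 ≤ᵐ[P] v t := fun t => condExp_nonneg (ha0 t)
  have h1 : ∀ t ∈ Finset.Icc N T, ∫ ω, (partialSumLe v η N t).indicator (a t) ω ∂P =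
      ∫ ω, (partialSumLe v η N t).indicator (v t) ω ∂P := fun t ht => by
    rw [integral_indicator (hF _ _ (hI t)), integral_indicator (hF _ _ (hI t)), hv,
      setIntegral_condExp (hF _) (ha t (Finset.mem_Icc.mp ht).1) (hI t)]
  rw [Finset.sum_congr rfl h1, ← integral_finsetSum _ fun t _ =>
    integrable_condExp.indicator (hF _ _ (hI t))]
  calc _ ≤ ∫ _, η ∂P := by
        refine integral_mono_ae (integrable_finsetSum _ fun t _ =>
          integrable_condExp.indicator (hF _ _ (hI t))) (integrable_const _) ?_
        filter_upwards [ae_all_iff.mpr hv0] with ω hω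
        refine le_trans (le_of_eq ?_) (sum_ite_partialSum_le (v := fun t => v t ω) hω hη N T)
        refine Finset.sum_congr rfl fun t _ => ?_
        by_cases h : ω ∈ partialSumLe v η N t
        · rw [Set.indicator_of_mem h]; exact (if_pos h).symm
        · rw [Set.indicator_of_notMem h]; exact (if_neg h).symm
    _ = η := by simp

/-- Lenglart's inequality: a sum of nonnegative variables is controlled in probability by the sum
of their conditional expectations. -/
theorem measure_sum_gt_le (hF : ∀ t, F t ≤ m0) (hmono : Monotone F)
    (M : ℕ) {a : ℕ → Ω → ℝ} {N : ℕ} (ha : ∀ t, N ≤ t → Integrable (a t) P)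
    (ha0 : ∀ t, 0 ≤ᵐ[P] a t) {η c : ℝ} (hη : 0 ≤ η) (hc : 0 < c) (T : ℕ) :
    P {ω | c < ∑ t ∈ Finset.Icc N T, a t ω} ≤
      P {ω | η < ∑ t ∈ Finset.Icc N T, (P[a t | F (t - M)]) ω} + ENNReal.ofReal (η / c) := by
  set v : ℕ → Ω → ℝ := fun s => P[a s | F (s - M)] with hv
  have hG : Monotone fun t => F (t - M) := fun s t h => hmono (Nat.sub_le_sub_right h M)
  have hI : ∀ t, MeasurableSet (partialSumLe v η N t) := fun t => hF _ _
    (measurableSet_partialSumLe hG (fun t => stronglyMeasurable_condExp.measurable) η N t)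
  set b : Ω → ℝ := fun ω =>
    ∑ t ∈ Finset.Icc N T, (partialSumLe v η N t).indicator (a t) ω with hb
  have hbi : ∀ t ∈ Finset.Icc N T, Integrable ((partialSumLe v η N t).indicator (a t)) P :=
    fun t ht => (ha t (Finset.mem_Icc.mp ht).1).indicator (hI t)
  have h1 : P {ω | c ≤ b ω} ≤ ENNReal.ofReal (η / c) := by
    refine measure_ge_le_ofReal_integral_div (integrable_finsetSum _ hbi) ?_ hc ?_
    · filter_upwards [ae_all_iff.mpr ha0] with ω hω
      exact Finset.sum_nonneg fun t _ => Set.indicator_apply_nonneg fun _ => hω t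
    · rw [integral_finsetSum _ hbi]
      exact sum_integral_indicator_partialSumLe_le hF hmono M ha ha0 hη T
  refine le_trans ?_ ((measure_union_le _ _).trans (add_le_add_right h1 _))
  refine measure_mono_ae ?_
  -- The partial sums increase, so when the last one does not exceed η no term has been stopped and
  -- the stopped sum is the full one.
  filter_upwards [ae_mem_partialSumLe (fun t => condExp_nonneg (ha0 t)) η N T] with ω hω hc'
  by_cases h : η < ∑ t ∈ Finset.Icc N T, v t ω
  · exact Or.inl h
  · refine Or.inr (le_of_lt (lt_of_lt_of_le hc' (le_of_eq ?_)))
    exact Finset.sum_congr rfl fun t ht => (Set.indicator_of_mem (hω (not_lt.mp h) t ht) _).symm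

/-- Variables that are centred given the past before the last `M` periods are almost
orthogonal. -/
theorem integral_sum_sq_le (hF : ∀ t, F t ≤ m0) (hmono : Monotone F) {M : ℕ} {u : ℕ → Ω → ℝ}
    (s : Finset ℕ) (hu : ∀ t ∈ s, StronglyMeasurable[F t] (u t)) (hL : ∀ t ∈ s, MemLp (u t) 2 P)
    (h0 : ∀ t ∈ s, P[u t | F (t - M)] =ᵐ[P] 0) :
    ∫ ω, (∑ t ∈ s, u t ω) ^ 2 ∂P ≤ 2 * M * ∑ t ∈ s, ∫ ω, u t ω ^ 2 ∂P := by
  have hint : ∀ i ∈ s, ∀ j ∈ s, Integrable (fun ω => u i ω * u j ω) P := fun i hi j hj =>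
    (hL i hi).integrable_mul (hL j hj)
  -- For indices at least M apart the earlier variable is known at the time with respect to which
  -- the later one is centred.
  have horth : ∀ i ∈ s, ∀ j ∈ s, i + M ≤ j → ∫ ω, u i ω * u j ω ∂P = 0 := by
    intro i hi j hj hij
    have h1 : P[u i * u j | F (j - M)] =ᵐ[P] u i * P[u j | F (j - M)] :=
      condExp_mul_of_stronglyMeasurable_left ((hu i hi).mono (hmono (by omega)))
        (hint i hi j hj) ((hL j hj).integrable (by norm_num))
    have h2 : ∫ ω, (u i * u j) ω ∂P = ∫ ω, (P[u i * u j | F (j - M)]) ω ∂P :=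
      (integral_condExp (hF _)).symm
    have h3 : P[u i * u j | F (j - M)] =ᵐ[P] 0 := by
      filter_upwards [h1, h0 j hj] with ω e1 e2
      rw [e1]; simp [e2]
    rw [show (∫ ω, u i ω * u j ω ∂P) = ∫ ω, (u i * u j) ω ∂P from rfl, h2, integral_congr_ae h3]
    simp
  set q : ℕ → ℝ := fun i => ∫ ω, u i ω ^ 2 ∂P with hq
  have hq0 : ∀ i, 0 ≤ q i := fun i => integral_nonneg fun _ => sq_nonneg _
  have hsq : ∀ i ∈ s, Integrable (fun ω => u i ω ^ 2) P := fun i hi => (hL i hi).integrable_sq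
  have hbd : ∀ i ∈ s, ∀ j ∈ s, ∫ ω, u i ω * u j ω ∂P ≤
      if i < j + M ∧ j < i + M then (q i + q j) / 2 else 0 := by
    intro i hi j hj
    split_ifs with h
    · rw [hq]
      simp only
      rw [← integral_add (hsq i hi) (hsq j hj), ← integral_div]
      refine integral_mono (hint i hi j hj) (((hsq i hi).add (hsq j hj)).div_const 2) fun ω => ?_
      have := sq_nonneg (u i ω - u j ω)
      simp only
      nlinarith
    · rw [not_and_or, not_lt, not_lt] at h
      rcases h with h | h
      · rw [← horth j hj i hi h]; simp_rw [mul_comm]; rfl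
      · exact (horth i hi j hj h).le
  -- Only indices fewer than M steps from i contribute, and there are at most 2M of them.
  have hcard : ∀ i, ((s.filter fun j => i < j + M ∧ j < i + M).card : ℝ) ≤ 2 * M := fun i => by
    have : (s.filter fun j => i < j + M ∧ j < i + M) ⊆ Finset.Ico (i + 1 - M) (i + M) :=
      fun j hj => by
        simp only [Finset.mem_filter] at hj
        simp only [Finset.mem_Ico]; omega
    have h2 := Finset.card_le_card this
    rw [Nat.card_Ico] at h2
    have h3 : (s.filter fun j => i < j + M ∧ j < i + M).card ≤ 2 * M := by omega
    exact_mod_cast h3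
  calc ∫ ω, (∑ t ∈ s, u t ω) ^ 2 ∂P = ∑ i ∈ s, ∑ j ∈ s, ∫ ω, u i ω * u j ω ∂P := by
        simp_rw [sq, Finset.sum_mul_sum]
        rw [integral_finsetSum _ fun i hi => integrable_finsetSum _ fun j hj => hint i hi j hj]
        exact Finset.sum_congr rfl fun i hi => integral_finsetSum _ fun j hj => hint i hi j hj
    _ ≤ ∑ i ∈ s, ∑ j ∈ s, (if i < j + M ∧ j < i + M then (q i + q j) / 2 else 0) :=
        Finset.sum_le_sum fun i hi => Finset.sum_le_sum fun j hj => hbd i hi j hj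
    _ = ∑ i ∈ s, ∑ j ∈ s, (if i < j + M ∧ j < i + M then q i else 0) := by
        have e : ∀ i j, (if i < j + M ∧ j < i + M then (q i + q j) / 2 else 0) =
            (if i < j + M ∧ j < i + M then q i else 0) / 2 +
            (if j < i + M ∧ i < j + M then q j else 0) / 2 := fun i j => by
          by_cases h : i < j + M ∧ j < i + M
          · rw [if_pos h, if_pos h, if_pos h.symm]; ring
          · rw [if_neg h, if_neg h, if_neg fun h' => h h'.symm]; ring
        simp_rw [e, Finset.sum_add_distrib, ← Finset.sum_div]
        rw [Finset.sum_comm (f := fun i j => if j < i + M ∧ i < j + M then q j else 0)]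
        ring
    _ ≤ ∑ i ∈ s, 2 * M * q i := by
        refine Finset.sum_le_sum fun i _ => ?_
        rw [← Finset.sum_filter, Finset.sum_const, nsmul_eq_mul]
        exact mul_le_mul_of_nonneg_right (hcard i) (hq0 i)
    _ = _ := by rw [Finset.mul_sum]

/-- Conditional expectation is an orthogonal projection: the second moment drops by exactly that of
the projection. -/
theorem integral_sub_condExp_sq_le {m : MeasurableSpace Ω} (hm : m ≤ m0) {y : Ω → ℝ}
    (hy : MemLp y 2 P) (hy' : MemLp (P[y | m]) 2 P) :
    ∫ ω, (y ω - (P[y | m]) ω) ^ 2 ∂P ≤ ∫ ω, y ω ^ 2 ∂P := by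
  set b : Ω → ℝ := P[y | m] with hb
  have hyb : Integrable (fun ω => b ω * y ω) P := hy'.integrable_mul hy
  have h1 : P[b * y | m] =ᵐ[P] b * b :=
    condExp_mul_of_stronglyMeasurable_left stronglyMeasurable_condExp hyb
      (hy.integrable (by norm_num))
  have h2 : ∫ ω, b ω * y ω ∂P = ∫ ω, b ω ^ 2 ∂P := by
    rw [show (∫ ω, b ω * y ω ∂P) = ∫ ω, (b * y) ω ∂P from rfl, ← integral_condExp hm,
      integral_congr_ae h1]
    simp [sq]
  have e : ∀ ω, (y ω - b ω) ^ 2 = y ω ^ 2 - 2 * (b ω * y ω) + b ω ^ 2 := fun ω => by ring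
  simp_rw [e]
  have h3 : Integrable (fun ω => y ω ^ 2 - 2 * (b ω * y ω)) P :=
    hy.integrable_sq.sub (hyb.const_mul 2)
  rw [integral_add h3 hy'.integrable_sq,
    integral_sub hy.integrable_sq (hyb.const_mul 2), integral_const_mul, h2]
  have : 0 ≤ ∫ ω, b ω ^ 2 ∂P := integral_nonneg fun _ => sq_nonneg _
  linarith

theorem sq_le_rpow_of_abs_le_one {x r : ℝ} (hx : |x| ≤ 1) (hr0 : 0 < r) (hr : r ≤ 2) :
    x ^ 2 ≤ |x| ^ r := by
  rw [← sq_abs, ← Real.rpow_natCast]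
  rcases (abs_nonneg x).eq_or_lt with h | h
  · rw [← h, Real.zero_rpow (by norm_num), Real.zero_rpow hr0.ne']
  · exact Real.rpow_le_rpow_of_exponent_ge h hx (by simpa)

/-- Truncation at level 1. Where |x| ≤ 1, x² ≤ |x|^r because r ≤ 2, and the recentred small parts
are handled in L² by near orthogonality. Where |x| > 1, |x| ≤ |x|^r because r ≥ 1, and the large
parts are handled in L¹. Half of c goes to each part. -/
theorem measure_abs_sum_gt_le_of_sum_integral_rpow_le (hF : ∀ t, F t ≤ m0) (hmono : Monotone F)
    {M : ℕ} {x : ℕ → Ω → ℝ} {r : ℝ} (hr1 : 1 ≤ r) (hr2 : r ≤ 2) (s : Finset ℕ)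
    (hx : ∀ t ∈ s, StronglyMeasurable[F t] (x t)) (hi : ∀ t ∈ s, Integrable (x t) P)
    (h0 : ∀ t ∈ s, P[x t | F (t - M)] =ᵐ[P] 0)
    (hir : ∀ t ∈ s, Integrable (fun ω => |x t ω| ^ r) P) {η c : ℝ} (hc : 0 < c)
    (hη : ∑ t ∈ s, ∫ ω, |x t ω| ^ r ∂P ≤ η) :
    P {ω | c < |∑ t ∈ s, x t ω|} ≤ ENNReal.ofReal (4 * η / c + 8 * M * η / c ^ 2) := by
  have hη0 : 0 ≤ η := le_trans (Finset.sum_nonneg fun t _ =>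
    integral_nonneg fun ω => Real.rpow_nonneg (abs_nonneg _) r) hη
  have hr0 : 0 < r := by linarith
  set A : ℕ → Set Ω := fun t => {ω | |x t ω| ≤ 1} with hA
  have hAm : ∀ t ∈ s, MeasurableSet[F t] (A t) := fun t ht =>
    @measurableSet_le _ _ _ _ _ (F t) _ _ _ _ _
      (continuous_abs.measurable.comp (hx t ht).measurable) measurable_const
  set y : ℕ → Ω → ℝ := fun t => (A t).indicator (x t) with hy
  set z : ℕ → Ω → ℝ := fun t => (A t)ᶜ.indicator (x t) with hz
  have hym : ∀ t ∈ s, StronglyMeasurable[F t] (y t) := fun t ht => (hx t ht).indicator (hAm t ht)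
  have hyb : ∀ t ω, |y t ω| ≤ 1 := fun t ω => by
    by_cases h : ω ∈ A t
    · simp only [hy, Set.indicator_of_mem h]; exact h
    · simp [hy, Set.indicator_of_notMem h]
  have hyi : ∀ t ∈ s, Integrable (y t) P := fun t ht => (hi t ht).indicator (hF t _ (hAm t ht))
  have hzi : ∀ t ∈ s, Integrable (z t) P := fun t ht =>
    (hi t ht).indicator (hF t _ (hAm t ht)).compl
  have hyr : ∀ t ω, y t ω ^ 2 ≤ |x t ω| ^ r := fun t ω => by
    by_cases h : ω ∈ A t
    · simp only [hy, Set.indicator_of_mem h]; exact sq_le_rpow_of_abs_le_one h hr0 hr2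
    · simp only [hy, Set.indicator_of_notMem h]; simpa using Real.rpow_nonneg (abs_nonneg _) r
  have hzr : ∀ t ω, |z t ω| ≤ |x t ω| ^ r := fun t ω => by
    by_cases h : ω ∈ A t
    · have h' : ω ∉ (A t)ᶜ := by simpa using h
      simp only [hz, Set.indicator_of_notMem h', abs_zero]; exact Real.rpow_nonneg (abs_nonneg _) r
    · simp only [hz, Set.indicator_of_mem (show ω ∈ (A t)ᶜ from h)]
      exact Real.self_le_rpow_of_one_le (not_le.mp h).le hr1
  set U : ℕ → Ω → ℝ := fun t ω => y t ω - (P[y t | F (t - M)]) ω with hU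
  set V : ℕ → Ω → ℝ := fun t ω => z t ω - (P[z t | F (t - M)]) ω with hV
  have hyL : ∀ t ∈ s, MemLp (y t) 2 P := fun t ht =>
    MemLp.of_bound ((hym t ht).mono (hF t)).aestronglyMeasurable 1 (ae_of_all _ (hyb t))
  have hcL : ∀ t ∈ s, MemLp (P[y t | F (t - M)]) 2 P := fun t ht =>
    MemLp.of_bound (stronglyMeasurable_condExp.mono (hF _)).aestronglyMeasurable 1
      (ae_bdd_abs_condExp_of_ae_bdd_abs (R := (1 : ℝ)) (ae_of_all _ (hyb t)))
  -- Since x is centred, the conditional means subtracted from its two parts cancel.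
  have hsplit : ∀ᵐ ω ∂P, ∀ t ∈ s, x t ω = U t ω + V t ω := by
    rw [eventually_all_finset]
    intro t ht
    have h1 : P[y t + z t | F (t - M)] =ᵐ[P] P[y t | F (t - M)] + P[z t | F (t - M)] :=
      condExp_add (hyi t ht) (hzi t ht) _
    have h2 : y t + z t = x t := Set.indicator_self_add_compl _ _
    rw [h2] at h1
    filter_upwards [h1, h0 t ht] with ω e1 e2
    have e3 := congrFun h2 ω
    simp only [Pi.add_apply] at e1 e3
    rw [e2] at e1
    simp only [hU, hV, Pi.zero_apply] at e1 ⊢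
    linarith
  have hVb : P {ω | c / 2 ≤ ∑ t ∈ s, |V t ω|} ≤ ENNReal.ofReal (2 * η / (c / 2)) := by
    have hVi : ∀ t ∈ s, Integrable (fun ω => |V t ω|) P := fun t ht =>
      ((hzi t ht).sub integrable_condExp).abs
    refine measure_ge_le_ofReal_integral_div (integrable_finsetSum _ hVi)
      (ae_of_all _ fun ω => Finset.sum_nonneg fun t _ => abs_nonneg _) (by positivity) ?_
    rw [integral_finsetSum _ hVi]
    calc ∑ t ∈ s, ∫ ω, |V t ω| ∂P ≤ ∑ t ∈ s, 2 * ∫ ω, |x t ω| ^ r ∂P := by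
          refine Finset.sum_le_sum fun t ht => ?_
          have h1 : ∫ ω, |V t ω| ∂P ≤ ∫ ω, (|z t ω| + |(P[z t | F (t - M)]) ω|) ∂P :=
            integral_mono (hVi t ht) ((hzi t ht).abs.add integrable_condExp.abs)
              fun ω => abs_sub _ _
          rw [integral_add (hzi t ht).abs integrable_condExp.abs] at h1
          have h2 : ∫ ω, |z t ω| ∂P ≤ ∫ ω, |x t ω| ^ r ∂P :=
            integral_mono (hzi t ht).abs (hir t ht) (hzr t)
          have h3 := integral_abs_condExp_le (μ := P) (m := F (t - M)) (z t)
          linarith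
      _ ≤ 2 * η := by rw [← Finset.mul_sum]; linarith
  have hUb : P {ω | (c / 2) ^ 2 ≤ (∑ t ∈ s, U t ω) ^ 2} ≤
      ENNReal.ofReal (2 * M * η / (c / 2) ^ 2) := by
    have hUL : ∀ t ∈ s, MemLp (U t) 2 P := fun t ht => (hyL t ht).sub (hcL t ht)
    have hUm : ∀ t ∈ s, StronglyMeasurable[F t] (U t) := fun t ht =>
      (hym t ht).sub (stronglyMeasurable_condExp.mono (hmono (Nat.sub_le t M)))
    refine measure_ge_le_ofReal_integral_div (memLp_finsetSum s hUL).integrable_sq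
      (ae_of_all _ fun ω => sq_nonneg _) (by positivity) ?_
    refine (integral_sum_sq_le hF hmono (M := M) s hUm hUL fun t ht => ?_).trans ?_
    · have h1 : P[y t - P[y t | F (t - M)] | F (t - M)] =ᵐ[P]
          P[y t | F (t - M)] - P[P[y t | F (t - M)] | F (t - M)] :=
        condExp_sub (hyi t ht) integrable_condExp _
      have h2 : P[P[y t | F (t - M)] | F (t - M)] =ᵐ[P] P[y t | F (t - M)] :=
        condExp_condExp_of_le le_rfl (hF _)
      refine h1.trans ?_
      filter_upwards [h2] with ω e
      simp [e]
    · refine mul_le_mul_of_nonneg_left (le_trans (Finset.sum_le_sum fun t ht => ?_) hη)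
        (by positivity)
      exact (integral_sub_condExp_sq_le (hF _) (hyL t ht) (hcL t ht)).trans
        (integral_mono (hyL t ht).integrable_sq (hir t ht) (hyr t))
  calc P {ω | c < |∑ t ∈ s, x t ω|}
      ≤ P ({ω | c / 2 ≤ ∑ t ∈ s, |V t ω|} ∪ {ω | (c / 2) ^ 2 ≤ (∑ t ∈ s, U t ω) ^ 2}) := by
        refine measure_mono_ae ?_
        filter_upwards [hsplit] with ω hω hc'
        rcases le_or_gt (c / 2) (∑ t ∈ s, |V t ω|) with h1 | h1
        · exact Or.inl h1
        rcases le_or_gt ((c / 2) ^ 2) ((∑ t ∈ s, U t ω) ^ 2) with h2 | h2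
        · exact Or.inr h2
        exfalso
        have h3 : |∑ t ∈ s, U t ω| < c / 2 := by
          rw [← sq_abs (∑ t ∈ s, U t ω)] at h2
          exact lt_of_pow_lt_pow_left₀ 2 (by positivity) h2
        have h4 : |∑ t ∈ s, V t ω| < c / 2 := lt_of_le_of_lt (Finset.abs_sum_le_sum_abs _ _) h1
        have h5 : ∑ t ∈ s, x t ω = ∑ t ∈ s, U t ω + ∑ t ∈ s, V t ω := by
          rw [← Finset.sum_add_distrib]; exact Finset.sum_congr rfl hω
        have h6 : c < |∑ t ∈ s, x t ω| := hc'
        rw [h5] at h6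
        have := abs_add_le (∑ t ∈ s, U t ω) (∑ t ∈ s, V t ω)
        linarith
    _ ≤ ENNReal.ofReal (2 * η / (c / 2)) + ENNReal.ofReal (2 * M * η / (c / 2) ^ 2) :=
        (measure_union_le _ _).trans (add_le_add hVb hUb)
    _ = _ := by
        rw [← ENNReal.ofReal_add (by positivity) (by positivity)]
        congr 1
        field_simp
        ring

/-- Weak law of large numbers for variables that are centred given the past before the last
`M` periods. -/
theorem measure_abs_sum_gt_le (hF : ∀ t, F t ≤ m0) (hmono : Monotone F)
    {M N : ℕ} {x : ℕ → Ω → ℝ} {r : ℝ} (hr0 : 0 < r) (hr2 : r ≤ 2)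
    (hx : ∀ t, N ≤ t → StronglyMeasurable[F t] (x t)) (hi : ∀ t, N ≤ t → Integrable (x t) P)
    (h0 : ∀ t, N ≤ t → P[x t | F (t - M)] =ᵐ[P] 0)
    (hir : ∀ t, N ≤ t → Integrable (fun ω => |x t ω| ^ r) P) {η c : ℝ} (hη : 0 ≤ η) (hc : 0 < c)
    (T : ℕ) :
    P {ω | c < |∑ t ∈ Finset.Icc N T, x t ω|} ≤
      P {ω | η < ∑ t ∈ Finset.Icc N T, (P[fun ω => |x t ω| ^ r | F (t - M)]) ω} +
        ENNReal.ofReal (η / c ^ r + 4 * η / c + 8 * M * η / c ^ 2) := by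
  have ha0 : ∀ t, 0 ≤ᵐ[P] fun ω => |x t ω| ^ r := fun t =>
    ae_of_all _ fun ω => Real.rpow_nonneg (abs_nonneg _) r
  rcases le_total r 1 with hr1 | hr1
  -- For r ≤ 1 the map x ↦ x^r is subadditive, so Lenglart's inequality for the sum of the |x|^r
  -- suffices and centring plays no role.
  · refine le_trans (measure_mono fun ω hω => ?_)
      ((measure_sum_gt_le hF hmono M hir ha0 hη (Real.rpow_pos_of_pos hc r) T).trans
        (add_le_add_right (ENNReal.ofReal_le_ofReal ?_) _))
    · have h1 : c < ∑ t ∈ Finset.Icc N T, |x t ω| :=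
        lt_of_lt_of_le hω (Finset.abs_sum_le_sum_abs _ _)
      refine lt_of_lt_of_le (Real.rpow_lt_rpow hc.le h1 hr0) ?_
      have key : ∀ s : Finset ℕ, (∑ t ∈ s, |x t ω|) ^ r ≤ ∑ t ∈ s, |x t ω| ^ r := by
        intro s
        induction s using Finset.induction_on with
        | empty => simp [Real.zero_rpow hr0.ne']
        | insert a s ha ih =>
          rw [Finset.sum_insert ha, Finset.sum_insert ha]
          exact (Real.rpow_add_le_add_rpow (abs_nonneg _)
            (Finset.sum_nonneg fun _ _ => abs_nonneg _) hr0.le hr1).trans (by gcongr)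
      exact key _
    · have : 0 ≤ 4 * η / c + 8 * M * η / c ^ 2 := by positivity
      linarith
  -- For r ≥ 1 the variables are stopped first. The stopping events lie in `F (t - M)`, so the
  -- stopped variables remain centred, and the sum of their r-th moments is at most η.
  · set v : ℕ → Ω → ℝ := fun t => P[fun ω => |x t ω| ^ r | F (t - M)] with hv
    have hG : Monotone fun t => F (t - M) := fun s t h => hmono (Nat.sub_le_sub_right h M)
    have hI : ∀ t, MeasurableSet[F (t - M)] (partialSumLe v η N t) := fun t =>
      measurableSet_partialSumLe hG (fun t => stronglyMeasurable_condExp.measurable) η N t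
    have hIm : ∀ t, MeasurableSet (partialSumLe v η N t) := fun t => hF _ _ (hI t)
    have hpow : ∀ t, (fun ω => |(partialSumLe v η N t).indicator (x t) ω| ^ r) =
        (partialSumLe v η N t).indicator (fun ω => |x t ω| ^ r) := fun t => by
      ext ω
      by_cases h : ω ∈ partialSumLe v η N t
      · simp [Set.indicator_of_mem h]
      · simp [Set.indicator_of_notMem h, Real.zero_rpow hr0.ne']
    have hmain := measure_abs_sum_gt_le_of_sum_integral_rpow_le hF hmono (M := M)
      (x := fun t => (partialSumLe v η N t).indicator (x t)) hr1 hr2 (Finset.Icc N T)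
      (fun t ht => (hx t (Finset.mem_Icc.mp ht).1).indicator (hmono (Nat.sub_le t M) _ (hI t)))
      (fun t ht => (hi t (Finset.mem_Icc.mp ht).1).indicator (hIm t))
      (fun t ht => (condExp_indicator (hi t (Finset.mem_Icc.mp ht).1) (hI t)).trans (by
        filter_upwards [h0 t (Finset.mem_Icc.mp ht).1] with ω hω
        by_cases h : ω ∈ partialSumLe v η N t
        · simp [Set.indicator_of_mem h, hω]
        · simp [Set.indicator_of_notMem h]))
      (fun t ht => by
        rw [hpow]; exact (hir t (Finset.mem_Icc.mp ht).1).indicator (hIm t))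
      (η := η) hc (by
        simp_rw [hpow]
        exact sum_integral_indicator_partialSumLe_le hF hmono M hir ha0 hη T)
    refine le_trans ?_ ((measure_union_le {ω | η < ∑ t ∈ Finset.Icc N T, v t ω} _).trans
      (add_le_add_right (hmain.trans (ENNReal.ofReal_le_ofReal ?_)) _))
    · refine measure_mono_ae ?_
      filter_upwards [ae_mem_partialSumLe (fun t => condExp_nonneg (ha0 t)) η N T] with ω hω hc'
      by_cases h : η < ∑ t ∈ Finset.Icc N T, v t ω
      · exact Or.inl h
      · refine Or.inr (lt_of_lt_of_le hc' (le_of_eq ?_))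
        refine congrArg _ (Finset.sum_congr rfl fun t ht => ?_)
        exact (Set.indicator_of_mem (hω (not_lt.mp h) t ht) _).symm
    · have : 0 ≤ η / c ^ r := div_nonneg hη (Real.rpow_nonneg hc.le r)
      linarith

end LaggedMartingale

/-! ### Conditional expectations as integrals against a kernel. -/

section RegularConditional

variable {Ω α β : Type*} {m m0 : MeasurableSpace Ω} [MeasurableSpace α]
  [MeasurableSpace β] {P : Measure Ω} [IsProbabilityMeasure P] {V : Ω → α} {W : Ω → β}
  {κ : ProbabilityTheory.Kernel α β} [ProbabilityTheory.IsMarkovKernel κ]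

/-- Rectangles determine the joint law. Restricting to an arbitrary `m`-measurable `B`, which `V`
need not generate, is what later identifies conditional expectations given `m` and not merely given
`V`. -/
theorem map_restrict_eq_compProd (hm : m ≤ m0) (hV : Measurable[m] V) (hW : Measurable W)
    (hκ : ∀ A, MeasurableSet A →
      P[(W ⁻¹' A).indicator (fun _ => (1 : ℝ)) | m] =ᵐ[P] fun ω => (κ (V ω)).real A)
    {B : Set Ω} (hB : MeasurableSet[m] B) :
    (P.restrict B).map (fun ω => (V ω, W ω)) =
      MeasureTheory.Measure.compProd ((P.restrict B).map V) κ := by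
  have hV0 : Measurable V := hV.mono hm le_rfl
  refine Measure.ext_prod fun {s u} hs hu => ?_
  rw [Measure.map_apply (hV0.prodMk hW) (hs.prod hu), Measure.compProd_apply_prod hs hu,
    setLIntegral_map hs (ProbabilityTheory.Kernel.measurable_coe κ hu) hV0,
    Measure.restrict_apply ((hV0.prodMk hW) (hs.prod hu)),
    Measure.restrict_restrict (hV0 hs)]
  set C := V ⁻¹' s ∩ B with hC
  have hCm : MeasurableSet[m] C := (hV hs).inter hB
  have e : (fun ω => (V ω, W ω)) ⁻¹' s ×ˢ u ∩ B = W ⁻¹' u ∩ C := by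
    ext ω; simp [hC]; tauto
  have h1 : ∫ ω in C, (W ⁻¹' u).indicator (fun _ => (1 : ℝ)) ω ∂P =
      ∫ ω in C, (κ (V ω)).real u ∂P := by
    rw [← setIntegral_condExp hm ((integrable_const _).indicator (hW hu)) hCm]
    exact integral_congr_ae (ae_restrict_of_ae (hκ u hu))
  rw [e, integral_indicator_const _ (hW hu), Measure.real, Measure.restrict_apply (hW hu),
    smul_eq_mul, mul_one] at *
  have hmeas : Measurable fun ω => κ (V ω) u :=
    (ProbabilityTheory.Kernel.measurable_coe κ hu).comp hV0
  rw [show (∫ ω in C, (κ (V ω)).real u ∂P) = (∫⁻ ω in C, κ (V ω) u ∂P).toReal from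
    integral_toReal hmeas.aemeasurable (ae_of_all _ fun ω => measure_lt_top _ _)] at h1
  refine (ENNReal.toReal_eq_toReal_iff' (measure_ne_top _ _) ?_).mp h1
  refine ((setLIntegral_mono measurable_const fun ω _ => prob_le_one).trans_lt ?_).ne
  simp

theorem ae_integrable_kernel (hm : m ≤ m0) (hV : Measurable[m] V) (hW : Measurable W)
    (hκ : ∀ A, MeasurableSet A →
      P[(W ⁻¹' A).indicator (fun _ => (1 : ℝ)) | m] =ᵐ[P] fun ω => (κ (V ω)).real A)
    {g : α × β → ℝ} (hg : Measurable g) (hgi : Integrable (fun ω => g (V ω, W ω)) P) :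
    ∀ᵐ ω ∂P, Integrable (fun w => g (V ω, w)) (κ (V ω)) := by
  have hV0 : Measurable V := hV.mono hm le_rfl
  have h1 := map_restrict_eq_compProd hm hV hW hκ (@MeasurableSet.univ _ m)
  rw [Measure.restrict_univ] at h1
  have h2 : Integrable g (P.map fun ω => (V ω, W ω)) :=
    (integrable_map_measure hg.aestronglyMeasurable (hV0.prodMk hW).aemeasurable).mpr hgi
  rw [h1] at h2
  exact ae_of_ae_map hV0.aemeasurable
    ((Measure.integrable_compProd_iff hg.aestronglyMeasurable).mp h2).1

theorem condExp_comp_prodMk_eq_integral_kernel (hm : m ≤ m0) (hV : Measurable[m] V)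
    (hW : Measurable W)
    (hκ : ∀ A, MeasurableSet A →
      P[(W ⁻¹' A).indicator (fun _ => (1 : ℝ)) | m] =ᵐ[P] fun ω => (κ (V ω)).real A)
    {g : α × β → ℝ} (hg : Measurable g) (hgi : Integrable (fun ω => g (V ω, W ω)) P) :
    P[fun ω => g (V ω, W ω) | m] =ᵐ[P] fun ω => ∫ w, g (V ω, w) ∂(κ (V ω)) := by
  have hV0 : Measurable V := hV.mono hm le_rfl
  have hk : ∀ B, MeasurableSet[m] B →
      Integrable (fun ω => ∫ w, g (V ω, w) ∂(κ (V ω))) (P.restrict B) ∧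
      ∫ ω in B, ∫ w, g (V ω, w) ∂(κ (V ω)) ∂P = ∫ ω in B, g (V ω, W ω) ∂P := by
    intro B hB
    have h1 := map_restrict_eq_compProd hm hV hW hκ hB
    have h2 : Integrable g ((P.restrict B).map fun ω => (V ω, W ω)) :=
      (integrable_map_measure hg.aestronglyMeasurable (hV0.prodMk hW).aemeasurable).mpr
        hgi.integrableOn
    have h3 := h2
    rw [h1] at h3
    have hsm : StronglyMeasurable fun a => ∫ w, g (a, w) ∂(κ a) :=
      hg.stronglyMeasurable.integral_kernel_prod_right'
    have h4 : Integrable (fun a => ∫ w, g (a, w) ∂(κ a)) ((P.restrict B).map V) := by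
      refine ((Measure.integrable_compProd_iff hg.aestronglyMeasurable).mp h3).2.mono'
        hsm.aestronglyMeasurable (ae_of_all _ fun a => norm_integral_le_integral_norm _)
    refine ⟨(integrable_map_measure hsm.aestronglyMeasurable hV0.aemeasurable).mp h4, ?_⟩
    rw [← integral_map (φ := V) hV0.aemeasurable (f := fun a => ∫ w, g (a, w) ∂(κ a))
      hsm.aestronglyMeasurable, ← integral_map (φ := fun ω => (V ω, W ω))
      (hV0.prodMk hW).aemeasurable (f := g) hg.aestronglyMeasurable, h1,
      Measure.integral_compProd h3]
  refine (ae_eq_condExp_of_forall_setIntegral_eq hm hgi (fun B hB _ => (hk B hB).1)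
    (fun B hB _ => (hk B hB).2) ?_).symm
  exact (hg.stronglyMeasurable.integral_kernel_prod_right'.comp_measurable hV).aestronglyMeasurable

end RegularConditional

/-- A directional derivative is a pointwise limit of difference quotients along a sequence. The
index shift keeps all evaluation points in `G`, where measurability in the second argument is known.
-/
theorem measurable_fderiv_apply_of_hasFDerivAt {α F : Type*} [MeasurableSpace α]
    [NormedAddCommGroup F] [NormedSpace ℝ F] {g : F → α → ℝ} {G : Set F} (hG : IsOpen G)
    (hg : ∀ x ∈ G, Measurable (g x)) {x : F} (hx : x ∈ G) {g' : α → F →L[ℝ] ℝ}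
    (h : ∀ a, HasFDerivAt (fun y => g y a) (g' a) x) (v : F) : Measurable fun a => g' a v := by
  have h1 : Tendsto (fun n : ℕ => x + ((n : ℝ))⁻¹ • v) atTop (𝓝 x) := by
    have : Tendsto (fun n : ℕ => ((n : ℝ))⁻¹) atTop (𝓝 0) := tendsto_inv_atTop_nhds_zero_nat
    simpa using (this.smul_const v).const_add x
  obtain ⟨N, hN⟩ := eventually_atTop.mp (h1.eventually (hG.mem_nhds hx))
  refine measurable_of_tendsto_metrizable (f := fun n a =>
    ((n + N : ℕ) : ℝ) • (g (x + (((n + N : ℕ) : ℝ))⁻¹ • v) a - g x a)) (fun n => ?_) ?_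
  · exact ((hg _ (hN (n + N) (Nat.le_add_left N n))).sub (hg x hx)).const_mul _
  · rw [tendsto_pi_nhds]
    intro a
    exact ((h a).lim_real v).comp
      (tendsto_natCast_atTop_atTop.comp (tendsto_add_atTop_nat N))

/-! ### The filtration of complete histories and the conditional law of the treatment. -/

namespace SpatioTemporal.Study

section Information

variable {Ω S 𝒳 𝓡 : Type*} [MeasurableSpace S] {p L K : ℕ}
variable {D : Study Ω S 𝒳 𝓡 p L K}
variable [MeasurableSpace 𝒳]

theorem fullSigma_mono : Monotone D.fullSigma := by
  intro s t hst
  refine sup_le_sup_right ?_ _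
  have h : D.Wbar s = (fun (w : Path (PointPattern S) t) (i : ↥(Set.Icc 1 s)) =>
      w ⟨i, i.2.1, i.2.2.trans hst⟩) ∘ D.Wbar t := rfl
  rw [h, ← MeasurableSpace.comap_comp]
  refine MeasurableSpace.comap_mono ?_
  exact Measurable.comap_le (measurable_pi_lambda _ fun i => measurable_pi_apply _)

theorem measurable_Wbar_fullSigma {s t : ℕ} (hst : s ≤ t) :
    Measurable[D.fullSigma t] (D.Wbar s) :=
  Measurable.mono (comap_measurable (D.Wbar s)) (le_sup_left.trans (fullSigma_mono hst)) le_rfl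

theorem measurable_W_fullSigma {s t : ℕ} (hs : 1 ≤ s) (hst : s ≤ t) :
    Measurable[D.fullSigma t] (D.W s) :=
  (measurable_pi_apply (⟨s, hs, le_rfl⟩ : ↥(Set.Icc 1 s))).comp (measurable_Wbar_fullSigma hst)

variable [mΩ : MeasurableSpace Ω] [MeasurableSpace 𝓡] {P : Measure Ω}

theorem Setting.fullSigma_le (hS : D.Setting P) (t : ℕ) : D.fullSigma t ≤ mΩ := by
  refine sup_le ?_ (sup_le ?_ ?_)
  · exact Measurable.comap_le (measurable_pi_lambda _ fun s => hS.measurable_W s s.2.1)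
  · exact iSup_le fun s => iSup_le fun hs => iSup_le fun w => (hS.measurable_Y s hs w).comap_le
  · exact iSup_le fun s => iSup_le fun hs => iSup_le fun w => (hS.measurable_X s hs w).comap_le

/-- An observed outcome is a random field evaluated at a random path. Joint measurability with
respect to `potSigma` and the path space makes the composite measurable for the complete history. -/
theorem Setting.measurable_Yobs (hS : D.Setting P) {s t : ℕ} (hs : 1 ≤ s) (hst : s ≤ t) :
    Measurable[D.fullSigma t] (D.Yobs s) := by
  have h1 : Measurable[D.fullSigma t, D.potSigma.prod inferInstance]
      fun ω => (ω, D.Wbar s ω) :=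
    @Measurable.prodMk _ (D.fullSigma t) _ _ D.potSigma _ _ _
      (measurable_id.mono le_sup_right le_rfl) (measurable_Wbar_fullSigma hst)
  exact (hS.joint_Y s hs).comp h1

theorem Setting.measurable_Xobs (hS : D.Setting P) {s t : ℕ} (hs : 1 ≤ s) (hst : s - 1 ≤ t) :
    Measurable[D.fullSigma t] (D.Xobs s) := by
  have h1 : Measurable[D.fullSigma t, D.potSigma.prod inferInstance]
      fun ω => (ω, D.Wbar (s - 1) ω) :=
    @Measurable.prodMk _ (D.fullSigma t) _ _ D.potSigma _ _ _
      (measurable_id.mono le_sup_right le_rfl) (measurable_Wbar_fullSigma hst)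
  exact (hS.joint_X s hs).comp h1

/-- The history preceding the treatment of period s involves treatments up to s − 1 only, even
though it contains the covariates of period s. It is therefore known given the complete history
through s − 1. -/
theorem Setting.measurable_hist (hS : D.Setting P) {s t : ℕ} (hst : s - 1 ≤ t) :
    Measurable[D.fullSigma t] (D.hist s) := by
  refine (measurable_Wbar_fullSigma hst).prodMk (Measurable.prodMk ?_ ?_)
  · exact @measurable_pi_lambda _ _ _ (D.fullSigma t) _ _ fun i =>
      hS.measurable_Yobs i.2.1 (i.2.2.trans hst)
  · exact @measurable_pi_lambda _ _ _ (D.fullSigma t) _ _ fun i =>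
      hS.measurable_Xobs i.2.1 ((Nat.sub_le_sub_right i.2.2 1).trans hst)

variable (D) in
/-- The conditional law of the treatment of period `t` given the observed history. -/
noncomputable def treatmentKernel [SFinite D.ν] (t : ℕ) :
    ProbabilityTheory.Kernel (History S 𝒳 t) (PointPattern S) :=
  ProbabilityTheory.Kernel.withDensity (ProbabilityTheory.Kernel.const _ D.ν)
    fun h w => ENNReal.ofReal (D.e t h w D.γs)

theorem Setting.treatmentKernel_apply [SFinite D.ν] (hS : D.Setting P) {t : ℕ} (ht : 1 ≤ t)
    (h : History S 𝒳 t) :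
    D.treatmentKernel t h = D.ν.withDensity fun w => ENNReal.ofReal (D.e t h w D.γs) := by
  rw [treatmentKernel, ProbabilityTheory.Kernel.withDensity_apply,
    ProbabilityTheory.Kernel.const_apply]
  exact ENNReal.measurable_ofReal.comp (hS.e_measurable t ht D.γs hS.γs_mem)

theorem Setting.isMarkovKernel_treatmentKernel [SFinite D.ν] (hS : D.Setting P) {t : ℕ}
    (ht : 1 ≤ t) : ProbabilityTheory.IsMarkovKernel (D.treatmentKernel t) := by
  refine ⟨fun h => ⟨?_⟩⟩
  rw [hS.treatmentKernel_apply ht, withDensity_apply _ MeasurableSet.univ, Measure.restrict_univ,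
    hS.e_prob t ht D.γs hS.γs_mem]

/-- Unconfoundedness transfers the correctly specified law from the observed to the complete
history, although the kernel still depends on the observed one alone. -/
theorem Setting.condExp_indicator_eq_treatmentKernel [SFinite D.ν] (hS : D.Setting P)
    (hU : D.Unconfounded P) {t : ℕ} (ht : 1 ≤ t) {A : Set (PointPattern S)}
    (hA : MeasurableSet A) :
    P[(D.W t ⁻¹' A).indicator (fun _ => (1 : ℝ)) | D.fullSigma (t - 1)] =ᵐ[P]
      fun ω => (D.treatmentKernel t (D.hist t ω)).real A := by
  refine (hU t ht A hA).trans ((hS.correct t ht A hA).trans (ae_of_all _ fun ω => ?_))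
  have hm : Measurable fun w => D.e t (D.hist t ω) w D.γs :=
    (hS.e_measurable t ht D.γs hS.γs_mem).comp measurable_prodMk_left
  simp only
  rw [Measure.real, hS.treatmentKernel_apply ht, withDensity_apply _ hA,
    integral_eq_lintegral_of_nonneg_ae
      (ae_of_all _ fun w => hS.e_nonneg t ht D.γs hS.γs_mem _ w) hm.aestronglyMeasurable]

end Information

end SpatioTemporal.Study

/-! ### Quadratic forms. -/

/-- The quadratic form of a square matrix. -/
def quadForm {K : ℕ} (A : Fin K → Fin K → ℝ) (u : Fin K → ℝ) : ℝ :=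
  ∑ k, ∑ j, u k * u j * A k j

theorem quadForm_add {K : ℕ} (A B : Fin K → Fin K → ℝ) (u : Fin K → ℝ) :
    quadForm (fun k j => A k j + B k j) u = quadForm A u + quadForm B u := by
  simp only [quadForm, mul_add, Finset.sum_add_distrib]

theorem quadForm_mul_self {K : ℕ} (a u : Fin K → ℝ) :
    quadForm (fun k j => a k * a j) u = (∑ k, u k * a k) ^ 2 := by
  rw [quadForm, sq, Finset.sum_mul_sum]
  exact Finset.sum_congr rfl fun k _ => Finset.sum_congr rfl fun j _ => by ring

theorem quadForm_sum {ι : Type*} {K : ℕ} (s : Finset ι) (A : ι → Fin K → Fin K → ℝ)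
    (u : Fin K → ℝ) : quadForm (fun k j => ∑ t ∈ s, A t k j) u = ∑ t ∈ s, quadForm (A t) u := by
  simp only [quadForm, Finset.mul_sum]
  rw [Finset.sum_comm (s := s)]
  exact Finset.sum_congr rfl fun k _ => Finset.sum_comm

theorem quadForm_smul {K : ℕ} (A : Fin K → Fin K → ℝ) (c : ℝ) (u : Fin K → ℝ) :
    quadForm A (c • u) = c ^ 2 * quadForm A u := by
  simp only [quadForm, Finset.mul_sum, Pi.smul_apply, smul_eq_mul]
  exact Finset.sum_congr rfl fun k _ => Finset.sum_congr rfl fun j _ => by ring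

theorem continuous_quadForm {K : ℕ} (A : Fin K → Fin K → ℝ) : Continuous (quadForm A) := by
  unfold quadForm
  fun_prop

theorem inner_clm_eq_quadForm {K : ℕ}
    (J : EuclideanSpace ℝ (Fin K) →L[ℝ] EuclideanSpace ℝ (Fin K)) (u : EuclideanSpace ℝ (Fin K)) :
    inner ℝ (J u) u = quadForm (fun k j => J (EuclideanSpace.single j 1) k) u := by
  have h : u = ∑ j, u j • EuclideanSpace.single j (1 : ℝ) := by
    ext i; simp [Finset.sum_apply, Pi.single_apply]
  have h2 : ∀ k, J u k = ∑ j, u j * J (EuclideanSpace.single j 1) k := fun k => by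
    conv_lhs => rw [h]
    simp [map_sum]
  rw [PiLp.inner_apply, quadForm]
  refine Finset.sum_congr rfl fun k _ => ?_
  rw [h2 k]
  simp [Finset.mul_sum, mul_assoc]

/-! ### Local expansion of the score and the conditional information inequality. -/

namespace SpatioTemporal.Study

variable {Ω S 𝒳 𝓡 : Type*} [MeasurableSpace S] {p L K : ℕ}
variable {D : Study Ω S 𝒳 𝓡 p L K}

variable (D) in
/-- `∂ψ_k/∂γ_j` at the true parameter. -/
noncomputable def psiJac (k j : Fin K) (t : ℕ) (h : History S 𝒳 t) (w : PointPattern S) : ℝ :=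
  fderiv ℝ (fun g => D.psi t h w g k) D.γs (EuclideanSpace.single j 1)

variable [mΩ : MeasurableSpace Ω] [MeasurableSpace 𝒳] {P : Measure Ω}

variable (D) in
/-- The score is twice continuously differentiable on the ball of radius `r` around the true
parameter, with second derivative bounded by `B`. -/
structure LocalScore (P : Measure Ω) (r C : ℝ)
    (B : (t : ℕ) → History S 𝒳 t → PointPattern S → ℝ) : Prop where
  pos : 0 < r
  subset : Metric.ball D.γs r ⊆ D.Γ
  contDiffOn : ∀ t, 1 ≤ t → ∀ h w, ContDiffOn ℝ 2 (D.psi t h w) D.Γ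
  differentiableOn : ∀ t, 1 ≤ t → ∀ h w, DifferentiableOn ℝ (D.e t h w) D.Γ
  measurable : ∀ t, 1 ≤ t → Measurable fun q : History S 𝒳 t × PointPattern S => B t q.1 q.2
  bound : ∀ t, 1 ≤ t → ∀ h w, ∀ γ ∈ Metric.ball D.γs r,
    ‖iteratedFDeriv ℝ 2 (D.psi t h w) γ‖ ≤ B t h w
  integrable : ∀ t, 1 ≤ t → Integrable (fun ω => B t (D.hist t ω) (D.W t ω)) P
  integral_le : ∀ t, 1 ≤ t → ∫ ω, B t (D.hist t ω) (D.W t ω) ∂P ≤ C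

namespace LocalScore

variable {r C : ℝ} {B : (t : ℕ) → History S 𝒳 t → PointPattern S → ℝ} {t : ℕ}

theorem mem_ball (hL : D.LocalScore P r C B) : D.γs ∈ Metric.ball D.γs r :=
  Metric.mem_ball_self hL.pos

theorem contDiffOn_ball (hL : D.LocalScore P r C B) (ht : 1 ≤ t) (h : History S 𝒳 t)
    (w : PointPattern S) : ContDiffOn ℝ 2 (D.psi t h w) (Metric.ball D.γs r) :=
  (hL.contDiffOn t ht h w).mono hL.subset

theorem differentiableAt_psi (hL : D.LocalScore P r C B) (ht : 1 ≤ t) (h : History S 𝒳 t)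
    (w : PointPattern S) {γ : EuclideanSpace ℝ (Fin K)} (hγ : γ ∈ Metric.ball D.γs r) :
    DifferentiableAt ℝ (D.psi t h w) γ :=
  ((hL.contDiffOn_ball ht h w).differentiableOn (by norm_num)).differentiableAt
    (Metric.isOpen_ball.mem_nhds hγ)

theorem psiJac_eq (hL : D.LocalScore P r C B) (ht : 1 ≤ t) (h : History S 𝒳 t)
    (w : PointPattern S) (k j : Fin K) :
    D.psiJac k j t h w = fderiv ℝ (D.psi t h w) D.γs (EuclideanSpace.single j 1) k := by
  have h1 := (EuclideanSpace.proj (𝕜 := ℝ) k).hasFDerivAt.comp D.γs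
    (hL.differentiableAt_psi ht h w hL.mem_ball).hasFDerivAt
  have h2 : HasFDerivAt (fun g => D.psi t h w g k)
    ((EuclideanSpace.proj (𝕜 := ℝ) k).comp (fderiv ℝ (D.psi t h w) D.γs)) D.γs := h1
  rw [psiJac, h2.fderiv]
  rfl

theorem inner_fderiv_psi (hL : D.LocalScore P r C B) (ht : 1 ≤ t) (h : History S 𝒳 t)
    (w : PointPattern S) (u : EuclideanSpace ℝ (Fin K)) :
    inner ℝ (fderiv ℝ (D.psi t h w) D.γs u) u =
      quadForm (fun k j => D.psiJac k j t h w) u := by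
  rw [inner_clm_eq_quadForm]
  simp_rw [hL.psiJac_eq ht h w]

theorem continuousOn_psi (hL : D.LocalScore P r C B) (ht : 1 ≤ t) (h : History S 𝒳 t)
    (w : PointPattern S) : ContinuousOn (gradient fun g => Real.log (D.e t h w g)) D.Γ :=
  (hL.contDiffOn t ht h w).continuousOn

variable [MeasurableSpace 𝓡]

theorem hasGradientAt_log (hL : D.LocalScore P r C B) (hS : D.Setting P) (ht : 1 ≤ t)
    (h : History S 𝒳 t) (w : PointPattern S) {γ : EuclideanSpace ℝ (Fin K)}
    (hγ : γ ∈ Metric.ball D.γs r) :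
    HasGradientAt (fun g => Real.log (D.e t h w g)) (D.psi t h w γ) γ :=
  hasGradientAt_log_of_continuousOn hS.isOpen_Γ (fun g hg => hS.e_nonneg t ht g hg h w)
    (hL.differentiableOn t ht h w) (hL.continuousOn_psi ht h w) hL.subset hγ

theorem e_eq_mul_exp (hL : D.LocalScore P r C B) (hS : D.Setting P) (ht : 1 ≤ t)
    (h : History S 𝒳 t) (w : PointPattern S) {γ : EuclideanSpace ℝ (Fin K)}
    (hγ : γ ∈ Metric.ball D.γs r) :
    D.e t h w γ = D.e t h w D.γs * Real.exp (Real.log (D.e t h w γ) - Real.log (D.e t h w D.γs)) :=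
  eq_mul_exp_log_sub_log hS.isOpen_Γ (fun g hg => hS.e_nonneg t ht g hg h w)
    (hL.differentiableOn t ht h w) (hL.continuousOn_psi ht h w) (convex_ball _ _) hL.subset
    hL.mem_ball hγ

theorem abs_log_sub_taylor_le (hL : D.LocalScore P r C B) (hS : D.Setting P) (ht : 1 ≤ t)
    (h : History S 𝒳 t) (w : PointPattern S) {γ : EuclideanSpace ℝ (Fin K)}
    (hγ : γ ∈ Metric.ball D.γs r) :
    |Real.log (D.e t h w γ) - Real.log (D.e t h w D.γs) -
      (inner ℝ (D.psi t h w D.γs) (γ - D.γs) +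
        quadForm (fun k j => D.psiJac k j t h w) (γ - D.γs).ofLp / 2)| ≤
      B t h w * ‖γ - D.γs‖ ^ 3 := by
  have := abs_sub_taylor_le_of_norm_iteratedFDeriv_two_le
    (fun x hx => hL.hasGradientAt_log hS ht h w hx) (hL.contDiffOn_ball ht h w)
    (hL.bound t ht h w) hγ
  rwa [hL.inner_fderiv_psi ht] at this

theorem measurable_psi (hL : D.LocalScore P r C B) (hS : D.Setting P) (ht : 1 ≤ t)
    {γ : EuclideanSpace ℝ (Fin K)} (hγ : γ ∈ Metric.ball D.γs r) (k : Fin K) :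
    Measurable fun q : History S 𝒳 t × PointPattern S => D.psi t q.1 q.2 γ k := by
  have h1 := measurable_fderiv_apply_of_hasFDerivAt
    (g := fun g (q : History S 𝒳 t × PointPattern S) => Real.log (D.e t q.1 q.2 g))
    hS.isOpen_Γ (fun x hx => (hS.e_measurable t ht x hx).log) (hL.subset hγ)
    (fun q => (hL.hasGradientAt_log hS ht q.1 q.2 hγ).hasFDerivAt) (EuclideanSpace.single k 1)
  simpa [EuclideanSpace.inner_single_right] using h1

theorem measurable_psiJac (hL : D.LocalScore P r C B) (hS : D.Setting P) (ht : 1 ≤ t)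
    (k j : Fin K) :
    Measurable fun q : History S 𝒳 t × PointPattern S => D.psiJac k j t q.1 q.2 := by
  refine measurable_fderiv_apply_of_hasFDerivAt
    (g := fun g (q : History S 𝒳 t × PointPattern S) => D.psi t q.1 q.2 g k)
    Metric.isOpen_ball (fun x hx => hL.measurable_psi hS ht hx k) hL.mem_ball
    (fun q => DifferentiableAt.hasFDerivAt ?_) (EuclideanSpace.single j 1)
  exact (EuclideanSpace.proj (𝕜 := ℝ) k).differentiableAt.comp D.γs
    (hL.differentiableAt_psi ht q.1 q.2 hL.mem_ball)

/-- The score identities given the observed history. -/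
theorem integral_score_treatmentKernel [SFinite D.ν] (hL : D.LocalScore P r C B)
    (hS : D.Setting P) (ht : 1 ≤ t) (h : History S 𝒳 t)
    (hψ : ∀ k, Integrable (fun w => D.psi t h w D.γs k) (D.treatmentKernel t h))
    (hψ2 : ∀ k j, Integrable (fun w => D.psi t h w D.γs k * D.psi t h w D.γs j)
      (D.treatmentKernel t h))
    (hP : ∀ k j, Integrable (fun w => D.psiJac k j t h w) (D.treatmentKernel t h))
    (hB : Integrable (B t h) (D.treatmentKernel t h)) (u : EuclideanSpace ℝ (Fin K)) :
    ∫ w, inner ℝ (D.psi t h w D.γs) u ∂(D.treatmentKernel t h) = 0 ∧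
    ∫ w, (inner ℝ (D.psi t h w D.γs) u) ^ 2 ∂(D.treatmentKernel t h) +
      ∫ w, quadForm (fun k j => D.psiJac k j t h w) u ∂(D.treatmentKernel t h) ≤ 0 := by
  have := hS.isMarkovKernel_treatmentKernel ht
  -- This keeps γ* + εu in the ball of radius `r`; the `+ 1` covers u = 0.
  set ε₀ := r / (‖u‖ + 1) with hε₀
  have hε₀p : 0 < ε₀ := div_pos hL.pos (by positivity)
  have hmem : ∀ ε, |ε| < ε₀ → D.γs + ε • u ∈ Metric.ball D.γs r := fun ε hε => by
    rw [mem_ball_iff_norm, add_sub_cancel_left, norm_smul, Real.norm_eq_abs]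
    rw [hε₀, lt_div_iff₀ (by positivity)] at hε
    nlinarith [abs_nonneg ε]
  have hinner : ∀ w, inner ℝ (D.psi t h w D.γs) u = ∑ k, u k * D.psi t h w D.γs k := fun w => by
    simp [PiLp.inner_apply]
  set X : ℝ → PointPattern S → ℝ := fun ε w =>
    Real.log (D.e t h w (D.γs + ε • u)) - Real.log (D.e t h w D.γs) with hX
  have hem : ∀ g ∈ D.Γ, Measurable fun w => D.e t h w g := fun g hg =>
    (hS.e_measurable t ht g hg).comp measurable_prodMk_left
  have hXm : ∀ ε, |ε| < ε₀ → Measurable (X ε) := fun ε hε =>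
    (hem _ (hL.subset (hmem ε hε))).log.sub (hem _ hS.γs_mem).log
  -- The exponential is the density ratio, so its integral against the density at γ* is the total
  -- mass at γ* + εu. Zeros do no harm because they are shared by both parameters.
  have hexp : ∀ ε, |ε| < ε₀ →
      ∫⁻ w, ENNReal.ofReal (Real.exp (X ε w)) ∂(D.treatmentKernel t h) = 1 := fun ε hε => by
    rw [hS.treatmentKernel_apply ht, lintegral_withDensity_eq_lintegral_mul _
      (hem _ hS.γs_mem).ennreal_ofReal (hXm ε hε).exp.ennreal_ofReal,
      ← hS.e_prob t ht _ (hL.subset (hmem ε hε)) h]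
    refine lintegral_congr fun w => ?_
    rw [Pi.mul_apply, ← ENNReal.ofReal_mul (hS.e_nonneg t ht _ hS.γs_mem h w),
      ← hL.e_eq_mul_exp hS ht h w (hmem ε hε)]
  have hT : ∀ ε, |ε| < ε₀ → ∀ w, |X ε w - (ε * inner ℝ (D.psi t h w D.γs) u +
      ε ^ 2 * quadForm (fun k j => D.psiJac k j t h w) u / 2)| ≤
      |ε| ^ 3 * (B t h w * ‖u‖ ^ 3) := fun ε hε w => by
    have h1 := hL.abs_log_sub_taylor_le hS ht h w (hmem ε hε)
    rw [add_sub_cancel_left, norm_smul, Real.norm_eq_abs, real_inner_smul_right,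
      WithLp.ofLp_smul, quadForm_smul] at h1
    refine le_trans (le_of_eq ?_) (h1.trans (le_of_eq (by ring)))
    congr 2
  have ha : Integrable (fun w => inner ℝ (D.psi t h w D.γs) u) (D.treatmentKernel t h) := by
    simp_rw [hinner]
    exact integrable_finsetSum _ fun k _ => (hψ k).const_mul _
  have ha2 : Integrable (fun w => (inner ℝ (D.psi t h w D.γs) u) ^ 2) (D.treatmentKernel t h) := by
    simp_rw [hinner, ← quadForm_mul_self, quadForm]
    exact integrable_finsetSum _ fun k _ => integrable_finsetSum _ fun j _ =>
      (hψ2 k j).const_mul _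
  have hb : Integrable (fun w => quadForm (fun k j => D.psiJac k j t h w) u)
      (D.treatmentKernel t h) :=
    integrable_finsetSum _ fun k _ => integrable_finsetSum _ fun j _ => (hP k j).const_mul _
  exact ⟨integral_score_eq_zero hε₀p hXm hexp hT ha hb (hB.mul_const _),
    integral_sq_score_add_deriv_le_zero hε₀p hXm hexp hT ha hb (hB.mul_const _) ha2⟩

end LocalScore

variable [MeasurableSpace 𝓡]

theorem ScoreRegular.exists_localScore {Vps : Matrix (Fin K) (Fin K) ℝ} (hS : D.Setting P)
    (h : D.ScoreRegular P Vps) : ∃ r C B, D.LocalScore P r C B := by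
  obtain ⟨U, hU, B, C, h1, h2, h3, h4⟩ := h.dominated
  obtain ⟨r, hr, hr'⟩ := Metric.mem_nhds_iff.mp (inter_mem hU (hS.isOpen_Γ.mem_nhds hS.γs_mem))
  exact ⟨r, C, B, hr, fun x hx => (hr' hx).2, h.smooth, h.differentiable, h1,
    fun t ht a w γ hγ => h2 t ht a w γ (hr' hγ).1, h3, h4⟩


end SpatioTemporal.Study

theorem condExp_quadForm {Ω : Type*} {m m0 : MeasurableSpace Ω} {P : Measure Ω} {K : ℕ}
    {f : Fin K → Fin K → Ω → ℝ} (hf : ∀ k j, Integrable (f k j) P) (u : Fin K → ℝ) :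
    P[fun ω => quadForm (fun k j => f k j ω) u | m] =ᵐ[P]
      fun ω => quadForm (fun k j => (P[f k j | m]) ω) u := by
  have h1 : (fun ω => quadForm (fun k j => f k j ω) u) =
      ∑ q : Fin K × Fin K, (u q.1 * u q.2) • f q.1 q.2 := by
    ext ω
    simp [quadForm, Fintype.sum_prod_type, Finset.sum_apply]
  have h2 : P[∑ q : Fin K × Fin K, (u q.1 * u q.2) • f q.1 q.2 | m] =ᵐ[P]
      ∑ q : Fin K × Fin K, P[(u q.1 * u q.2) • f q.1 q.2 | m] :=
    condExp_finsetSum (fun q _ => (hf q.1 q.2).smul (u q.1 * u q.2)) m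
  have h3 : ∀ᵐ ω ∂P, ∀ q : Fin K × Fin K, (P[(u q.1 * u q.2) • f q.1 q.2 | m]) ω =
      (u q.1 * u q.2) * (P[f q.1 q.2 | m]) ω := by
    rw [ae_all_iff]
    exact fun q => condExp_smul (u q.1 * u q.2) (f q.1 q.2) m
  rw [h1]
  filter_upwards [h2, h3] with ω e2 e3
  rw [e2, Finset.sum_apply]
  simp_rw [e3]
  rw [Fintype.sum_prod_type]
  rfl

/-- A countable dense set of directions and continuity make the null set independent of `u`, which
will later be the random vector γ̂ − γ*. -/
theorem ae_forall_quadForm_le {Ω : Type*} {m0 : MeasurableSpace Ω} {P : Measure Ω} {K : ℕ}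
    {f g : Fin K → Fin K → Ω → ℝ}
    (h : ∀ u, ∀ᵐ ω ∂P, quadForm (fun k j => f k j ω) u ≤ quadForm (fun k j => g k j ω) u) :
    ∀ᵐ ω ∂P, ∀ u, quadForm (fun k j => f k j ω) u ≤ quadForm (fun k j => g k j ω) u := by
  obtain ⟨s, hs, hd⟩ := TopologicalSpace.exists_countable_dense (Fin K → ℝ)
  filter_upwards [(ae_ball_iff hs).mpr fun u _ => h u] with ω hω u
  have hc : IsClosed {u | quadForm (fun k j => f k j ω) u ≤ quadForm (fun k j => g k j ω) u} :=
    isClosed_le (continuous_quadForm _) (continuous_quadForm _)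
  exact closure_minimal (fun u hu => hω u hu) hc (hd u)

namespace SpatioTemporal.Study

variable {Ω S 𝒳 𝓡 : Type*} [MeasurableSpace S] {p L K : ℕ}
variable {D : Study Ω S 𝒳 𝓡 p L K}
theorem psiDeriv_eq (k j : Fin K) (t : ℕ) :
    D.psiDeriv k j t = fun ω => D.psiJac k j t (D.hist t ω) (D.W t ω) := rfl

variable [mΩ : MeasurableSpace Ω] [MeasurableSpace 𝒳] [MeasurableSpace 𝓡] {P : Measure Ω}

theorem Setting.measurable_hist_W (hS : D.Setting P) {t : ℕ} (ht : 1 ≤ t) :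
    Measurable[D.fullSigma t] fun ω => (D.hist t ω, D.W t ω) :=
  (hS.measurable_hist (Nat.sub_le t 1)).prodMk (measurable_W_fullSigma ht le_rfl)

namespace LocalScore

variable {r C : ℝ} {B : (t : ℕ) → History S 𝒳 t → PointPattern S → ℝ} {t : ℕ}

theorem measurable_psiObs (hL : D.LocalScore P r C B) (hS : D.Setting P) (ht : 1 ≤ t)
    (k : Fin K) : Measurable[D.fullSigma t] fun ω => D.psiObs t D.γs ω k :=
  (hL.measurable_psi hS ht hL.mem_ball k).comp (hS.measurable_hist_W ht)

theorem measurable_psiDeriv (hL : D.LocalScore P r C B) (hS : D.Setting P) (ht : 1 ≤ t)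
    (k j : Fin K) : Measurable[D.fullSigma t] (D.psiDeriv k j t) := by
  have h := (hL.measurable_psiJac hS ht k j).comp (hS.measurable_hist_W ht)
  rw [psiDeriv_eq]
  exact h

theorem memLp_psiObs (hL : D.LocalScore P r C B) (hS : D.Setting P)
    {Vps : Matrix (Fin K) (Fin K) ℝ} (hR : D.ScoreRegular P Vps) (ht : 1 ≤ t) (k : Fin K) :
    MemLp (fun ω => D.psiObs t D.γs ω k) 2 P := by
  have hm := ((hL.measurable_psiObs hS ht k).mono (hS.fullSigma_le t) le_rfl).aestronglyMeasurable
    (μ := P)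
  rw [memLp_two_iff_integrable_sq hm]
  refine (hR.sq_integrable t ht).mono' (hm.pow 2) (ae_of_all _ fun ω => ?_)
  rw [Real.norm_of_nonneg (sq_nonneg _), EuclideanSpace.norm_sq_eq]
  refine le_trans (le_of_eq ?_) (Finset.single_le_sum
    (f := fun i => ‖(D.psiObs t D.γs ω) i‖ ^ 2) (fun i _ => sq_nonneg _) (Finset.mem_univ k))
  simp

theorem integrable_psiObs_mul (hL : D.LocalScore P r C B) (hS : D.Setting P)
    {Vps : Matrix (Fin K) (Fin K) ℝ} (hR : D.ScoreRegular P Vps) (ht : 1 ≤ t) (k j : Fin K) :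
    Integrable (fun ω => D.psiObs t D.γs ω k * D.psiObs t D.γs ω j) P :=
  (hL.memLp_psiObs hS hR ht k).integrable_mul (hL.memLp_psiObs hS hR ht j)

variable [IsProbabilityMeasure P]

/-- Integrability under `P` passes to the kernel at almost every history. There the pointwise score
identities apply, and the conditional expectations are the kernel integrals. -/
theorem ae_score_treatmentKernel [SFinite D.ν] (hL : D.LocalScore P r C B) (hS : D.Setting P)
    (hU : D.Unconfounded P) {Vps : Matrix (Fin K) (Fin K) ℝ} (hR : D.ScoreRegular P Vps)
    (ht : 1 ≤ t) (u : EuclideanSpace ℝ (Fin K)) :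
    P[fun ω => inner ℝ (D.psiObs t D.γs ω) u | D.fullSigma (t - 1)] =ᵐ[P] 0 ∧
    P[fun ω => (inner ℝ (D.psiObs t D.γs ω) u) ^ 2 + quadForm (fun k j => D.psiDeriv k j t ω) u |
      D.fullSigma (t - 1)] ≤ᵐ[P] 0 := by
  have hMk := hS.isMarkovKernel_treatmentKernel ht
  have hm := hS.fullSigma_le (t - 1)
  have hV := hS.measurable_hist (s := t) (t := t - 1) le_rfl
  have hW := hS.measurable_W t ht
  have hκ := fun A hA => hS.condExp_indicator_eq_treatmentKernel hU ht (A := A) hA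
  have hinner : ∀ h w, inner ℝ (D.psi t h w D.γs) u = ∑ k, u k * D.psi t h w D.γs k :=
    fun h w => by simp [PiLp.inner_apply]
  have hψm := fun k => hL.measurable_psi hS ht hL.mem_ball k
  have hg1 : Measurable fun q : History S 𝒳 t × PointPattern S =>
      (inner ℝ (D.psi t q.1 q.2 D.γs) u : ℝ) := by
    simp_rw [hinner]
    exact Finset.measurable_fun_sum _ fun k _ => (hψm k).const_mul _
  have hg2 : Measurable fun q : History S 𝒳 t × PointPattern S =>
      quadForm (fun k j => D.psiJac k j t q.1 q.2) u :=
    Finset.measurable_fun_sum _ fun k _ => Finset.measurable_fun_sum _ fun j _ =>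
      (hL.measurable_psiJac hS ht k j).const_mul (u k * u j)
  have hi1 : Integrable (fun ω => (inner ℝ (D.psiObs t D.γs ω) u : ℝ)) P := by
    simp_rw [psiObs, hinner]
    exact integrable_finsetSum _ fun k _ =>
      ((hL.memLp_psiObs hS hR ht k).integrable (by norm_num)).const_mul (u k)
  have hi2 : Integrable (fun ω => (inner ℝ (D.psiObs t D.γs ω) u) ^ 2) P := by
    simp_rw [psiObs, hinner, ← quadForm_mul_self, quadForm]
    exact integrable_finsetSum _ fun k _ => integrable_finsetSum _ fun j _ =>
      (hL.integrable_psiObs_mul hS hR ht k j).const_mul (u k * u j)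
  have hi3 : Integrable (fun ω => quadForm (fun k j => D.psiDeriv k j t ω) u) P :=
    integrable_finsetSum _ fun k _ => integrable_finsetSum _ fun j _ =>
      (hR.deriv_integrable k j t ht).const_mul (u k * u j)
  have hd : ∀ k j, Integrable (fun ω => D.psiJac k j t (D.hist t ω) (D.W t ω)) P := fun k j => by
    rw [← psiDeriv_eq]; exact hR.deriv_integrable k j t ht
  have a1 : ∀ᵐ ω ∂P, ∀ k, Integrable (fun w => D.psi t (D.hist t ω) w D.γs k)
      (D.treatmentKernel t (D.hist t ω)) := ae_all_iff.mpr fun k =>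
    ae_integrable_kernel (g := fun q => D.psi t q.1 q.2 D.γs k) hm hV hW hκ (hψm k)
      ((hL.memLp_psiObs hS hR ht k).integrable (by norm_num))
  have a2 : ∀ᵐ ω ∂P, ∀ k j, Integrable
      (fun w => D.psi t (D.hist t ω) w D.γs k * D.psi t (D.hist t ω) w D.γs j)
      (D.treatmentKernel t (D.hist t ω)) := ae_all_iff.mpr fun k => ae_all_iff.mpr fun j =>
    ae_integrable_kernel (g := fun q => D.psi t q.1 q.2 D.γs k * D.psi t q.1 q.2 D.γs j)
      hm hV hW hκ ((hψm k).mul (hψm j)) (hL.integrable_psiObs_mul hS hR ht k j)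
  have a3 : ∀ᵐ ω ∂P, ∀ k j, Integrable (fun w => D.psiJac k j t (D.hist t ω) w)
      (D.treatmentKernel t (D.hist t ω)) := ae_all_iff.mpr fun k => ae_all_iff.mpr fun j =>
    ae_integrable_kernel (g := fun q => D.psiJac k j t q.1 q.2) hm hV hW hκ
      (hL.measurable_psiJac hS ht k j) (hd k j)
  have a4 := ae_integrable_kernel (g := fun q => B t q.1 q.2) hm hV hW hκ (hL.measurable t ht) (hL.integrable t ht)
  have b2 := ae_integrable_kernel (g := fun q => (inner ℝ (D.psi t q.1 q.2 D.γs) u) ^ 2)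
    hm hV hW hκ (hg1.pow_const 2) hi2
  have b3 := ae_integrable_kernel (g := fun q => quadForm (fun k j => D.psiJac k j t q.1 q.2) u)
    hm hV hW hκ hg2 hi3
  constructor
  · refine (condExp_comp_prodMk_eq_integral_kernel
      (g := fun q => inner ℝ (D.psi t q.1 q.2 D.γs) u) hm hV hW hκ hg1 hi1).trans ?_
    filter_upwards [a1, a2, a3, a4] with ω h1 h2 h3 h4
    exact (hL.integral_score_treatmentKernel hS ht _ h1 h2 h3 h4 u).1
  · refine (condExp_comp_prodMk_eq_integral_kernel
      (g := fun q => (inner ℝ (D.psi t q.1 q.2 D.γs) u) ^ 2 +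
        quadForm (fun k j => D.psiJac k j t q.1 q.2) u) hm hV hW hκ ((hg1.pow_const 2).add hg2)
      (hi2.add hi3)).trans_le ?_
    filter_upwards [a1, a2, a3, a4, b2, b3] with ω h1 h2 h3 h4 h5 h6
    refine le_trans (le_of_eq ?_) (hL.integral_score_treatmentKernel hS ht _ h1 h2 h3 h4 u).2
    exact integral_add h5 h6

/-- Tower property: M ≥ 1, so the history through t − M is contained in the one through t − 1. -/
theorem condExp_psiObs_eq_zero (hL : D.LocalScore P r C B) (hS : D.Setting P)
    (hU : D.Unconfounded P) {Vps : Matrix (Fin K) (Fin K) ℝ} (hR : D.ScoreRegular P Vps)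
    (ht : 1 ≤ t) (k : Fin K) :
    P[fun ω => D.psiObs t D.γs ω k | D.fullSigma (t - D.M)] =ᵐ[P] 0 := by
  have := hS.sigmaFinite
  have h1 := (hL.ae_score_treatmentKernel hS hU hR ht (EuclideanSpace.single k 1)).1
  simp only [EuclideanSpace.inner_single_right, one_mul, conj_trivial] at h1
  have h2 := condExp_condExp_of_le (f := fun ω => D.psiObs t D.γs ω k) (μ := P)
    (fullSigma_mono (D := D) (Nat.sub_le_sub_left hS.one_le_M t)) (hS.fullSigma_le (t - 1))
  refine h2.symm.trans ((condExp_congr_ae h1).trans ?_)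
  rw [condExp_zero]

/-- The information inequality given the complete history through time `t - M`. -/
theorem ae_information_le (hL : D.LocalScore P r C B) (hS : D.Setting P)
    (hU : D.Unconfounded P) {Vps : Matrix (Fin K) (Fin K) ℝ} (hR : D.ScoreRegular P Vps) :
    ∀ᵐ ω ∂P, ∀ t, 1 ≤ t → ∀ u : Fin K → ℝ,
      0 ≤ quadForm (fun k j => (P[fun ω => D.psiObs t D.γs ω k * D.psiObs t D.γs ω j |
        D.fullSigma (t - D.M)]) ω) u ∧
      quadForm (fun k j => (P[fun ω => D.psiObs t D.γs ω k * D.psiObs t D.γs ω j |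
        D.fullSigma (t - D.M)]) ω) u +
      quadForm (fun k j => (P[D.psiDeriv k j t | D.fullSigma (t - D.M)]) ω) u ≤ 0 := by
  have := hS.sigmaFinite
  rw [ae_all_iff]
  intro t
  by_cases ht : 1 ≤ t
  swap
  · exact ae_of_all _ fun ω h => absurd h ht
  have hinner : ∀ ω (u : Fin K → ℝ), quadForm (fun k j => D.psiObs t D.γs ω k *
      D.psiObs t D.γs ω j) u = (inner ℝ (D.psiObs t D.γs ω) (WithLp.toLp 2 u)) ^ 2 := fun ω u => by
    rw [quadForm_mul_self]; simp [PiLp.inner_apply]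
  have h0 : ∀ᵐ ω ∂P, ∀ u, quadForm (fun _ _ => (0 : ℝ)) u ≤
      quadForm (fun k j => (P[fun ω => D.psiObs t D.γs ω k * D.psiObs t D.γs ω j |
        D.fullSigma (t - D.M)]) ω) u := by
    refine ae_forall_quadForm_le (f := fun _ _ _ => (0 : ℝ)) fun u => ?_
    have h1 := condExp_quadForm (m := D.fullSigma (t - D.M))
      (fun k j => hL.integrable_psiObs_mul hS hR ht k j) u
    have h2 : 0 ≤ᵐ[P] P[fun ω => quadForm (fun k j => D.psiObs t D.γs ω k *
        D.psiObs t D.γs ω j) u | D.fullSigma (t - D.M)] :=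
      condExp_nonneg (ae_of_all _ fun ω => by
        exact (sq_nonneg _).trans_eq (quadForm_mul_self _ _).symm)
    filter_upwards [h1, h2] with ω e1 e2
    rw [← e1]
    simpa [quadForm] using e2
  have h3 : ∀ᵐ ω ∂P, ∀ u, quadForm (fun k j =>
      (P[fun ω => D.psiObs t D.γs ω k * D.psiObs t D.γs ω j | D.fullSigma (t - D.M)]) ω +
        (P[D.psiDeriv k j t | D.fullSigma (t - D.M)]) ω) u ≤
      quadForm (fun _ _ => (0 : ℝ)) u := by
    refine ae_forall_quadForm_le (g := fun _ _ _ => (0 : ℝ)) fun u => ?_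
    have i1 : ∀ k j, Integrable (fun ω => D.psiObs t D.γs ω k * D.psiObs t D.γs ω j +
        D.psiDeriv k j t ω) P := fun k j =>
      (hL.integrable_psiObs_mul hS hR ht k j).add (hR.deriv_integrable k j t ht)
    have h1 := condExp_quadForm (m := D.fullSigma (t - D.M)) i1 u
    have h2 := (hL.ae_score_treatmentKernel hS hU hR ht (WithLp.toLp 2 u)).2
    have h4 := condExp_condExp_of_le (f := fun ω => quadForm (fun k j =>
      D.psiObs t D.γs ω k * D.psiObs t D.γs ω j + D.psiDeriv k j t ω) u) (μ := P)
      (fullSigma_mono (D := D) (Nat.sub_le_sub_left hS.one_le_M t)) (hS.fullSigma_le (t - 1))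
    have h5 : ∀ ω, quadForm (fun k j =>
      D.psiObs t D.γs ω k * D.psiObs t D.γs ω j + D.psiDeriv k j t ω) u =
      (inner ℝ (D.psiObs t D.γs ω) (WithLp.toLp 2 u)) ^ 2 +
        quadForm (fun k j => D.psiDeriv k j t ω) u := fun ω => by rw [quadForm_add, hinner]
    simp_rw [h5] at h4 h1
    have h6 : P[P[fun ω => (inner ℝ (D.psiObs t D.γs ω) (WithLp.toLp 2 u)) ^ 2 +
        quadForm (fun k j => D.psiDeriv k j t ω) u | D.fullSigma (t - 1)] |
        D.fullSigma (t - D.M)] ≤ᵐ[P] P[(0 : Ω → ℝ) | D.fullSigma (t - D.M)] :=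
      condExp_mono integrable_condExp (integrable_zero _ _ _) h2
    rw [condExp_zero] at h6
    have h7 : ∀ᵐ ω ∂P, ∀ k j, (P[fun ω => D.psiObs t D.γs ω k * D.psiObs t D.γs ω j +
        D.psiDeriv k j t ω | D.fullSigma (t - D.M)]) ω =
        (P[fun ω => D.psiObs t D.γs ω k * D.psiObs t D.γs ω j | D.fullSigma (t - D.M)]) ω +
        (P[D.psiDeriv k j t | D.fullSigma (t - D.M)]) ω :=
      ae_all_iff.mpr fun k => ae_all_iff.mpr fun j =>
        condExp_add (hL.integrable_psiObs_mul hS hR ht k j) (hR.deriv_integrable k j t ht) _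
    filter_upwards [h1, h4, h6, h7] with ω e1 e4 e6 e7
    simp_rw [e7] at e1
    rw [← e1, ← e4]
    simpa [quadForm] using e6
  filter_upwards [h0, h3] with ω e0 e3 _ u
  have e0' := e0 u
  have e3' := e3 u
  rw [quadForm_add] at e3'
  simp only [quadForm, mul_zero, Finset.sum_const_zero] at e0' e3'
  exact ⟨e0', e3'⟩

end LocalScore

end SpatioTemporal.Study

/-! ### Events of probability tending to one and boundedness in probability. -/

section InProbability

variable {Ω : Type*} {m0 : MeasurableSpace Ω} {P : Measure Ω}

/-- The events `G T` have probability tending to one (in outer measure). -/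
def WithProbTendingToOne (P : Measure Ω) (G : ℕ → Ω → Prop) : Prop :=
  Tendsto (fun T => P {ω | ¬ G T ω}) atTop (𝓝 0)

/-- The sequence `X` is bounded above in probability. -/
def BoundedInProb (P : Measure Ω) (X : ℕ → Ω → ℝ) : Prop :=
  ∀ η : ℝ, 0 < η → ∃ C, 0 < C ∧ ∀ᶠ T in atTop, P {ω | C < X T ω} ≤ ENNReal.ofReal η

namespace WithProbTendingToOne

theorem mono {G H : ℕ → Ω → Prop} (hG : WithProbTendingToOne P G)
    (h : ∀ᶠ T in atTop, ∀ᵐ ω ∂P, G T ω → H T ω) : WithProbTendingToOne P H := by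
  refine tendsto_of_tendsto_of_tendsto_of_le_of_le' tendsto_const_nhds hG
    (Eventually.of_forall fun _ => zero_le) ?_
  filter_upwards [h] with T hT
  refine measure_mono_ae ?_
  filter_upwards [hT] with ω hω h1 h2
  exact h1 (hω h2)

theorem of_ae {G : ℕ → Ω → Prop} (h : ∀ᶠ T in atTop, ∀ᵐ ω ∂P, G T ω) :
    WithProbTendingToOne P G := by
  refine tendsto_const_nhds.congr' ?_
  filter_upwards [h] with T hT
  exact (ae_iff.mp hT).symm

theorem and {G H : ℕ → Ω → Prop} (hG : WithProbTendingToOne P G)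
    (hH : WithProbTendingToOne P H) : WithProbTendingToOne P fun T ω => G T ω ∧ H T ω := by
  have h := Tendsto.add hG hH
  rw [add_zero] at h
  refine tendsto_of_tendsto_of_tendsto_of_le_of_le tendsto_const_nhds h
    (fun _ => zero_le) fun T => ?_
  refine le_trans (measure_mono fun ω hω => ?_) (measure_union_le _ _)
  by_cases hg : G T ω
  · exact Or.inr fun hh => hω ⟨hg, hh⟩
  · exact Or.inl hg

theorem forall_finite {ι : Type*} [Finite ι] {G : ι → ℕ → Ω → Prop}
    (h : ∀ i, WithProbTendingToOne P (G i)) : WithProbTendingToOne P fun T ω => ∀ i, G i T ω := by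
  have := Fintype.ofFinite ι
  have h1 : Tendsto (fun T => ∑ i, P {ω | ¬ G i T ω}) atTop (𝓝 (∑ _i : ι, 0)) :=
    tendsto_finsetSum _ fun i _ => h i
  rw [Finset.sum_const_zero] at h1
  refine tendsto_of_tendsto_of_tendsto_of_le_of_le tendsto_const_nhds h1
    (fun _ => zero_le) fun T => ?_
  refine le_trans (measure_mono fun ω hω => ?_) (measure_iUnion_fintype_le P _)
  simpa using hω

/-- To show that `G` has probability tending to one, one may assume a bound on a sequence that is
bounded in probability. -/
theorem of_boundedInProb {X : ℕ → Ω → ℝ} (hX : BoundedInProb P X) {G : ℕ → Ω → Prop}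
    (h : ∀ C, 0 < C → WithProbTendingToOne P fun T ω => X T ω ≤ C → G T ω) :
    WithProbTendingToOne P G := by
  refine ENNReal.tendsto_nhds_zero.mpr fun ε hε => ?_
  rcases eq_or_ne ε ⊤ with rfl | htop
  · exact Eventually.of_forall fun _ => le_top
  have hε' : 0 < ε.toReal / 2 := half_pos (ENNReal.toReal_pos hε.ne' htop)
  obtain ⟨C, hC, hC'⟩ := hX _ hε'
  have h2 := ENNReal.tendsto_nhds_zero.mp (h C hC) (ENNReal.ofReal (ε.toReal / 2))
    (ENNReal.ofReal_pos.mpr hε')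
  filter_upwards [hC', h2] with T e1 e2
  calc P {ω | ¬ G T ω} ≤ P ({ω | C < X T ω} ∪ {ω | ¬ (X T ω ≤ C → G T ω)}) := by
        refine measure_mono fun ω hω => ?_
        by_cases hx : X T ω ≤ C
        · exact Or.inr fun h => hω (h hx)
        · exact Or.inl (not_le.mp hx)
    _ ≤ ENNReal.ofReal (ε.toReal / 2) + ENNReal.ofReal (ε.toReal / 2) :=
        (measure_union_le _ _).trans (add_le_add e1 e2)
    _ = ε := by
        rw [← ENNReal.ofReal_add hε'.le hε'.le, add_halves, ENNReal.ofReal_toReal htop]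

theorem of_tendstoInMeasure {E : Type*} [PseudoMetricSpace E] {f : ℕ → Ω → E} {a : E}
    (h : TendstoInMeasure P f atTop fun _ => a) {ε : ℝ} (hε : 0 < ε) :
    WithProbTendingToOne P fun T ω => dist (f T ω) a < ε := by
  have := tendstoInMeasure_iff_dist.mp h ε hε
  simpa [WithProbTendingToOne] using this

end WithProbTendingToOne

theorem tendstoInMeasure_of_withProbTendingToOne {f : ℕ → Ω → ℝ} {a : ℝ}
    (h : ∀ ε, 0 < ε → WithProbTendingToOne P fun T ω => |f T ω - a| ≤ ε) :
    TendstoInMeasure P f atTop fun _ => a := by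
  refine tendstoInMeasure_iff_dist.mpr fun ε hε => ?_
  refine tendsto_of_tendsto_of_tendsto_of_le_of_le tendsto_const_nhds (h (ε / 2) (by positivity))
    (fun _ => zero_le) fun T => measure_mono fun ω hω => ?_
  have h1 : ε ≤ |f T ω - a| := hω
  change ¬ _
  linarith

namespace BoundedInProb

theorem add {X Y : ℕ → Ω → ℝ} (hX : BoundedInProb P X) (hY : BoundedInProb P Y) :
    BoundedInProb P fun T ω => X T ω + Y T ω := by
  intro η hη
  obtain ⟨C, hC, h1⟩ := hX (η / 2) (by positivity)
  obtain ⟨C', hC', h2⟩ := hY (η / 2) (by positivity)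
  refine ⟨C + C', by positivity, ?_⟩
  filter_upwards [h1, h2] with T e1 e2
  calc P {ω | C + C' < X T ω + Y T ω} ≤ P ({ω | C < X T ω} ∪ {ω | C' < Y T ω}) := by
        refine measure_mono fun ω hω => ?_
        by_contra hcon
        have h3 : ¬ (C < X T ω ∨ C' < Y T ω) := hcon
        have h4 : C + C' < X T ω + Y T ω := hω
        push Not at h3
        linarith
    _ ≤ ENNReal.ofReal (η / 2) + ENNReal.ofReal (η / 2) :=
        (measure_union_le _ _).trans (add_le_add e1 e2)
    _ = _ := by rw [← ENNReal.ofReal_add (by positivity) (by positivity), add_halves]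

theorem const (c : ℝ) : BoundedInProb P fun _ _ => c := by
  intro η _
  refine ⟨|c| + 1, by positivity, Eventually.of_forall fun T => ?_⟩
  have : {ω : Ω | |c| + 1 < c} = ∅ := by
    ext ω
    simpa using (le_abs_self c).trans (by linarith)
  rw [this]; simp

theorem sum {ι : Type*} (s : Finset ι) {X : ι → ℕ → Ω → ℝ} (h : ∀ i ∈ s, BoundedInProb P (X i)) :
    BoundedInProb P fun T ω => ∑ i ∈ s, X i T ω := by
  classical
  induction s using Finset.induction_on with
  | empty => simpa using const 0
  | insert a s ha ih =>
    simp_rw [Finset.sum_insert ha]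
    exact (h a (Finset.mem_insert_self a s)).add
      (ih fun i hi => h i (Finset.mem_insert_of_mem hi))

theorem of_integral_le [IsFiniteMeasure P] {X : ℕ → Ω → ℝ} {C : ℝ}
    (hX : ∀ᶠ T in atTop, Integrable (X T) P ∧ 0 ≤ᵐ[P] X T ∧ ∫ ω, X T ω ∂P ≤ C) :
    BoundedInProb P X := by
  intro η hη
  refine ⟨(|C| + 1) / η, by positivity, ?_⟩
  filter_upwards [hX] with T ⟨h1, h2, h3⟩
  have hc : 0 < (|C| + 1) / η := by positivity
  refine (measure_mono (t := {ω | (|C| + 1) / η ≤ X T ω}) fun ω hω =>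
    show (|C| + 1) / η ≤ X T ω from le_of_lt (show (|C| + 1) / η < X T ω from hω)).trans
    ((measure_ge_le_ofReal_integral_div h1 h2 hc h3).trans (ENNReal.ofReal_le_ofReal ?_))
  rw [div_div_eq_mul_div, div_le_iff₀ (by positivity)]
  nlinarith [le_abs_self C]

/-- Boundedness in probability from a tail bound that holds with probability tending to one. -/
theorem of_measure_le {X : ℕ → Ω → ℝ} {G : ℕ → Ω → Prop} (hG : WithProbTendingToOne P G)
    {φ : ℝ → ℝ} (hφ : Tendsto φ atTop (𝓝 0))
    (h : ∀ c, 0 < c → ∀ᶠ T in atTop,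
      P {ω | c < X T ω} ≤ P {ω | ¬ G T ω} + ENNReal.ofReal (φ c)) : BoundedInProb P X := by
  intro η hη
  obtain ⟨c, hc1, hc2⟩ := ((hφ.eventually_le_const (half_pos hη)).and
    (eventually_gt_atTop 0)).exists
  refine ⟨c, hc2, ?_⟩
  have h2 := ENNReal.tendsto_nhds_zero.mp hG (ENNReal.ofReal (η / 2))
    (ENNReal.ofReal_pos.mpr (half_pos hη))
  filter_upwards [h c hc2, h2] with T e1 e2
  calc _ ≤ _ := e1
    _ ≤ ENNReal.ofReal (η / 2) + ENNReal.ofReal (η / 2) :=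
        add_le_add e2 (ENNReal.ofReal_le_ofReal hc1)
    _ = _ := by rw [← ENNReal.ofReal_add (by positivity) (by positivity), add_halves]

end BoundedInProb

variable [IsProbabilityMeasure P] {F : ℕ → MeasurableSpace Ω}

/-- The weak law of large numbers with a normalization `s`. -/
theorem measure_mul_lt_abs_sum_le (hF : ∀ t, F t ≤ m0) (hmono : Monotone F)
    {M N : ℕ} {x : ℕ → Ω → ℝ} {r : ℝ} (hr0 : 0 < r) (hr2 : r ≤ 2)
    (hx : ∀ t, N ≤ t → Measurable[F t] (x t)) (hi : ∀ t, N ≤ t → Integrable (x t) P)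
    (h0 : ∀ t, N ≤ t → P[x t | F (t - M)] =ᵐ[P] 0)
    (hir : ∀ t, N ≤ t → Integrable (fun ω => |x t ω| ^ r) P) {η c s : ℝ} (hη : 0 ≤ η) (hc : 0 < c)
    (hs : 0 < s) (T : ℕ) :
    P {ω | c * s < |∑ t ∈ Finset.Icc N T, x t ω|} ≤
      P {ω | η * s ^ r < ∑ t ∈ Finset.Icc N T, (P[fun ω => |x t ω| ^ r | F (t - M)]) ω} +
        ENNReal.ofReal (η / c ^ r + 4 * η / c + 8 * M * η / c ^ 2) := by
  have hpow : ∀ t, (fun ω => |s⁻¹ * x t ω| ^ r) = (s ^ r)⁻¹ • fun ω => |x t ω| ^ r := fun t => by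
    ext ω
    rw [abs_mul, abs_of_pos (inv_pos.mpr hs), Real.mul_rpow (inv_pos.mpr hs).le (abs_nonneg _),
      Real.inv_rpow hs.le]
    rfl
  have hmain := measure_abs_sum_gt_le hF hmono (M := M) (N := N) (x := fun t ω => s⁻¹ * x t ω)
    hr0 hr2
    (fun t ht => ((hx t ht).const_mul s⁻¹).stronglyMeasurable)
    (fun t ht => (hi t ht).const_mul s⁻¹)
    (fun t ht => (condExp_smul s⁻¹ (x t) (F (t - M))).trans (by
      filter_upwards [h0 t ht] with ω hω
      simp [hω]))
    (fun t ht => by rw [hpow]; exact (hir t ht).smul _) hη hc T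
  refine le_trans (measure_mono fun ω hω => ?_) (hmain.trans (add_le_add_left (measure_mono_ae ?_) _))
  · have h1 : c * s < |∑ t ∈ Finset.Icc N T, x t ω| := hω
    change c < _
    rw [← Finset.mul_sum, abs_mul, abs_of_pos (inv_pos.mpr hs), inv_mul_eq_div, lt_div_iff₀ hs]
    exact h1
  · have h2 : ∀ᵐ ω ∂P, ∀ t, (P[fun ω => |s⁻¹ * x t ω| ^ r | F (t - M)]) ω =
        (s ^ r)⁻¹ * (P[fun ω => |x t ω| ^ r | F (t - M)]) ω := by
      rw [ae_all_iff]
      intro t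
      rw [hpow]
      exact condExp_smul _ _ _
    filter_upwards [h2] with ω e1 e2
    have e3 : η < ∑ t ∈ Finset.Icc N T, (P[fun ω => |s⁻¹ * x t ω| ^ r | F (t - M)]) ω := e2
    simp_rw [e1] at e3
    rw [← Finset.mul_sum, inv_mul_eq_div, lt_div_iff₀ (Real.rpow_pos_of_pos hs r)] at e3
    exact e3

end InProbability

/-! ### Growth of the score, its derivatives and their conditional moments. -/

namespace SpatioTemporal.Study

variable {Ω S 𝒳 𝓡 : Type*} [MeasurableSpace S] {p L K : ℕ}
variable {D : Study Ω S 𝒳 𝓡 p L K}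
variable [mΩ : MeasurableSpace Ω] [MeasurableSpace 𝒳] {P : Measure Ω}

variable (D) in
/-- `∂ψ_k/∂γ_j` centred at its conditional expectation. -/
noncomputable def psiDev (P : Measure Ω) (k j : Fin K) (t : ℕ) (ω : Ω) : ℝ :=
  D.psiDeriv k j t ω - (P[D.psiDeriv k j t | D.fullSigma (t - D.M)]) ω

variable (D) in
/-- The conditional second moments of the score. -/
noncomputable def scoreInfo (P : Measure Ω) (k j : Fin K) (t : ℕ) : Ω → ℝ :=
  P[fun ω => D.psiObs t D.γs ω k * D.psiObs t D.γs ω j | D.fullSigma (t - D.M)]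

variable [MeasurableSpace 𝓡]

theorem ScoreRegular.abs_sum_scoreInfo_sub_le {Vps : Matrix (Fin K) (Fin K) ℝ}
    (hR : D.ScoreRegular P Vps) {ε : ℝ} (hε : 0 < ε) :
    WithProbTendingToOne P fun T ω => ∀ k j,
      |∑ t ∈ Finset.Icc 1 T, D.scoreInfo P k j t ω - T * Vps k j| ≤ ε * T := by
  refine WithProbTendingToOne.forall_finite fun k => WithProbTendingToOne.forall_finite fun j => ?_
  refine (WithProbTendingToOne.of_tendstoInMeasure (hR.information k j) hε).mono ?_
  filter_upwards [eventually_gt_atTop 0] with T hT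
  refine ae_of_all _ fun ω h => ?_
  have hT' : (0 : ℝ) < T := by exact_mod_cast hT
  rw [Real.dist_eq] at h
  simp only [Matrix.of_apply] at h
  change |(∑ t ∈ Finset.Icc 1 T, D.scoreInfo P k j t ω) / T - Vps k j| < ε at h
  have e : ∑ t ∈ Finset.Icc 1 T, D.scoreInfo P k j t ω - T * Vps k j =
      ((∑ t ∈ Finset.Icc 1 T, D.scoreInfo P k j t ω) / T - Vps k j) * T := by
    field_simp
  rw [e, abs_mul, abs_of_pos hT']
  exact mul_le_mul_of_nonneg_right h.le hT'.le

namespace LocalScore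

variable {r C : ℝ} {B : (t : ℕ) → History S 𝒳 t → PointPattern S → ℝ} {t : ℕ}
  {Vps : Matrix (Fin K) (Fin K) ℝ}

theorem measurable_psiDev (hL : D.LocalScore P r C B) (hS : D.Setting P) (ht : 1 ≤ t)
    (k j : Fin K) : Measurable[D.fullSigma t] (D.psiDev P k j t) :=
  (hL.measurable_psiDeriv hS ht k j).sub
    (stronglyMeasurable_condExp.measurable.mono (fullSigma_mono (Nat.sub_le t D.M)) le_rfl)

theorem integrable_psiDev (hR : D.ScoreRegular P Vps) (ht : 1 ≤ t) (k j : Fin K) :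
    Integrable (D.psiDev P k j t) P :=
  (hR.deriv_integrable k j t ht).sub integrable_condExp

theorem scoreInfo_diag_nonneg (k : Fin K) (t : ℕ) : 0 ≤ᵐ[P] D.scoreInfo P k k t :=
  condExp_nonneg (ae_of_all _ fun _ => mul_self_nonneg _)

theorem abs_rpow_two_eq (k : Fin K) (t : ℕ) : (fun ω => |D.psiObs t D.γs ω k| ^ (2 : ℝ)) =
    fun ω => D.psiObs t D.γs ω k * D.psiObs t D.γs ω k := by
  ext ω
  rw [Real.rpow_two, sq_abs, sq]

variable [IsProbabilityMeasure P]

theorem condExp_psiDev (hS : D.Setting P) (hR : D.ScoreRegular P Vps) (ht : 1 ≤ t)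
    (k j : Fin K) : P[D.psiDev P k j t | D.fullSigma (t - D.M)] =ᵐ[P] 0 := by
  have h1 : P[D.psiDev P k j t | D.fullSigma (t - D.M)] =ᵐ[P]
      P[D.psiDeriv k j t | D.fullSigma (t - D.M)] -
      P[P[D.psiDeriv k j t | D.fullSigma (t - D.M)] | D.fullSigma (t - D.M)] :=
    condExp_sub (hR.deriv_integrable k j t ht) integrable_condExp _
  have h2 : P[P[D.psiDeriv k j t | D.fullSigma (t - D.M)] | D.fullSigma (t - D.M)] =ᵐ[P]
      P[D.psiDeriv k j t | D.fullSigma (t - D.M)] :=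
    condExp_condExp_of_le le_rfl (hS.fullSigma_le _)
  refine h1.trans ?_
  filter_upwards [h2] with ω e
  simp [e]

/-- The conditional second moments of the score grow at most linearly. -/
theorem sum_scoreInfo_le (hR : D.ScoreRegular P Vps) :
    WithProbTendingToOne P fun T ω => ∀ k, ∀ N, 1 ≤ N →
      ∑ t ∈ Finset.Icc N T, D.scoreInfo P k k t ω ≤ (∑ k, |Vps k k| + 1) * T := by
  refine (hR.abs_sum_scoreInfo_sub_le one_pos).mono (Eventually.of_forall fun T => ?_)
  filter_upwards [ae_all_iff.mpr fun k => ae_all_iff.mpr fun t =>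
    scoreInfo_diag_nonneg (D := D) (P := P) k t] with ω h0 h k N hN
  have h1 : ∑ t ∈ Finset.Icc N T, D.scoreInfo P k k t ω ≤
      ∑ t ∈ Finset.Icc 1 T, D.scoreInfo P k k t ω :=
    Finset.sum_le_sum_of_subset_of_nonneg (Finset.Icc_subset_Icc_left hN) fun t _ _ => h0 k t
  have h2 := (abs_le.mp (h k k)).2
  have h3 : |Vps k k| ≤ ∑ k, |Vps k k| :=
    Finset.single_le_sum (f := fun k => |Vps k k|) (fun _ _ => abs_nonneg _) (Finset.mem_univ k)
  have h4 : (T : ℝ) * Vps k k ≤ T * ∑ k, |Vps k k| :=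
    mul_le_mul_of_nonneg_left ((le_abs_self _).trans h3) (Nat.cast_nonneg T)
  linarith

/-- The normalized score is bounded in probability. -/
theorem boundedInProb_score (hL : D.LocalScore P r C B) (hS : D.Setting P)
    (hU : D.Unconfounded P) (hR : D.ScoreRegular P Vps) :
    BoundedInProb P fun T ω =>
      ∑ k, (∑ t ∈ Finset.Icc D.M T, D.psiObs t D.γs ω k) ^ 2 / (T : ℝ) := by
  refine BoundedInProb.sum _ fun k _ => ?_
  set A : ℝ := ∑ k, |Vps k k| + 1 with hA
  have hA0 : 0 ≤ A := add_nonneg (Finset.sum_nonneg fun _ _ => abs_nonneg _) zero_le_one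
  -- The tail function is that of the weak law with r = 2, η = A, threshold √c and normalization √T.
  refine BoundedInProb.of_measure_le (sum_scoreInfo_le (D := D) (P := P) hR)
    (φ := fun c => A / c + 4 * A / √c + 8 * D.M * A / c) ?_ ?_
  · have h1 : Tendsto (fun c : ℝ => √c) atTop atTop := Real.tendsto_sqrt_atTop
    have := ((tendsto_const_nhds (x := A)).div_atTop tendsto_id).add
      (((tendsto_const_nhds (x := 4 * A)).div_atTop h1)) |>.add
      ((tendsto_const_nhds (x := 8 * D.M * A)).div_atTop tendsto_id)
    simpa using this
  · intro c hc
    filter_upwards [eventually_gt_atTop 0] with T hT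
    have hT' : (0 : ℝ) < T := by exact_mod_cast hT
    have hge : ∀ t, D.M ≤ t → 1 ≤ t := fun t h => hS.one_le_M.trans h
    have hmain := measure_mul_lt_abs_sum_le (P := P) (F := D.fullSigma) hS.fullSigma_le
      fullSigma_mono (M := D.M) (N := D.M) (x := fun t ω => D.psiObs t D.γs ω k) (r := 2)
      two_pos le_rfl
      (fun t h => hL.measurable_psiObs hS (hge t h) k)
      (fun t h => (hL.memLp_psiObs hS hR (hge t h) k).integrable (by norm_num))
      (fun t h => hL.condExp_psiObs_eq_zero hS hU hR (hge t h) k)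
      (fun t h => by
        rw [abs_rpow_two_eq]
        exact hL.integrable_psiObs_mul hS hR (hge t h) k k)
      hA0 (Real.sqrt_pos.mpr hc) (Real.sqrt_pos.mpr hT') T
    refine le_trans (measure_mono fun ω hω => ?_)
      (hmain.trans (add_le_add (measure_mono fun ω hω => ?_) (le_of_eq ?_)))
    · have h1 : c < (∑ t ∈ Finset.Icc D.M T, D.psiObs t D.γs ω k) ^ 2 / (T : ℝ) := hω
      rw [lt_div_iff₀ hT'] at h1
      change √c * √(T : ℝ) < |∑ t ∈ Finset.Icc D.M T, D.psiObs t D.γs ω k|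
      rw [← Real.sqrt_mul hc.le, ← Real.sqrt_sq_eq_abs]
      exact Real.sqrt_lt_sqrt (by positivity) h1
    · have h1 : A * √(T : ℝ) ^ (2 : ℝ) < ∑ t ∈ Finset.Icc D.M T,
        (P[fun ω => |D.psiObs t D.γs ω k| ^ (2 : ℝ) | D.fullSigma (t - D.M)]) ω := hω
      simp_rw [abs_rpow_two_eq] at h1
      rw [Real.rpow_two, Real.sq_sqrt hT'.le] at h1
      exact fun h2 => absurd (h2 k D.M hS.one_le_M) (not_le.mpr h1)
    · rw [Real.rpow_two, Real.sq_sqrt hc.le]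

/-- The averaged squared norm of the score is bounded in probability. -/
theorem boundedInProb_sum_sq_score (hL : D.LocalScore P r C B) (hS : D.Setting P)
    (hR : D.ScoreRegular P Vps) :
    BoundedInProb P fun T ω =>
      ∑ k, (∑ t ∈ Finset.Icc 1 T, D.psiObs t D.γs ω k ^ 2) / (T : ℝ) := by
  refine BoundedInProb.sum _ fun k _ => ?_
  set A : ℝ := ∑ k, |Vps k k| + 1 with hA
  have hA0 : 0 ≤ A := add_nonneg (Finset.sum_nonneg fun _ _ => abs_nonneg _) zero_le_one
  -- Lenglart with η = A T and threshold c T leaves the tail A / c.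
  refine BoundedInProb.of_measure_le (sum_scoreInfo_le (D := D) (P := P) hR)
    (φ := fun c => A / c) (tendsto_const_nhds.div_atTop tendsto_id) fun c hc => ?_
  filter_upwards [eventually_gt_atTop 0] with T hT
  have hT' : (0 : ℝ) < T := by exact_mod_cast hT
  have hmain := measure_sum_gt_le (P := P) (F := D.fullSigma) hS.fullSigma_le fullSigma_mono D.M
    (a := fun t ω => D.psiObs t D.γs ω k * D.psiObs t D.γs ω k) (N := 1) (η := A * T) (c := c * T)
    (fun t h => hL.integrable_psiObs_mul hS hR h k k)
    (fun t => ae_of_all _ fun ω => mul_self_nonneg _) (by positivity) (by positivity) T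
  refine le_trans (measure_mono fun ω hω => ?_)
    (hmain.trans (add_le_add (measure_mono fun ω hω => ?_) (le_of_eq ?_)))
  · have h1 : c < (∑ t ∈ Finset.Icc 1 T, D.psiObs t D.γs ω k ^ 2) / (T : ℝ) := hω
    rw [lt_div_iff₀ hT'] at h1
    simp only [sq] at h1
    exact h1
  · have h1 : A * T < ∑ t ∈ Finset.Icc 1 T, D.scoreInfo P k k t ω := hω
    exact fun h2 => absurd (h2 k 1 le_rfl) (not_le.mpr h1)
  · rw [mul_div_mul_right _ _ hT'.ne']

theorem bound_nonneg (hL : D.LocalScore P r C B) (ht : 1 ≤ t) (h : History S 𝒳 t)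
    (w : PointPattern S) : 0 ≤ B t h w :=
  (norm_nonneg _).trans (hL.bound t ht h w _ hL.mem_ball)

theorem boundedInProb_bound (hL : D.LocalScore P r C B) :
    BoundedInProb P fun T ω => (∑ t ∈ Finset.Icc 1 T, B t (D.hist t ω) (D.W t ω)) / (T : ℝ) := by
  have hi : ∀ T : ℕ, ∀ t ∈ Finset.Icc 1 T, Integrable (fun ω => B t (D.hist t ω) (D.W t ω)) P :=
    fun T t ht => hL.integrable t (Finset.mem_Icc.mp ht).1
  refine BoundedInProb.of_integral_le (C := C) ?_
  filter_upwards [eventually_gt_atTop 0] with T hT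
  have hT' : (0 : ℝ) < T := by exact_mod_cast hT
  refine ⟨(integrable_finsetSum _ (hi T)).div_const _, ae_of_all _ fun ω => div_nonneg
    (Finset.sum_nonneg fun t ht => hL.bound_nonneg (Finset.mem_Icc.mp ht).1 _ _) hT'.le, ?_⟩
  rw [integral_div, integral_finsetSum _ (hi T), div_le_iff₀ hT']
  calc _ ≤ ∑ _t ∈ Finset.Icc 1 T, C :=
        Finset.sum_le_sum fun t ht => hL.integral_le t (Finset.mem_Icc.mp ht).1
    _ = C * T := by simp [mul_comm]

/-- The centred derivatives of the score average out. -/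
theorem abs_sum_psiDev_le (hL : D.LocalScore P r C B) (hS : D.Setting P)
    (hR : D.ScoreRegular P Vps) {ε : ℝ} (hε : 0 < ε) :
    WithProbTendingToOne P fun T ω => ∀ k j,
      |∑ t ∈ Finset.Icc D.M T, D.psiDev P k j t ω| ≤ ε * T := by
  refine WithProbTendingToOne.forall_finite fun k => WithProbTendingToOne.forall_finite fun j => ?_
  obtain ⟨q, hq0, hq2, hqi, hq⟩ := hR.deriv_stable k j
  have hge : ∀ t, D.M ≤ t → 1 ≤ t := fun t h => hS.one_le_M.trans h
  refine ENNReal.tendsto_nhds_zero.mpr fun κ hκ => ?_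
  rcases eq_or_ne κ ⊤ with rfl | htop
  · exact Eventually.of_forall fun _ => le_top
  have hκ' : 0 < κ.toReal / 2 := half_pos (ENNReal.toReal_pos hκ.ne' htop)
  -- The level ε is fixed, so a small η makes the weak law's tail smaller than half the allowed
  -- probability; stability of the derivatives handles the event that depends on η.
  have hlim : Tendsto (fun η : ℝ => η / ε ^ q + 4 * η / ε + 8 * D.M * η / ε ^ 2) (𝓝[>] 0)
      (𝓝 0) := by
    have : Continuous fun η : ℝ => η / ε ^ q + 4 * η / ε + 8 * D.M * η / ε ^ 2 := by fun_prop
    have h := this.tendsto 0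
    simp only [zero_div, mul_zero, add_zero] at h
    exact h.mono_left nhdsWithin_le_nhds
  obtain ⟨η, h1, h2⟩ := ((hlim.eventually_le_const hκ').and self_mem_nhdsWithin).exists
  have h3 := ENNReal.tendsto_nhds_zero.mp (WithProbTendingToOne.of_tendstoInMeasure hq h2)
    (ENNReal.ofReal (κ.toReal / 2)) (ENNReal.ofReal_pos.mpr hκ')
  have hv0 : ∀ᵐ ω ∂P, ∀ t, 0 ≤ (P[fun ω => |D.psiDev P k j t ω| ^ q | D.fullSigma (t - D.M)]) ω :=
    ae_all_iff.mpr fun t => condExp_nonneg (ae_of_all _ fun ω => Real.rpow_nonneg (abs_nonneg _) q)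
  filter_upwards [h3, eventually_gt_atTop 0] with T e3 hT
  have hT' : (0 : ℝ) < T := by exact_mod_cast hT
  have hmain := measure_mul_lt_abs_sum_le (P := P) (F := D.fullSigma) hS.fullSigma_le
    fullSigma_mono (M := D.M) (N := D.M) (x := D.psiDev P k j) hq0 hq2
    (fun t h => hL.measurable_psiDev hS (hge t h) k j)
    (fun t h => integrable_psiDev hR (hge t h) k j)
    (fun t h => condExp_psiDev hS hR (hge t h) k j)
    (fun t h => hqi t (hge t h)) (le_of_lt h2) hε hT' T
  calc _ ≤ P {ω | ε * T < |∑ t ∈ Finset.Icc D.M T, D.psiDev P k j t ω|} :=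
        measure_mono fun ω hω => not_le.mp hω
    _ ≤ _ := hmain
    _ ≤ ENNReal.ofReal (κ.toReal / 2) + ENNReal.ofReal (κ.toReal / 2) := by
        refine add_le_add (le_trans (measure_mono_ae ?_) e3) (ENNReal.ofReal_le_ofReal h1)
        filter_upwards [hv0] with ω h0 h4 h5
        have h6 : η * (T : ℝ) ^ q < ∑ t ∈ Finset.Icc D.M T,
          (P[fun ω => |D.psiDev P k j t ω| ^ q | D.fullSigma (t - D.M)]) ω := h4
        have h7 : dist ((∑ t ∈ Finset.Icc 1 T,
          (P[fun ω => |D.psiDev P k j t ω| ^ q | D.fullSigma (t - D.M)]) ω) / (T : ℝ) ^ q) 0 < η :=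
          h5
        rw [Real.dist_eq, sub_zero] at h7
        have h8 := (le_abs_self _).trans_lt h7
        rw [div_lt_iff₀ (Real.rpow_pos_of_pos hT' q)] at h8
        have h9 : ∑ t ∈ Finset.Icc D.M T,
            (P[fun ω => |D.psiDev P k j t ω| ^ q | D.fullSigma (t - D.M)]) ω ≤
            ∑ t ∈ Finset.Icc 1 T,
            (P[fun ω => |D.psiDev P k j t ω| ^ q | D.fullSigma (t - D.M)]) ω :=
          Finset.sum_le_sum_of_subset_of_nonneg (Finset.Icc_subset_Icc_left hS.one_le_M)
            fun t _ _ => h0 t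
        linarith
    _ = κ := by
        rw [← ENNReal.ofReal_add hκ'.le hκ'.le, add_halves, ENNReal.ofReal_toReal htop]

/-- The squares of the centred derivatives of the score grow at most quadratically. -/
theorem sum_sq_psiDev_le (hS : D.Setting P) (hR : D.ScoreRegular P Vps) :
    WithProbTendingToOne P fun T ω => ∀ k j,
      ∑ t ∈ Finset.Icc 1 T, D.psiDev P k j t ω ^ 2 ≤ (T : ℝ) ^ 2 := by
  refine WithProbTendingToOne.forall_finite fun k => WithProbTendingToOne.forall_finite fun j => ?_
  obtain ⟨q, hq0, hq2, hqi, hq⟩ := hR.deriv_stable k j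
  refine ENNReal.tendsto_nhds_zero.mpr fun κ hκ => ?_
  rcases eq_or_ne κ ⊤ with rfl | htop
  · exact Eventually.of_forall fun _ => le_top
  have hκ' : 0 < κ.toReal / 2 := half_pos (ENNReal.toReal_pos hκ.ne' htop)
  have h3 := ENNReal.tendsto_nhds_zero.mp (WithProbTendingToOne.of_tendstoInMeasure hq hκ')
    (ENNReal.ofReal (κ.toReal / 2)) (ENNReal.ofReal_pos.mpr hκ')
  filter_upwards [h3, eventually_gt_atTop 0] with T e3 hT
  have hT' : (0 : ℝ) < T := by exact_mod_cast hT
  have hTq : 0 < (T : ℝ) ^ q := Real.rpow_pos_of_pos hT' q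
  -- The ratio of η to the threshold is half the allowed probability.
  have hmain := measure_sum_gt_le (P := P) (F := D.fullSigma) hS.fullSigma_le fullSigma_mono D.M
    (a := fun t ω => |D.psiDev P k j t ω| ^ q) (N := 1) (η := κ.toReal / 2 * (T : ℝ) ^ q)
    (c := (T : ℝ) ^ q) hqi (fun t => ae_of_all _ fun ω => Real.rpow_nonneg (abs_nonneg _) q)
    (by positivity) hTq T
  calc _ ≤ P {ω | (T : ℝ) ^ q < ∑ t ∈ Finset.Icc 1 T, |D.psiDev P k j t ω| ^ q} := by
        refine measure_mono fun ω hω => ?_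
        by_contra hcon
        refine hω ?_
        have h1 : ∑ t ∈ Finset.Icc 1 T, |D.psiDev P k j t ω| ^ q ≤ (T : ℝ) ^ q := not_lt.mp hcon
        have hx : ∀ t, |D.psiDev P k j t ω / T| ^ q = |D.psiDev P k j t ω| ^ q / (T : ℝ) ^ q :=
          fun t => by rw [abs_div, abs_of_pos hT', Real.div_rpow (abs_nonneg _) hT'.le]
        -- Once the sum of the |x/T|^q is at most 1, each |x/T| is at most 1, and since q ≤ 2 its
        -- square is at most its q-th power.
        have h2 : ∑ t ∈ Finset.Icc 1 T, |D.psiDev P k j t ω / T| ^ q ≤ 1 := by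
          simp_rw [hx]
          rw [← Finset.sum_div, div_le_one hTq]
          exact h1
        have h4 : ∀ t ∈ Finset.Icc 1 T, (D.psiDev P k j t ω / T) ^ 2 ≤
            |D.psiDev P k j t ω / T| ^ q := fun t ht => by
          refine sq_le_rpow_of_abs_le_one ?_ hq0 hq2
          have h5 : |D.psiDev P k j t ω / T| ^ q ≤ 1 := le_trans (Finset.single_le_sum
            (f := fun t => |D.psiDev P k j t ω / T| ^ q)
            (fun _ _ => Real.rpow_nonneg (abs_nonneg _) q) ht) h2
          rwa [← Real.one_rpow q, Real.rpow_le_rpow_iff (abs_nonneg _) zero_le_one hq0] at h5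
        have h6 := (Finset.sum_le_sum h4).trans h2
        simp_rw [div_pow] at h6
        rw [← Finset.sum_div, div_le_one (by positivity)] at h6
        exact h6
    _ ≤ _ := hmain
    _ ≤ ENNReal.ofReal (κ.toReal / 2) + ENNReal.ofReal (κ.toReal / 2) := by
        refine add_le_add (le_trans (measure_mono fun ω h4 => ?_) e3) (le_of_eq ?_)
        · have h6 : κ.toReal / 2 * (T : ℝ) ^ q < ∑ t ∈ Finset.Icc 1 T,
            (P[fun ω => |D.psiDev P k j t ω| ^ q | D.fullSigma (t - D.M)]) ω := h4
          rw [← lt_div_iff₀ hTq] at h6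
          intro h5
          have h7 : dist ((∑ t ∈ Finset.Icc 1 T,
            (P[fun ω => |D.psiDev P k j t ω| ^ q | D.fullSigma (t - D.M)]) ω) / (T : ℝ) ^ q) 0 <
            κ.toReal / 2 := h5
          rw [Real.dist_eq, sub_zero] at h7
          exact absurd ((le_abs_self _).trans_lt h7) (not_lt.mpr h6.le)
        · rw [mul_div_cancel_right₀ _ hTq.ne']
    _ = κ := by
        rw [← ENNReal.ofReal_add hκ'.le hκ'.le, add_halves, ENNReal.ofReal_toReal htop]

/-- Finitely many terms are bounded in probability. -/
theorem boundedInProb_condExp_psiDeriv (N : ℕ) (k j : Fin K) :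
    BoundedInProb P fun _ ω => ∑ t ∈ Finset.Ico 1 N,
      |(P[D.psiDeriv k j t | D.fullSigma (t - D.M)]) ω| := by
  have hi : Integrable (fun ω => ∑ t ∈ Finset.Ico 1 N,
      |(P[D.psiDeriv k j t | D.fullSigma (t - D.M)]) ω|) P :=
    integrable_finsetSum _ fun t _ => integrable_condExp.abs
  exact BoundedInProb.of_integral_le (C := ∫ ω, ∑ t ∈ Finset.Ico 1 N,
      |(P[D.psiDeriv k j t | D.fullSigma (t - D.M)]) ω| ∂P)
    (Eventually.of_forall fun _ => ⟨hi, ae_of_all _ fun ω =>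
      Finset.sum_nonneg fun _ _ => abs_nonneg _, le_rfl⟩)

theorem boundedInProb_scoreInfo (N : ℕ) (k j : Fin K) :
    BoundedInProb P fun _ ω => ∑ t ∈ Finset.Ico 1 N, |D.scoreInfo P k j t ω| := by
  have hi : Integrable (fun ω => ∑ t ∈ Finset.Ico 1 N, |D.scoreInfo P k j t ω|) P :=
    integrable_finsetSum _ fun t _ => integrable_condExp.abs
  exact BoundedInProb.of_integral_le (C := ∫ ω, ∑ t ∈ Finset.Ico 1 N,
      |D.scoreInfo P k j t ω| ∂P)
    (Eventually.of_forall fun _ => ⟨hi, ae_of_all _ fun ω =>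
      Finset.sum_nonneg fun _ _ => abs_nonneg _, le_rfl⟩)

end LocalScore

end SpatioTemporal.Study

/-! ### Bounds for quadratic forms and the deterministic estimate at a root. -/

theorem abs_quadForm_le {K : ℕ} (A : Fin K → Fin K → ℝ) (u : EuclideanSpace ℝ (Fin K)) :
    |quadForm A u.ofLp| ≤ (∑ k, ∑ j, |A k j|) * ‖u‖ ^ 2 := by
  rw [quadForm, Finset.sum_mul]
  refine (Finset.abs_sum_le_sum_abs _ _).trans (Finset.sum_le_sum fun k _ => ?_)
  rw [Finset.sum_mul]
  refine (Finset.abs_sum_le_sum_abs _ _).trans (Finset.sum_le_sum fun j _ => ?_)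
  have h : ∀ i, |u.ofLp i| ≤ ‖u‖ := fun i => by
    simpa using PiLp.norm_apply_le u i
  rw [abs_mul, abs_mul, mul_comm, sq]
  exact mul_le_mul_of_nonneg_left
    (mul_le_mul (h k) (h j) (abs_nonneg _) (norm_nonneg _)) (abs_nonneg _)

theorem abs_sum_quadForm_le {ι : Type*} {K : ℕ} (s : Finset ι) (A : ι → Fin K → Fin K → ℝ) {c : ℝ}
    (hA : ∀ k j, |∑ t ∈ s, A t k j| ≤ c) (u : EuclideanSpace ℝ (Fin K)) :
    |∑ t ∈ s, quadForm (A t) u.ofLp| ≤ K ^ 2 * c * ‖u‖ ^ 2 := by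
  rw [← quadForm_sum]
  refine (abs_quadForm_le _ u).trans (mul_le_mul_of_nonneg_right ?_ (sq_nonneg _))
  calc _ ≤ ∑ _k : Fin K, ∑ _j : Fin K, c :=
        Finset.sum_le_sum fun k _ => Finset.sum_le_sum fun j _ => hA k j
    _ = K ^ 2 * c := by simp [sq, mul_assoc]

theorem sum_sq_quadForm_le {ι : Type*} {K : ℕ} (s : Finset ι) (A : ι → Fin K → Fin K → ℝ) {c : ℝ}
    (hA : ∀ k j, ∑ t ∈ s, A t k j ^ 2 ≤ c) (u : EuclideanSpace ℝ (Fin K)) :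
    ∑ t ∈ s, quadForm (A t) u.ofLp ^ 2 ≤ K ^ 4 * c * ‖u‖ ^ 4 := by
  have h1 : ∀ t, quadForm (A t) u.ofLp ^ 2 ≤ K ^ 2 * (∑ k, ∑ j, A t k j ^ 2) * ‖u‖ ^ 4 := fun t => by
    have e1 : quadForm (A t) u.ofLp ^ 2 ≤ ((∑ k, ∑ j, |A t k j|) * ‖u‖ ^ 2) ^ 2 := by
      rw [← sq_abs (quadForm _ _)]
      exact pow_le_pow_left₀ (abs_nonneg _) (abs_quadForm_le (A t) u) 2
    have e2 : (∑ k, ∑ j, |A t k j|) ^ 2 ≤ K ^ 2 * (∑ k, ∑ j, A t k j ^ 2) := by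
      have := sq_sum_le_card_mul_sum_sq (s := (Finset.univ : Finset (Fin K × Fin K)))
        (f := fun q => |A t q.1 q.2|)
      rw [Fintype.sum_prod_type, Fintype.sum_prod_type] at this
      simpa [sq] using this
    calc _ ≤ _ := e1
      _ = (∑ k, ∑ j, |A t k j|) ^ 2 * ‖u‖ ^ 4 := by ring
      _ ≤ _ := mul_le_mul_of_nonneg_right e2 (by positivity)
  calc _ ≤ ∑ t ∈ s, K ^ 2 * (∑ k, ∑ j, A t k j ^ 2) * ‖u‖ ^ 4 := Finset.sum_le_sum fun t _ => h1 t
    _ = K ^ 2 * (∑ k, ∑ j, ∑ t ∈ s, A t k j ^ 2) * ‖u‖ ^ 4 := by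
        rw [← Finset.sum_mul, ← Finset.mul_sum, Finset.sum_comm]
        congr 2
        exact Finset.sum_congr rfl fun k _ => Finset.sum_comm
    _ ≤ K ^ 2 * (∑ _k : Fin K, ∑ _j : Fin K, c) * ‖u‖ ^ 4 := by
        refine mul_le_mul_of_nonneg_right (mul_le_mul_of_nonneg_left ?_ (by positivity))
          (by positivity)
        exact Finset.sum_le_sum fun k _ => Finset.sum_le_sum fun j _ => hA k j
    _ = _ := by
        simp only [Finset.sum_const, Finset.card_univ, Fintype.card_fin, nsmul_eq_mul]
        ring

/-- The constant is the minimum of the form over the compact unit sphere, extended by homogeneity.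
-/
theorem Matrix.PosDef.exists_forall_le_quadForm {K : ℕ} {V : Matrix (Fin K) (Fin K) ℝ}
    (hV : V.PosDef) :
    ∃ a, 0 < a ∧ ∀ u : EuclideanSpace ℝ (Fin K), a * ‖u‖ ^ 2 ≤ quadForm (fun k j => V k j) u.ofLp := by
  have hpos : ∀ u : EuclideanSpace ℝ (Fin K), u ≠ 0 → 0 < quadForm (fun k j => V k j) u.ofLp := fun u hu => by
    have h := hV.dotProduct_mulVec_pos (x := u.ofLp) (by simpa using hu)
    refine h.trans_eq ?_
    simp only [dotProduct, Matrix.mulVec, quadForm, Finset.mul_sum, star_trivial]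
    exact Finset.sum_congr rfl fun k _ => Finset.sum_congr rfl fun j _ => by ring
  have h0 : quadForm (fun k j => V k j) (0 : Fin K → ℝ) = 0 := by simp [quadForm]
  rcases (Metric.sphere (0 : EuclideanSpace ℝ (Fin K)) 1).eq_empty_or_nonempty with he | hne
  -- An empty sphere means that the parameter space is zero, and any constant works.
  · refine ⟨1, one_pos, fun u => ?_⟩
    have hu : u = 0 := by
      by_contra hu
      have : ‖u‖⁻¹ • u ∈ Metric.sphere (0 : EuclideanSpace ℝ (Fin K)) 1 := by
        simp [norm_smul, norm_ne_zero_iff.mpr hu]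
      rw [he] at this
      exact this
    subst hu
    simp [h0]
  · have hc : Continuous fun u : EuclideanSpace ℝ (Fin K) => quadForm (fun k j => V k j) u.ofLp :=
      (continuous_quadForm (fun k j => V k j)).comp (PiLp.continuous_ofLp 2 _)
    obtain ⟨v, hv, hmin⟩ := (isCompact_sphere _ _).exists_isMinOn hne hc.continuousOn
    have hv0 : v ≠ 0 := fun h => by simp [h] at hv
    refine ⟨quadForm (fun k j => V k j) v.ofLp, hpos v hv0, fun u => ?_⟩
    rcases eq_or_ne u 0 with rfl | hu
    · simp [h0]
    have hn : ‖u‖ ≠ 0 := norm_ne_zero_iff.mpr hu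
    have h1 : quadForm (fun k j => V k j) v.ofLp ≤ quadForm (fun k j => V k j) (‖u‖⁻¹ • u).ofLp :=
      hmin (show ‖u‖⁻¹ • u ∈ Metric.sphere (0 : EuclideanSpace ℝ (Fin K)) 1 by
        simp [norm_smul, hn])
    rw [WithLp.ofLp_smul, quadForm_smul, inv_pow, inv_mul_eq_div, le_div_iff₀ (by positivity)] at h1
    exact h1

theorem sq_le_of_abs_sub_le {x a b q w : ℝ} (h : |x - (a + (b - q) / 2)| ≤ w) :
    x ^ 2 ≤ 4 * (a ^ 2 + b ^ 2 + w ^ 2 + q ^ 2) := by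
  have h2 := sq_le_sq' (abs_le.mp h).1 (abs_le.mp h).2
  obtain ⟨y, hy⟩ : ∃ y, y = x - (a + (b - q) / 2) := ⟨_, rfl⟩
  rw [← hy] at h2
  have h3 : x = y + a + b / 2 - q / 2 := by rw [hy]; ring
  rw [h3]
  nlinarith [sq_nonneg (y - a), sq_nonneg (y - b / 2), sq_nonneg (y + q / 2),
    sq_nonneg (a - b / 2), sq_nonneg (a + q / 2), sq_nonneg (b / 2 + q / 2),
    sq_nonneg b, sq_nonneg q]

set_option maxHeartbeats 1000000 in
/-- Deterministic bound on the squares of the log likelihood ratios at a root of the estimating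
equation. -/
theorem sum_sq_le_of_estimating_equation {M T : ℕ} (hM : 1 ≤ M) (hMT : M ≤ T)
    {a b q e B X : ℕ → ℝ} {d l C : ℝ} (hl : 0 < l) (hC : 0 < C) (hd0 : 0 ≤ d) (hd1 : d ≤ 1)
    (hCd : C * d ≤ l / 8) (hq : ∀ t ∈ Finset.Icc 1 T, 0 ≤ q t) (hB : ∀ t ∈ Finset.Icc 1 T, 0 ≤ B t)
    (he : ∀ t ∈ Finset.Icc 1 T, |e t| ≤ B t * d ^ 3)
    (hX : ∀ t ∈ Finset.Icc 1 T, |X t - (a t + (b t - q t) / 2)| ≤ B t * d ^ 3)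
    (hroot : ∑ t ∈ Finset.Icc M T, (a t + (b t - q t) + e t) = 0)
    (ha : (∑ t ∈ Finset.Icc M T, a t) ^ 2 ≤ C * T * d ^ 2)
    (ha2 : ∑ t ∈ Finset.Icc 1 T, a t ^ 2 ≤ C * T * d ^ 2)
    (hb : |∑ t ∈ Finset.Icc M T, b t| ≤ l / 8 * T * d ^ 2)
    (hb2 : ∑ t ∈ Finset.Icc 1 T, b t ^ 2 ≤ C * T ^ 2 * d ^ 4)
    (hql : l / 2 * T * d ^ 2 ≤ ∑ t ∈ Finset.Icc M T, q t)
    (hqe : ∑ t ∈ Finset.Ico 1 M, q t ≤ C * d ^ 2)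
    (hBT : ∑ t ∈ Finset.Icc 1 T, B t ≤ C * T) :
    ∑ t ∈ Finset.Icc 1 T, X t ^ 2 ≤
      4 * (C * (16 * C / l ^ 2) + C * (16 * C / l ^ 2) ^ 2 + C ^ 2 * (16 * C / l ^ 2) ^ 2 +
        (1 + C * (16 * C / l ^ 2) + l / 4 * (16 * C / l ^ 2) + C) ^ 2) := by
  have hsplit : ∀ f : ℕ → ℝ, ∑ t ∈ Finset.Icc 1 T, f t =
      ∑ t ∈ Finset.Ico 1 M, f t + ∑ t ∈ Finset.Icc M T, f t := fun f => by
    rw [← Finset.Ico_succ_right_eq_Icc, ← Finset.Ico_succ_right_eq_Icc]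
    exact (Finset.sum_Ico_consecutive f hM (hMT.trans (Nat.le_succ T))).symm
  have hT : (0 : ℝ) < T := by exact_mod_cast lt_of_lt_of_le hM hMT
  set E := 16 * C / l ^ 2 with hE
  have hE0 : 0 < E := by positivity
  have hsub : ∀ t ∈ Finset.Icc M T, t ∈ Finset.Icc 1 T :=
    fun t ht => Finset.Icc_subset_Icc_left hM ht
  have hBM : ∑ t ∈ Finset.Icc M T, B t ≤ C * T :=
    (Finset.sum_le_sum_of_subset_of_nonneg (Finset.Icc_subset_Icc_left hM)
      fun t ht _ => hB t ht).trans hBT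
  have hesum : ∑ t ∈ Finset.Icc M T, e t ≤ l / 8 * T * d ^ 2 := by
    calc _ ≤ ∑ t ∈ Finset.Icc M T, B t * d ^ 3 :=
          Finset.sum_le_sum fun t ht => (le_abs_self _).trans (he t (hsub t ht))
      _ = (∑ t ∈ Finset.Icc M T, B t) * d ^ 3 := by rw [Finset.sum_mul]
      _ ≤ C * T * d ^ 3 := mul_le_mul_of_nonneg_right hBM (by positivity)
      _ = (C * d) * (T * d ^ 2) := by ring
      _ ≤ l / 8 * (T * d ^ 2) := mul_le_mul_of_nonneg_right hCd (by positivity)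
      _ = _ := by ring
  -- The estimating equation solved for the information term.
  have hqeq : ∑ t ∈ Finset.Icc M T, q t = ∑ t ∈ Finset.Icc M T, a t +
      ∑ t ∈ Finset.Icc M T, b t + ∑ t ∈ Finset.Icc M T, e t := by
    have : ∑ t ∈ Finset.Icc M T, (a t + (b t - q t) + e t) = ∑ t ∈ Finset.Icc M T, a t +
      ∑ t ∈ Finset.Icc M T, b t + ∑ t ∈ Finset.Icc M T, e t - ∑ t ∈ Finset.Icc M T, q t := by
      rw [← Finset.sum_add_distrib, ← Finset.sum_add_distrib, ← Finset.sum_sub_distrib]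
      exact Finset.sum_congr rfl fun t _ => by ring
    linarith
  have hb' := (abs_le.mp hb).2
  set A := ∑ t ∈ Finset.Icc M T, a t with hA
  set y := T * d ^ 2 with hy
  have hy0 : 0 ≤ y := by positivity
  -- Of the l/2 in the lower bound on ∑ q, l/8 is lost to the centred derivatives and l/8 to the
  -- remainder.
  have h1 : l / 4 * y ≤ A := by rw [hy]; linarith
  have hAy : A ^ 2 ≤ C * y := by rw [hy]; linarith
  -- Root-T consistency: A dominates l y / 4 while A² is at most C y, so y = T d² is bounded.
  have hyE : y ≤ E := by
    rcases hy0.eq_or_lt with h | h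
    · rw [← h]; exact hE0.le
    have h2 : (l / 4 * y) ^ 2 ≤ C * y := (pow_le_pow_left₀ (by positivity) h1 2).trans hAy
    rw [hE, le_div_iff₀ (by positivity)]
    have h3 : y * (y * l ^ 2) ≤ y * (16 * C) := by nlinarith
    exact le_of_mul_le_mul_left h3 h
  have hAE : A ≤ 1 + C * E := by
    have : C * y ≤ C * E := mul_le_mul_of_nonneg_left hyE hC.le
    nlinarith [sq_nonneg (A - 1)]
  have hly : l / 4 * y ≤ l / 4 * E := mul_le_mul_of_nonneg_left hyE (by positivity)
  have hqM : ∑ t ∈ Finset.Icc M T, q t ≤ 1 + C * E + l / 4 * E := by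
    have : ∑ t ∈ Finset.Icc M T, q t ≤ A + l / 4 * y := by rw [hy]; linarith
    linarith
  have hd2 : d ^ 2 ≤ 1 := pow_le_one₀ hd0 hd1
  have hqT : ∑ t ∈ Finset.Icc 1 T, q t ≤ 1 + C * E + l / 4 * E + C := by
    rw [hsplit]
    have : C * d ^ 2 ≤ C := mul_le_of_le_one_right hC.le hd2
    linarith
  -- The sign of `q` enters here: the bound on its sum is also a bound on its sum of squares.
  have hq2 : ∑ t ∈ Finset.Icc 1 T, q t ^ 2 ≤ (1 + C * E + l / 4 * E + C) ^ 2 :=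
    (Finset.sum_sq_le_sq_sum_of_nonneg hq).trans
      (pow_le_pow_left₀ (Finset.sum_nonneg hq) hqT 2)
  have hB2 : ∑ t ∈ Finset.Icc 1 T, (B t * d ^ 3) ^ 2 ≤ C ^ 2 * E ^ 2 := by
    calc _ ≤ (∑ t ∈ Finset.Icc 1 T, B t * d ^ 3) ^ 2 :=
          Finset.sum_sq_le_sq_sum_of_nonneg fun t ht => mul_nonneg (hB t ht) (by positivity)
      _ = (∑ t ∈ Finset.Icc 1 T, B t) ^ 2 * (d ^ 4 * d ^ 2) := by rw [← Finset.sum_mul]; ring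
      -- Two of the six powers of d are discarded; the other four pair with T².
      _ ≤ (C * T) ^ 2 * (d ^ 4 * 1) := by
          refine mul_le_mul (pow_le_pow_left₀ (Finset.sum_nonneg hB) hBT 2) ?_ (by positivity)
            (by positivity)
          exact mul_le_mul_of_nonneg_left hd2 (by positivity)
      _ = C ^ 2 * y ^ 2 := by rw [hy]; ring
      _ ≤ _ := mul_le_mul_of_nonneg_left (pow_le_pow_left₀ hy0 hyE 2) (by positivity)
  have ha2' : ∑ t ∈ Finset.Icc 1 T, a t ^ 2 ≤ C * E := by
    have : C * y ≤ C * E := mul_le_mul_of_nonneg_left hyE hC.le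
    rw [hy] at this
    linarith
  have hb2' : ∑ t ∈ Finset.Icc 1 T, b t ^ 2 ≤ C * E ^ 2 := by
    have : C * y ^ 2 ≤ C * E ^ 2 :=
      mul_le_mul_of_nonneg_left (pow_le_pow_left₀ hy0 hyE 2) hC.le
    have h2 : C * y ^ 2 = C * T ^ 2 * d ^ 4 := by rw [hy]; ring
    linarith
  have hXt : ∀ t ∈ Finset.Icc 1 T, X t ^ 2 ≤
      4 * (a t ^ 2 + b t ^ 2 + (B t * d ^ 3) ^ 2 + q t ^ 2) :=
    fun t ht => sq_le_of_abs_sub_le (hX t ht)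
  refine (Finset.sum_le_sum hXt).trans ?_
  rw [← Finset.mul_sum, Finset.sum_add_distrib, Finset.sum_add_distrib, Finset.sum_add_distrib]
  linarith

/-! ### Roots of the estimating equation and their log likelihood ratios. -/

namespace SpatioTemporal.Study

variable {Ω S 𝒳 𝓡 : Type*} [MeasurableSpace S] {p L K : ℕ}
variable {D : Study Ω S 𝒳 𝓡 p L K}
variable [mΩ : MeasurableSpace Ω] [MeasurableSpace 𝒳] {P : Measure Ω}

variable (D) in
/-- The bounds on the score and its derivatives that hold with high probability. -/
structure ScoreBounds (P : Measure Ω) (B : (t : ℕ) → History S 𝒳 t → PointPattern S → ℝ)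
    (l C : ℝ) (T : ℕ) (ω : Ω) : Prop where
  le : D.M ≤ T
  score : ∀ u : EuclideanSpace ℝ (Fin K),
    (∑ t ∈ Finset.Icc D.M T, inner ℝ (D.psiObs t D.γs ω) u) ^ 2 ≤ C * T * ‖u‖ ^ 2
  score_sq : ∀ u : EuclideanSpace ℝ (Fin K),
    ∑ t ∈ Finset.Icc 1 T, (inner ℝ (D.psiObs t D.γs ω) u) ^ 2 ≤ C * T * ‖u‖ ^ 2
  dev : ∀ u : EuclideanSpace ℝ (Fin K),
    |∑ t ∈ Finset.Icc D.M T, quadForm (fun k j => D.psiDev P k j t ω) u.ofLp| ≤ l / 8 * T * ‖u‖ ^ 2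
  dev_sq : ∀ u : EuclideanSpace ℝ (Fin K),
    ∑ t ∈ Finset.Icc 1 T, quadForm (fun k j => D.psiDev P k j t ω) u.ofLp ^ 2 ≤
      C * T ^ 2 * ‖u‖ ^ 4
  info_nonneg : ∀ t, 1 ≤ t → ∀ u : EuclideanSpace ℝ (Fin K),
    0 ≤ -quadForm (fun k j => (P[D.psiDeriv k j t | D.fullSigma (t - D.M)]) ω) u.ofLp
  info : ∀ u : EuclideanSpace ℝ (Fin K), l / 2 * T * ‖u‖ ^ 2 ≤ ∑ t ∈ Finset.Icc D.M T,
    -quadForm (fun k j => (P[D.psiDeriv k j t | D.fullSigma (t - D.M)]) ω) u.ofLp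
  info_early : ∀ u : EuclideanSpace ℝ (Fin K), ∑ t ∈ Finset.Ico 1 D.M,
    -quadForm (fun k j => (P[D.psiDeriv k j t | D.fullSigma (t - D.M)]) ω) u.ofLp ≤ C * ‖u‖ ^ 2
  bound : ∑ t ∈ Finset.Icc 1 T, B t (D.hist t ω) (D.W t ω) ≤ C * T

variable [MeasurableSpace 𝓡] {r C : ℝ} {B : (t : ℕ) → History S 𝒳 t → PointPattern S → ℝ} {t : ℕ}
  {Vps : Matrix (Fin K) (Fin K) ℝ} [IsProbabilityMeasure P]

/-- The averaged conditional second moments converge to `Vps`, whose form is at least l ‖u‖², and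
the information inequality carries this over to the negated derivatives period by period. A quarter
of l pays for the convergence error and another quarter for the periods before M, which the
estimating equation omits. -/
theorem LocalScore.le_sum_info (hL : D.LocalScore P r C B) (hS : D.Setting P)
    (hU : D.Unconfounded P) (hR : D.ScoreRegular P Vps) {l : ℝ} (hl : 0 < l)
    (hV : ∀ u : EuclideanSpace ℝ (Fin K), l * ‖u‖ ^ 2 ≤ quadForm (fun k j => Vps k j) u.ofLp) :
    WithProbTendingToOne P fun T ω => ∀ u : EuclideanSpace ℝ (Fin K),
      l / 2 * T * ‖u‖ ^ 2 ≤ ∑ t ∈ Finset.Icc D.M T,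
        -quadForm (fun k j => (P[D.psiDeriv k j t | D.fullSigma (t - D.M)]) ω) u.ofLp := by
  have htight : BoundedInProb P fun _ ω => ∑ q : Fin K × Fin K,
      ∑ t ∈ Finset.Ico 1 D.M, |D.scoreInfo P q.1 q.2 t ω| :=
    BoundedInProb.sum _ fun q _ => boundedInProb_scoreInfo D.M q.1 q.2
  refine WithProbTendingToOne.of_boundedInProb htight fun c hc => ?_
  set ε := l / (4 * (K ^ 2 + 1)) with hε
  have hε0 : 0 < ε := by positivity
  have hεK : K ^ 2 * ε ≤ l / 4 := by
    rw [hε, ← mul_div_assoc, div_le_div_iff₀ (by positivity) (by positivity)]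
    nlinarith
  have hcT : ∀ᶠ T : ℕ in atTop, K ^ 2 * c ≤ l / 4 * T :=
    ((tendsto_natCast_atTop_atTop (R := ℝ)).const_mul_atTop (by positivity : 0 < l / 4)).eventually_ge_atTop _
  refine (hR.abs_sum_scoreInfo_sub_le hε0).mono ?_
  filter_upwards [eventually_ge_atTop D.M, hcT] with T hMT hT
  filter_upwards [hL.ae_information_le hS hU hR] with ω hinfo h1 h2 u
  have h3 : ∀ k j, |∑ t ∈ Finset.Ico 1 D.M, D.scoreInfo P k j t ω| ≤ c := fun k j =>
    (Finset.abs_sum_le_sum_abs _ _).trans ((Finset.single_le_sum (f := fun q : Fin K × Fin K =>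
      ∑ t ∈ Finset.Ico 1 D.M, |D.scoreInfo P q.1 q.2 t ω|) (fun q _ => Finset.sum_nonneg
        fun _ _ => abs_nonneg _) (Finset.mem_univ (k, j))).trans h2)
  have h4 := abs_sum_quadForm_le (Finset.Ico 1 D.M) (fun t k j => D.scoreInfo P k j t ω) h3 u
  have h5 := (abs_quadForm_le (fun k j => ∑ t ∈ Finset.Icc 1 T, D.scoreInfo P k j t ω -
    T * Vps k j) u).trans (mul_le_mul_of_nonneg_right
      (Finset.sum_le_sum fun k _ => Finset.sum_le_sum fun j _ => h1 k j) (sq_nonneg _))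
  have h6 : quadForm (fun k j => ∑ t ∈ Finset.Icc 1 T, D.scoreInfo P k j t ω) u.ofLp =
      quadForm (fun k j => ∑ t ∈ Finset.Icc 1 T, D.scoreInfo P k j t ω - T * Vps k j) u.ofLp +
      T * quadForm (fun k j => Vps k j) u.ofLp := by
    have e := quadForm_add (fun k j => ∑ t ∈ Finset.Icc 1 T, D.scoreInfo P k j t ω - T * Vps k j)
      (fun k j => T * Vps k j) u.ofLp
    simp only [sub_add_cancel] at e
    rw [e]
    congr 1
    simp only [quadForm, Finset.mul_sum]
    exact Finset.sum_congr rfl fun k _ => Finset.sum_congr rfl fun j _ => by ring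
  rw [quadForm_sum] at h6
  have h7 : ∑ t ∈ Finset.Icc 1 T, quadForm (fun k j => D.scoreInfo P k j t ω) u.ofLp =
      ∑ t ∈ Finset.Ico 1 D.M, quadForm (fun k j => D.scoreInfo P k j t ω) u.ofLp +
      ∑ t ∈ Finset.Icc D.M T, quadForm (fun k j => D.scoreInfo P k j t ω) u.ofLp := by
    rw [← Finset.Ico_succ_right_eq_Icc, ← Finset.Ico_succ_right_eq_Icc]
    exact (Finset.sum_Ico_consecutive _ hS.one_le_M (hMT.trans (Nat.le_succ T))).symm
  have h8 : ∑ t ∈ Finset.Icc D.M T, quadForm (fun k j => D.scoreInfo P k j t ω) u.ofLp ≤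
      ∑ t ∈ Finset.Icc D.M T,
        -quadForm (fun k j => (P[D.psiDeriv k j t | D.fullSigma (t - D.M)]) ω) u.ofLp :=
    Finset.sum_le_sum fun t ht => by
      have e := (hinfo t (hS.one_le_M.trans (Finset.mem_Icc.mp ht).1) u.ofLp).2
      have e2 : quadForm (fun k j => D.scoreInfo P k j t ω) u.ofLp +
        quadForm (fun k j => (P[D.psiDeriv k j t | D.fullSigma (t - D.M)]) ω) u.ofLp ≤ 0 := e
      linarith
  have h9 := mul_le_mul_of_nonneg_left (hV u) (Nat.cast_nonneg (α := ℝ) T)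
  have h10 : (∑ _k : Fin K, ∑ _j : Fin K, ε * T) = K ^ 2 * ε * T := by simp; ring
  rw [h10] at h5
  have h11 := mul_le_mul_of_nonneg_right hεK (by positivity : 0 ≤ (T : ℝ) * ‖u‖ ^ 2)
  have h12 := mul_le_mul_of_nonneg_right hT (sq_nonneg ‖u‖)
  have h13 := (abs_le.mp h4).2
  have h14 := (abs_le.mp h5).1
  nlinarith

/-- With probability tending to one, the score bounds hold with some constant. -/
theorem LocalScore.exists_of_scoreBounds (hL : D.LocalScore P r C B) (hS : D.Setting P)
    (hU : D.Unconfounded P) (hR : D.ScoreRegular P Vps) (hV : Vps.PosDef) :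
    ∃ l, 0 < l ∧ ∀ G : ℕ → Ω → Prop,
      (∀ c, 0 < c → WithProbTendingToOne P fun T ω => D.ScoreBounds P B l c T ω → G T ω) →
      WithProbTendingToOne P G := by
  obtain ⟨l, hl, hlV⟩ := hV.exists_forall_le_quadForm
  refine ⟨l, hl, fun G hG => ?_⟩
  have t1 : BoundedInProb P fun _ ω => ∑ q : Fin K × Fin K, ∑ t ∈ Finset.Ico 1 D.M,
      |(P[D.psiDeriv q.1 q.2 t | D.fullSigma (t - D.M)]) ω| :=
    BoundedInProb.sum _ fun q _ => boundedInProb_condExp_psiDeriv D.M q.1 q.2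
  refine WithProbTendingToOne.of_boundedInProb t1 fun c1 hc1 => ?_
  refine WithProbTendingToOne.of_boundedInProb hL.boundedInProb_bound fun c2 hc2 => ?_
  refine WithProbTendingToOne.of_boundedInProb (hL.boundedInProb_sum_sq_score hS hR)
    fun c3 hc3 => ?_
  refine WithProbTendingToOne.of_boundedInProb (hL.boundedInProb_score hS hU hR)
    fun c4 hc4 => ?_
  -- One constant for all bounds: powers of K arise on passing from matrix entries to quadratic
  -- forms, and K⁴ alone serves the squared deviations, whose entries sum to at most T².
  set c := K ^ 2 * c1 + c2 + c3 + c4 + K ^ 4 with hc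
  have hc0 : 0 < c := by positivity
  have hK2 : 0 ≤ K ^ 2 * c1 := by positivity
  have hK4 : (0 : ℝ) ≤ K ^ 4 := by positivity
  set ε := l / (8 * (K ^ 2 + 1)) with hε
  have hε0 : 0 < ε := by positivity
  have hεK : K ^ 2 * ε ≤ l / 8 := by
    rw [hε, ← mul_div_assoc, div_le_div_iff₀ (by positivity) (by positivity)]
    nlinarith
  refine ((((hL.abs_sum_psiDev_le hS hR hε0).and (sum_sq_psiDev_le hS hR)).and
    (hL.le_sum_info hS hU hR hl hlV)).and (hG c hc0)).mono ?_
  filter_upwards [eventually_ge_atTop D.M] with T hMT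
  have hT : (0 : ℝ) < T := by exact_mod_cast lt_of_lt_of_le hS.one_le_M hMT
  filter_upwards [hL.ae_information_le hS hU hR] with ω hinfo ⟨⟨⟨d1, d2⟩, d3⟩, d4⟩ b4 b3 b2 b1
  refine d4 ⟨hMT, fun u => ?_, fun u => ?_, fun u => ?_, fun u => ?_, fun t ht u => ?_, d3,
    fun u => ?_, ?_⟩
  · rw [← sum_inner, ← sq_abs]
    refine (pow_le_pow_left₀ (abs_nonneg _) (abs_real_inner_le_norm _ u) 2).trans ?_
    rw [mul_pow]
    refine mul_le_mul_of_nonneg_right ?_ (sq_nonneg _)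
    rw [← Finset.sum_div, div_le_iff₀ hT] at b4
    rw [EuclideanSpace.norm_sq_eq]
    simp only [WithLp.ofLp_sum, Finset.sum_apply, Real.norm_eq_abs, sq_abs]
    exact b4.trans (mul_le_mul_of_nonneg_right (by linarith) hT.le)
  · have e : ∀ t, (inner ℝ (D.psiObs t D.γs ω) u) ^ 2 ≤
        (∑ k, D.psiObs t D.γs ω k ^ 2) * ‖u‖ ^ 2 := fun t => by
      rw [← sq_abs]
      refine (pow_le_pow_left₀ (abs_nonneg _) (abs_real_inner_le_norm _ u) 2).trans_eq ?_
      rw [mul_pow, EuclideanSpace.norm_sq_eq]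
      simp only [Real.norm_eq_abs, sq_abs]
    refine (Finset.sum_le_sum fun t _ => e t).trans ?_
    rw [← Finset.sum_mul, Finset.sum_comm]
    refine mul_le_mul_of_nonneg_right ?_ (sq_nonneg _)
    rw [← Finset.sum_div, div_le_iff₀ hT] at b3
    exact b3.trans (mul_le_mul_of_nonneg_right (by linarith) hT.le)
  · refine (abs_sum_quadForm_le _ (fun t k j => D.psiDev P k j t ω) d1 u).trans ?_
    refine mul_le_mul_of_nonneg_right ?_ (sq_nonneg _)
    rw [← mul_assoc]
    exact mul_le_mul_of_nonneg_right hεK hT.le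
  · refine (sum_sq_quadForm_le _ (fun t k j => D.psiDev P k j t ω) d2 u).trans ?_
    refine mul_le_mul_of_nonneg_right ?_ (by positivity)
    exact mul_le_mul_of_nonneg_right (by linarith) (by positivity)
  · have e := hinfo t ht u.ofLp
    linarith [e.1, e.2]
  · have e : ∀ k j, |∑ t ∈ Finset.Ico 1 D.M,
        (P[D.psiDeriv k j t | D.fullSigma (t - D.M)]) ω| ≤ c1 := fun k j =>
      (Finset.abs_sum_le_sum_abs _ _).trans ((Finset.single_le_sum (f := fun q : Fin K × Fin K =>
        ∑ t ∈ Finset.Ico 1 D.M, |(P[D.psiDeriv q.1 q.2 t | D.fullSigma (t - D.M)]) ω|)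
        (fun q _ => Finset.sum_nonneg fun _ _ => abs_nonneg _) (Finset.mem_univ (k, j))).trans b1)
    have e2 := (abs_le.mp (abs_sum_quadForm_le _
      (fun t k j => (P[D.psiDeriv k j t | D.fullSigma (t - D.M)]) ω) e u)).1
    rw [Finset.sum_neg_distrib]
    have e3 : K ^ 2 * c1 * ‖u‖ ^ 2 ≤ c * ‖u‖ ^ 2 :=
      mul_le_mul_of_nonneg_right (by linarith) (sq_nonneg _)
    linarith
  · rw [div_le_iff₀ hT] at b2
    exact b2.trans (mul_le_mul_of_nonneg_right (by linarith) hT.le)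

theorem quadForm_psiJac_eq (t : ℕ) (ω : Ω) (u : Fin K → ℝ) :
    quadForm (fun k j => D.psiJac k j t (D.hist t ω) (D.W t ω)) u =
      quadForm (fun k j => D.psiDev P k j t ω) u -
        -quadForm (fun k j => (P[D.psiDeriv k j t | D.fullSigma (t - D.M)]) ω) u := by
  rw [sub_neg_eq_add, ← quadForm_add]
  congr 1
  ext k j
  exact (sub_add_cancel _ _).symm

/-- A root of the estimating equation exists near the true parameter. -/
theorem ScoreBounds.exists_solvesScore (hL : D.LocalScore P r C B) (hS : D.Setting P) {l c ρ : ℝ}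
    (hl : 0 < l) (hc : 0 < c) (hρ : 0 < ρ) (hρr : ρ < r) (hcρ : c * ρ ≤ l / 16) {T : ℕ} {ω : Ω}
    (hT : c / ρ ^ 2 * (16 / l) ^ 2 < T) (hb : D.ScoreBounds P B l c T ω) :
    ∃ γ ∈ Metric.ball D.γs ρ, D.SolvesScore T γ ω := by
  have hge : ∀ t ∈ Finset.Icc D.M T, 1 ≤ t := fun t h => hS.one_le_M.trans (Finset.mem_Icc.mp h).1
  have hT0 : (0 : ℝ) < T := by exact_mod_cast lt_of_lt_of_le hS.one_le_M hb.le
  have hsub : Metric.closedBall D.γs ρ ⊆ Metric.ball D.γs r := Metric.closedBall_subset_ball hρr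
  set ell : EuclideanSpace ℝ (Fin K) → ℝ := fun g =>
    ∑ t ∈ Finset.Icc D.M T, Real.log (D.e t (D.hist t ω) (D.W t ω) g) with hell
  have hderiv : ∀ g ∈ Metric.ball D.γs r,
      HasGradientAt ell (∑ t ∈ Finset.Icc D.M T, D.psiObs t g ω) g := fun g hg => by
    rw [hasGradientAt_iff_hasFDerivAt, map_sum]
    refine (HasFDerivAt.fun_sum fun t ht =>
      (hL.hasGradientAt_log hS (hge t ht) _ _ hg).hasFDerivAt)
  have hcont : ContinuousOn ell (Metric.closedBall D.γs ρ) := fun g hg =>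
    (hderiv g (hsub hg)).continuousAt.continuousWithinAt
  obtain ⟨γ, hγ, hmax⟩ := (isCompact_closedBall D.γs ρ).exists_isMaxOn
    ⟨D.γs, Metric.mem_closedBall_self hρ.le⟩ hcont
  -- At a maximizer on the sphere the likelihood gain is nonnegative, so the linear term A must be
  -- of order T ρ². The score bound gives A² ≤ c T ρ², a contradiction for large T.
  have hint : γ ∈ Metric.ball D.γs ρ := by
    refine Metric.mem_ball.mpr (lt_of_le_of_ne (Metric.mem_closedBall.mp hγ) fun hd => ?_)
    rw [dist_eq_norm] at hd
    set u := γ - D.γs with hu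
    have h1 : ell D.γs ≤ ell γ := hmax (Metric.mem_closedBall_self hρ.le)
    have h2 : ell γ - ell D.γs ≤ ∑ t ∈ Finset.Icc D.M T, (inner ℝ (D.psiObs t D.γs ω) u +
        (quadForm (fun k j => D.psiDev P k j t ω) u.ofLp -
          -quadForm (fun k j => (P[D.psiDeriv k j t | D.fullSigma (t - D.M)]) ω) u.ofLp) / 2 +
        B t (D.hist t ω) (D.W t ω) * ρ ^ 3) := by
      rw [hell, ← Finset.sum_sub_distrib]
      refine Finset.sum_le_sum fun t ht => ?_
      have h3 := (abs_le.mp (hL.abs_log_sub_taylor_le hS (hge t ht) (D.hist t ω) (D.W t ω)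
        (hsub hγ))).2
      rw [quadForm_psiJac_eq (P := P), ← hu, hd] at h3
      have h4 : D.psiObs t D.γs ω = D.psi t (D.hist t ω) (D.W t ω) D.γs := rfl
      rw [h4]
      linarith
    rw [Finset.sum_add_distrib, Finset.sum_add_distrib, ← Finset.sum_div, Finset.sum_sub_distrib,
      ← Finset.sum_mul] at h2
    have h5 := hb.score u
    have h6 := (abs_le.mp (hb.dev u)).2
    have h7 := hb.info u
    have h8 : ∑ t ∈ Finset.Icc D.M T, B t (D.hist t ω) (D.W t ω) ≤ c * T :=
      (Finset.sum_le_sum_of_subset_of_nonneg (Finset.Icc_subset_Icc_left hS.one_le_M)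
        fun t ht _ => hL.bound_nonneg (Finset.mem_Icc.mp ht).1 _ _).trans hb.bound
    have h9 := mul_le_mul_of_nonneg_right h8 (by positivity : 0 ≤ ρ ^ 3)
    have h10 := mul_le_mul_of_nonneg_right hcρ (by positivity : 0 ≤ T * ρ ^ 2)
    rw [hd] at h5 h6 h7
    set A := ∑ t ∈ Finset.Icc D.M T, inner ℝ (D.psiObs t D.γs ω) u with hA
    -- The quadratic term contributes at most −(l/2 − l/8)/2 = −3l/16 and the cubic remainder at
    -- most l/16, in units of T ρ²; l/16 is a weakening of what remains.
    have h11 : l / 16 * (T * ρ ^ 2) ≤ A := by nlinarith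
    have h12 : (l / 16 * (T * ρ ^ 2)) ^ 2 ≤ c * T * ρ ^ 2 :=
      (pow_le_pow_left₀ (by positivity) h11 2).trans h5
    have h13 : (T : ℝ) * (T * ρ ^ 2) ≤ (c / ρ ^ 2 * (16 / l) ^ 2) * (T * ρ ^ 2) := by
      have e : (c / ρ ^ 2 * (16 / l) ^ 2) * (T * ρ ^ 2) = (c * T * ρ ^ 2) * ((16 / l) ^ 2 / ρ ^ 2) := by
        field_simp
      have e2 : (T : ℝ) * (T * ρ ^ 2) = (l / 16 * (T * ρ ^ 2)) ^ 2 * ((16 / l) ^ 2 / ρ ^ 2) := by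
        field_simp
      rw [e, e2]
      exact mul_le_mul_of_nonneg_right h12 (by positivity)
    exact absurd (le_of_mul_le_mul_right h13 (by positivity)) (not_le.mpr hT)
  refine ⟨γ, hint, hL.subset (hsub hγ), ?_⟩
  have hloc : IsLocalMax ell γ := by
    filter_upwards [Metric.isOpen_ball.mem_nhds hint] with g hg
    exact hmax (Metric.ball_subset_closedBall hg)
  have := hloc.hasFDerivAt_eq_zero (hderiv γ (hsub hγ)).hasFDerivAt
  exact (InnerProductSpace.toDual ℝ _).map_eq_zero_iff.mp this

theorem LocalScore.withProb_exists_solvesScore (hL : D.LocalScore P r C B) (hS : D.Setting P)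
    (hU : D.Unconfounded P) (hR : D.ScoreRegular P Vps) (hV : Vps.PosDef)
    {N : Set (EuclideanSpace ℝ (Fin K))} (hN : N ∈ 𝓝 D.γs) :
    WithProbTendingToOne P fun T ω => ∃ γ ∈ N, D.SolvesScore T γ ω := by
  obtain ⟨l, hl, h⟩ := hL.exists_of_scoreBounds hS hU hR hV
  refine h _ fun c hc => ?_
  obtain ⟨ρ0, hρ0, hρN⟩ := Metric.mem_nhds_iff.mp hN
  set ρ := min (min ρ0 (r / 2)) (l / 16 / c) with hρ
  have hr := hL.pos
  have hρp : 0 < ρ := by positivity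
  have h1 : ρ ≤ ρ0 := (min_le_left _ _).trans (min_le_left _ _)
  have h2 : ρ ≤ r / 2 := (min_le_left _ _).trans (min_le_right _ _)
  have h3 : c * ρ ≤ l / 16 := by
    have : ρ ≤ l / 16 / c := min_le_right _ _
    rwa [le_div_iff₀ hc, mul_comm] at this
  refine WithProbTendingToOne.of_ae ?_
  filter_upwards [(tendsto_natCast_atTop_atTop (R := ℝ)).eventually_gt_atTop
    (c / ρ ^ 2 * (16 / l) ^ 2)] with T hT
  refine ae_of_all _ fun ω hb => ?_
  obtain ⟨γ, hγ, hsol⟩ := hb.exists_solvesScore hL hS hl hc hρp (by linarith) h3 hT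
  exact ⟨γ, hρN (Metric.ball_subset_ball h1 hγ), hsol⟩

/-- The squared log likelihood ratios at a root near the true parameter have bounded sum. -/
theorem ScoreBounds.exists_sum_sq_log_le (hL : D.LocalScore P r C B) (hS : D.Setting P) {l c : ℝ}
    (hl : 0 < l) (hc : 0 < c) : ∃ C', ∀ T ω, D.ScoreBounds P B l c T ω → ∀ γ,
      D.SolvesScore T γ ω → dist γ D.γs < min (min r 1) (l / 8 / c) →
      ∑ t ∈ Finset.Icc 1 T, (Real.log (D.e t (D.hist t ω) (D.W t ω) γ) -
        Real.log (D.e t (D.hist t ω) (D.W t ω) D.γs)) ^ 2 ≤ C' := by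
  refine ⟨4 * (c * (16 * c / l ^ 2) + c * (16 * c / l ^ 2) ^ 2 + c ^ 2 * (16 * c / l ^ 2) ^ 2 +
    (1 + c * (16 * c / l ^ 2) + l / 4 * (16 * c / l ^ 2) + c) ^ 2), fun T ω hb γ hγ hd => ?_⟩
  -- The radius in the hypothesis gives the three smallness conditions: γ lies where the expansions
  -- hold, d ≤ 1, and c d ≤ l/8.
  have hγr : γ ∈ Metric.ball D.γs r :=
    Metric.mem_ball.mpr (hd.trans_le ((min_le_left _ _).trans (min_le_left _ _)))
  have hd1 : dist γ D.γs ≤ 1 := hd.le.trans ((min_le_left _ _).trans (min_le_right _ _))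
  have hd2 : c * dist γ D.γs ≤ l / 8 := by
    have := hd.le.trans (min_le_right _ _)
    rwa [le_div_iff₀ hc, mul_comm] at this
  rw [dist_eq_norm] at hd1 hd2
  set u := γ - D.γs with hu
  have hge : ∀ t ∈ Finset.Icc 1 T, 1 ≤ t := fun t h => (Finset.mem_Icc.mp h).1
  refine sum_sq_le_of_estimating_equation hS.one_le_M hb.le
    (a := fun t => inner ℝ (D.psiObs t D.γs ω) u)
    (b := fun t => quadForm (fun k j => D.psiDev P k j t ω) u.ofLp)
    (q := fun t => -quadForm (fun k j =>
      (P[D.psiDeriv k j t | D.fullSigma (t - D.M)]) ω) u.ofLp)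
    (e := fun t => inner ℝ (D.psiObs t γ ω) u - (inner ℝ (D.psiObs t D.γs ω) u +
      quadForm (fun k j => D.psiJac k j t (D.hist t ω) (D.W t ω)) u.ofLp))
    (B := fun t => B t (D.hist t ω) (D.W t ω)) hl hc (norm_nonneg u) hd1 hd2
    (fun t ht => hb.info_nonneg t (hge t ht) u)
    (fun t ht => hL.bound_nonneg (hge t ht) _ _) (fun t ht => ?_) (fun t ht => ?_) ?_
    (hb.score u) (hb.score_sq u) (hb.dev u) (hb.dev_sq u) (hb.info u) (hb.info_early u) hb.bound
  · have h1 := norm_sub_sub_fderiv_le_of_norm_iteratedFDeriv_two_le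
      (hL.contDiffOn_ball (hge t ht) (D.hist t ω) (D.W t ω))
      (hL.bound t (hge t ht) (D.hist t ω) (D.W t ω)) hγr
    have h2 : inner ℝ (D.psiObs t γ ω) u - (inner ℝ (D.psiObs t D.γs ω) u +
        quadForm (fun k j => D.psiJac k j t (D.hist t ω) (D.W t ω)) u.ofLp) =
        inner ℝ (D.psi t (D.hist t ω) (D.W t ω) γ - D.psi t (D.hist t ω) (D.W t ω) D.γs -
          fderiv ℝ (D.psi t (D.hist t ω) (D.W t ω)) D.γs (γ - D.γs)) u := by
      rw [inner_sub_left, inner_sub_left, ← hu, hL.inner_fderiv_psi (hge t ht), ← sub_sub]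
      rfl
    change |_| ≤ _
    rw [h2]
    refine (abs_real_inner_le_norm _ _).trans ?_
    refine (mul_le_mul_of_nonneg_right h1 (norm_nonneg _)).trans_eq ?_
    rw [hu]
    ring
  · have h1 := hL.abs_log_sub_taylor_le hS (hge t ht) (D.hist t ω) (D.W t ω) hγr
    rw [quadForm_psiJac_eq (P := P)] at h1
    exact h1
  -- The vector equation is used only in the direction u.
  · have h1 : ∑ t ∈ Finset.Icc D.M T, inner ℝ (D.psiObs t γ ω) u = 0 := by
      rw [← sum_inner, hγ.2, inner_zero_left]
    refine Eq.trans (Finset.sum_congr rfl fun t _ => ?_) h1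
    rw [quadForm_psiJac_eq (P := P)]
    ring

end SpatioTemporal.Study

/-! ### Effect of a perturbation of the weights on averages. -/

theorem abs_exp_sub_one_le_abs_mul_exp (x : ℝ) : |Real.exp x - 1| ≤ |x| * Real.exp |x| := by
  have h1 := Real.add_one_le_exp x
  have h2 := mul_le_mul_of_nonneg_right (Real.add_one_le_exp (-x)) (Real.exp_pos x).le
  rw [← Real.exp_add, neg_add_cancel, Real.exp_zero] at h2
  have h3 : Real.exp x ≤ Real.exp |x| := Real.exp_le_exp.mpr (le_abs_self x)
  have h4 : 1 ≤ Real.exp |x| := Real.one_le_exp (abs_nonneg x)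
  rw [abs_le]
  constructor
  · nlinarith [neg_abs_le x, abs_nonneg x]
  · nlinarith [mul_le_mul_of_nonneg_right (le_abs_self x) (Real.exp_pos x).le,
      mul_le_mul_of_nonneg_left h3 (abs_nonneg x)]

/-- Sums over windows of length `M`. -/
theorem sum_sum_window_le {M T : ℕ} {f : ℕ → ℝ} (hf : ∀ t, 0 ≤ f t) :
    ∑ t ∈ Finset.Icc M T, ∑ j ∈ Finset.Icc (t + 1 - M) t, f j ≤ M * ∑ j ∈ Finset.Icc 1 T, f j := by
  have h1 : ∑ t ∈ Finset.Icc M T, ∑ j ∈ Finset.Icc (t + 1 - M) t, f j =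
      ∑ j ∈ Finset.Icc 1 T, ∑ t ∈ (Finset.Icc M T).filter fun t => t + 1 - M ≤ j ∧ j ≤ t, f j := by
    refine Finset.sum_comm' fun t j => ?_
    simp only [Finset.mem_Icc, Finset.mem_filter]
    omega
  rw [h1, Finset.mul_sum]
  refine Finset.sum_le_sum fun j _ => ?_
  rw [Finset.sum_const, nsmul_eq_mul]
  refine mul_le_mul_of_nonneg_right ?_ (hf j)
  -- Each index belongs to at most M windows.
  have h2 : ((Finset.Icc M T).filter fun t => t + 1 - M ≤ j ∧ j ≤ t) ⊆ Finset.Ico j (j + M) := by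
    intro t ht
    simp only [Finset.mem_Icc, Finset.mem_filter, Finset.mem_Ico] at ht ⊢
    omega
  have h3 := Finset.card_le_card h2
  rw [Nat.card_Ico, Nat.add_sub_cancel_left] at h3
  exact_mod_cast h3

/-- A bounded sum of squares bounds each window sum Y uniformly and the sum of the Y². The
exponential is then Lipschitz on the relevant range, and |Y| ≤ θ + Y²/θ splits the error into a
small multiple of T and a constant. -/
theorem abs_sum_exp_sub_one_mul_le {M T : ℕ} (hM : 1 ≤ M) {X g : ℕ → ℝ} {C β θ : ℝ} (hβ : 0 ≤ β)
    (hθ : 0 < θ) (hX : ∑ j ∈ Finset.Icc 1 T, X j ^ 2 ≤ C)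
    (hg : ∀ t ∈ Finset.Icc M T, |g t| ≤ β) :
    |∑ t ∈ Finset.Icc M T, (Real.exp (-2 * ∑ j ∈ Finset.Icc (t + 1 - M) t, X j) - 1) * g t| ≤
      β * (2 * Real.exp (2 * √(M * C))) * (θ * T + M ^ 2 * C / θ) := by
  set Y : ℕ → ℝ := fun t => ∑ j ∈ Finset.Icc (t + 1 - M) t, X j with hY
  have hY2 : ∀ t ∈ Finset.Icc M T, Y t ^ 2 ≤ M * ∑ j ∈ Finset.Icc (t + 1 - M) t, X j ^ 2 :=
    fun t ht => by
      have h1 := sq_sum_le_card_mul_sum_sq (s := Finset.Icc (t + 1 - M) t) (f := X)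
      have h2 : t + 1 - (t + 1 - M) = M := by
        have := (Finset.mem_Icc.mp ht).1
        omega
      rwa [Nat.card_Icc, h2] at h1
  have hYC : ∀ t ∈ Finset.Icc M T, |Y t| ≤ √(M * C) := fun t ht => by
    refine Real.abs_le_sqrt ((hY2 t ht).trans (mul_le_mul_of_nonneg_left ?_ (Nat.cast_nonneg M)))
    refine (Finset.sum_le_sum_of_subset_of_nonneg ?_ fun _ _ _ => sq_nonneg _).trans hX
    rw [Finset.mem_Icc] at ht
    exact Finset.Icc_subset_Icc (by omega) ht.2
  have hYsum : ∑ t ∈ Finset.Icc M T, Y t ^ 2 ≤ M ^ 2 * C := by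
    refine (Finset.sum_le_sum hY2).trans ?_
    rw [← Finset.mul_sum, sq, mul_assoc]
    refine mul_le_mul_of_nonneg_left ?_ (Nat.cast_nonneg M)
    exact (sum_sum_window_le fun t => sq_nonneg _).trans
      (mul_le_mul_of_nonneg_left hX (Nat.cast_nonneg M))
  have hterm : ∀ t ∈ Finset.Icc M T, |(Real.exp (-2 * Y t) - 1) * g t| ≤
      β * (2 * Real.exp (2 * √(M * C))) * (θ + Y t ^ 2 / θ) := fun t ht => by
    have h1 := abs_exp_sub_one_le_abs_mul_exp (-2 * Y t)
    have h2 : |-2 * Y t| = 2 * |Y t| := by rw [abs_mul]; norm_num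
    have h3 : |Y t| ≤ θ + Y t ^ 2 / θ := by
      have h4 : 0 ≤ (|Y t| - θ) ^ 2 / θ := by positivity
      have h5 : (|Y t| - θ) ^ 2 / θ = Y t ^ 2 / θ - 2 * |Y t| + θ := by
        rw [← sq_abs (Y t)]; field_simp; ring
      have h6 := abs_nonneg (Y t)
      linarith
    have h4 : Real.exp (2 * |Y t|) ≤ Real.exp (2 * √(M * C)) :=
      Real.exp_le_exp.mpr (by linarith [hYC t ht])
    rw [h2] at h1
    rw [abs_mul]
    calc _ ≤ (2 * |Y t| * Real.exp (2 * |Y t|)) * β :=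
          mul_le_mul h1 (hg t ht) (abs_nonneg _) (by positivity)
      _ ≤ (2 * (θ + Y t ^ 2 / θ) * Real.exp (2 * √(M * C))) * β := by gcongr
      _ = _ := by ring
  refine (Finset.abs_sum_le_sum_abs _ _).trans ((Finset.sum_le_sum hterm).trans ?_)
  rw [← Finset.mul_sum, Finset.sum_add_distrib, ← Finset.sum_div]
  refine mul_le_mul_of_nonneg_left (add_le_add ?_ ?_) (by positivity)
  · rw [Finset.sum_const, nsmul_eq_mul, mul_comm, Nat.card_Icc]
    refine mul_le_mul_of_nonneg_left ?_ hθ.le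
    exact_mod_cast (by omega : T + 1 - M ≤ T)
  · exact div_le_div_of_nonneg_right hYsum hθ.le

/-! ### Least squares coefficients: bounds and measurability. -/

namespace SpatioTemporal

theorem ols_smul {p L : ℕ} (Z : Matrix (Fin p) (Fin L) ℝ) (c : ℝ) (y : Fin p → ℝ) :
    ols Z (c • y) = c • ols Z y := by
  rw [ols, ols, Matrix.mulVec_smul, Matrix.mulVec_smul]

/-- Coercivity of `ZᵀZ` bounds the least squares coefficients. -/
theorem mul_dotProduct_ols_le {p L : ℕ} (Z : Matrix (Fin p) (Fin L) ℝ) {c : ℝ} (hc : 0 < c)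
    (hZ : ∀ v, c * (v ⬝ᵥ v) ≤ Z.mulVec v ⬝ᵥ Z.mulVec v) (y : Fin p → ℝ) :
    c * (ols Z y ⬝ᵥ ols Z y) ≤ y ⬝ᵥ y := by
  have hq : ∀ v w, Z.mulVec v ⬝ᵥ w = v ⬝ᵥ Z.transpose.mulVec w := fun v w => by
    rw [Matrix.dotProduct_mulVec, Matrix.vecMul_transpose]
  have hu : IsUnit (Z.transpose * Z) := by
    rw [← Matrix.mulVec_injective_iff_isUnit]
    intro v w hvw
    have h1 : (Z.transpose * Z).mulVec (v - w) = 0 := by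
      rw [Matrix.mulVec_sub]; exact sub_eq_zero.mpr hvw
    have h2 := hZ (v - w)
    rw [hq, Matrix.mulVec_mulVec, h1, dotProduct_zero] at h2
    have h3 : (v - w) ⬝ᵥ (v - w) = 0 := by
      have h4 : 0 ≤ (v - w) ⬝ᵥ (v - w) := Finset.sum_nonneg fun i _ => mul_self_nonneg _
      nlinarith
    exact sub_eq_zero.mp (dotProduct_self_eq_zero.mp h3)
  have hdet := (Matrix.isUnit_iff_isUnit_det _).mp hu
  refine (hZ _).trans ?_
  set b := ols Z y with hb
  -- The normal equations: the fitted vector is the orthogonal projection of y, so its norm does not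
  -- exceed that of y.
  have h1 : Z.mulVec b ⬝ᵥ Z.mulVec b = Z.mulVec b ⬝ᵥ y := by
    have h3 : Z.transpose.mulVec (Z.mulVec b) = Z.transpose.mulVec y := by
      rw [hb, ols, Matrix.mulVec_mulVec, Matrix.mulVec_mulVec, Matrix.mul_nonsing_inv _ hdet,
        Matrix.one_mulVec]
    rw [hq, hq, h3]
  have h2 : 0 ≤ (Z.mulVec b - y) ⬝ᵥ (Z.mulVec b - y) :=
    Finset.sum_nonneg fun i _ => mul_self_nonneg _
  rw [sub_dotProduct, dotProduct_sub, dotProduct_sub, dotProduct_comm y (Z.mulVec b)] at h2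
  linarith

theorem measurable_matrix_det {α n : Type*} [Fintype n] [DecidableEq n] {m : MeasurableSpace α}
    {A : α → Matrix n n ℝ} (hA : ∀ i j, Measurable fun a => A a i j) :
    Measurable fun a => (A a).det := by
  simp_rw [Matrix.det_apply']
  exact Finset.measurable_fun_sum _ fun σ _ =>
    (Finset.measurable_fun_prod _ fun i _ => hA _ _).const_mul _

/-- The inverse is the adjugate times the inverse determinant, also for singular matrices under the
convention that 0⁻¹ = 0, so no invertibility is needed. -/
theorem measurable_matrix_inv {α n : Type*} [Fintype n] [DecidableEq n] {m : MeasurableSpace α}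
    {A : α → Matrix n n ℝ} (hA : ∀ i j, Measurable fun a => A a i j) (i j : n) :
    Measurable fun a => (A a)⁻¹ i j := by
  simp_rw [Matrix.inv_def, Ring.inverse_eq_inv', Matrix.smul_apply, Matrix.adjugate_apply,
    smul_eq_mul]
  refine (measurable_matrix_det hA).inv.mul (measurable_matrix_det fun k l => ?_)
  by_cases h : k = j
  · subst h
    simp only [Matrix.updateRow_self]
    exact measurable_const
  · simp only [Matrix.updateRow_ne h]
    exact hA k l

theorem measurable_ols {α : Type*} {m : MeasurableSpace α} {p L : ℕ}
    {Z : α → Matrix (Fin p) (Fin L) ℝ} {y : α → Fin p → ℝ}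
    (hZ : ∀ i l, Measurable fun a => Z a i l) (hy : ∀ i, Measurable fun a => y a i) (l : Fin L) :
    Measurable fun a => ols (Z a) (y a) l := by
  simp only [ols, Matrix.mulVec, dotProduct, Matrix.transpose_apply]
  refine Finset.measurable_fun_sum _ fun k _ => Measurable.mul
    (measurable_matrix_inv (A := fun a => (Z a).transpose * Z a) (fun i j => ?_) l k)
    (Finset.measurable_fun_sum _ fun i _ => (hZ i k).mul (hy i))
  simp only [Matrix.mul_apply, Matrix.transpose_apply]
  exact Finset.measurable_fun_sum _ fun k _ => (hZ k i).mul (hZ k j)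

theorem PointPattern.measurable_count {S : Type*} [MeasurableSpace S] {A : Set S}
    (hA : MeasurableSet A) : Measurable (PointPattern.count A) :=
  Measurable.mono (comap_measurable _)
    (le_iSup₂_of_le (f := fun (B : Set S) (_ : MeasurableSet B) =>
      MeasurableSpace.comap (PointPattern.count B) ⊤) A hA le_rfl) le_rfl

theorem PointPattern.count_le {S : Type*} (A : Set S) (w : PointPattern S) :
    w.count A ≤ w.count Set.univ :=
  Set.ncard_le_ncard (Set.inter_subset_inter_right _ (Set.subset_univ A))
    (w.locations.finite_toSet.inter_of_left _)

end SpatioTemporal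

/-! ### Weak law for bounded variables. -/

section BoundedAverages

variable {Ω : Type*} {m0 : MeasurableSpace Ω} {P : Measure Ω} [IsProbabilityMeasure P]
  {F : ℕ → MeasurableSpace Ω}

/-- The weak law of large numbers for bounded variables centred at their conditional
expectations. -/
theorem abs_sum_sub_condExp_le (hF : ∀ t, F t ≤ m0) (hmono : Monotone F) {M : ℕ}
    (hM : 1 ≤ M) {g : ℕ → Ω → ℝ} {β : ℝ} (hg : ∀ t, M ≤ t → Measurable[F t] (g t))
    (hβ : ∀ t, M ≤ t → ∀ᵐ ω ∂P, |g t ω| ≤ β) {ε : ℝ} (hε : 0 < ε) :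
    WithProbTendingToOne P fun T ω =>
      |∑ t ∈ Finset.Icc M T, (g t ω - (P[g t | F (t - M)]) ω)| ≤ ε * T := by
  have hβ0 : 0 ≤ β := by
    obtain ⟨ω, hω⟩ := (hβ M le_rfl).exists
    exact (abs_nonneg _).trans hω
  have hgi : ∀ t, M ≤ t → Integrable (g t) P := fun t ht =>
    Integrable.of_bound ((hg t ht).mono (hF t) le_rfl).aestronglyMeasurable β (hβ t ht)
  set x : ℕ → Ω → ℝ := fun t => g t - P[g t | F (t - M)] with hx
  have hxm : ∀ t, M ≤ t → Measurable[F t] (x t) := fun t ht => (hg t ht).sub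
    (stronglyMeasurable_condExp.measurable.mono (hmono (Nat.sub_le t M)) le_rfl)
  have hxb : ∀ t, M ≤ t → ∀ᵐ ω ∂P, |x t ω| ≤ 2 * β := fun t ht => by
    filter_upwards [hβ t ht, ae_bdd_abs_condExp_of_ae_bdd_abs (m := F (t - M)) (hβ t ht)]
      with ω h1 h2
    refine (abs_sub _ _).trans ?_
    linarith
  have hxi : ∀ t, M ≤ t → Integrable (x t) P := fun t ht => (hgi t ht).sub integrable_condExp
  have hx2m : ∀ t, M ≤ t → AEStronglyMeasurable (fun ω => |x t ω| ^ (2 : ℝ)) P := fun t ht =>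
    ((((hxm t ht).mono (hF t) le_rfl).norm).pow_const (2 : ℝ)).aestronglyMeasurable
  have hx2b : ∀ t, M ≤ t → ∀ᵐ ω ∂P, |(|x t ω| ^ (2 : ℝ))| ≤ (2 * β) ^ 2 := fun t ht => by
    filter_upwards [hxb t ht] with ω h
    rw [Real.rpow_two, abs_of_nonneg (sq_nonneg _)]
    exact pow_le_pow_left₀ (abs_nonneg _) h 2
  have hx0 : ∀ t, M ≤ t → P[x t | F (t - M)] =ᵐ[P] 0 := fun t ht => by
    have h1 : P[x t | F (t - M)] =ᵐ[P] P[g t | F (t - M)] - P[P[g t | F (t - M)] | F (t - M)] :=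
      condExp_sub (hgi t ht) integrable_condExp _
    have h2 : P[P[g t | F (t - M)] | F (t - M)] =ᵐ[P] P[g t | F (t - M)] :=
      condExp_condExp_of_le le_rfl (hF _)
    refine h1.trans ?_
    filter_upwards [h2] with ω e
    simp [e]
  have hcond : ∀ᵐ ω ∂P, ∀ t, M ≤ t →
      (P[fun ω => |x t ω| ^ (2 : ℝ) | F (t - M)]) ω ≤ (2 * β) ^ 2 := by
    rw [ae_all_iff]
    intro t
    by_cases ht : M ≤ t
    · filter_upwards [ae_bdd_abs_condExp_of_ae_bdd_abs (m := F (t - M)) (hx2b t ht)] with ω h _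
      exact (le_abs_self _).trans h
    · exact ae_of_all _ fun _ h => absurd h ht
  have hlim : Tendsto (fun T : ℕ => ((2 * β) ^ 2 / T) / ε ^ (2 : ℝ) + 4 * ((2 * β) ^ 2 / T) / ε +
      8 * M * ((2 * β) ^ 2 / T) / ε ^ 2) atTop (𝓝 0) := by
    have h1 : Tendsto (fun T : ℕ => (2 * β) ^ 2 / (T : ℝ)) atTop (𝓝 0) :=
      tendsto_const_nhds.div_atTop tendsto_natCast_atTop_atTop
    have := ((h1.div_const (ε ^ (2 : ℝ))).add ((h1.const_mul 4).div_const ε)).add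
      ((h1.const_mul (8 * M : ℝ)).div_const (ε ^ 2))
    simpa using this
  have hlim' := ENNReal.tendsto_ofReal hlim
  rw [ENNReal.ofReal_zero] at hlim'
  refine tendsto_of_tendsto_of_tendsto_of_le_of_le' tendsto_const_nhds hlim'
    (Eventually.of_forall fun _ => zero_le) ?_
  filter_upwards [eventually_gt_atTop 0] with T hT
  have hT' : (0 : ℝ) < T := by exact_mod_cast hT
  -- With η = (2β)²/T, η T² equals T (2β)², which bounds the sum of the conditional second moments
  -- almost surely. The event depending on η is then null, and the tail tends to zero.
  have hmain := measure_mul_lt_abs_sum_le hF hmono (M := M) (N := M) (x := x) two_pos le_rfl hxm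
    hxi hx0 (fun t ht => Integrable.of_bound (hx2m t ht) _ (hx2b t ht))
    (by positivity : 0 ≤ (2 * β) ^ 2 / (T : ℝ)) hε hT' T
  refine (measure_mono fun ω hω => ?_).trans (hmain.trans_eq ?_)
  · exact not_le.mp hω
  · refine (congrArg (· + _) ?_).trans (zero_add _)
    rw [← compl_mem_ae_iff]
    filter_upwards [hcond] with ω h h2
    have h3 : (2 * β) ^ 2 / (T : ℝ) * (T : ℝ) ^ (2 : ℝ) < ∑ t ∈ Finset.Icc M T,
      (P[fun ω => |x t ω| ^ (2 : ℝ) | F (t - M)]) ω := h2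
    have h4 : ∑ t ∈ Finset.Icc M T, (P[fun ω => |x t ω| ^ (2 : ℝ) | F (t - M)]) ω ≤
        ∑ t ∈ Finset.Icc M T, (2 * β) ^ 2 :=
      Finset.sum_le_sum fun t ht => h t (Finset.mem_Icc.mp ht).1
    have h5 : ((Finset.Icc M T).card : ℝ) ≤ T := by
      rw [Nat.card_Icc]; exact_mod_cast (by omega : T + 1 - M ≤ T)
    rw [Finset.sum_const, nsmul_eq_mul] at h4
    have h6 := mul_le_mul_of_nonneg_right h5 (by positivity : 0 ≤ (2 * β) ^ 2)
    have h7 : (2 * β) ^ 2 / (T : ℝ) * (T : ℝ) ^ (2 : ℝ) = T * (2 * β) ^ 2 := by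
      rw [Real.rpow_two]; field_simp
    linarith

end BoundedAverages

/-! ### The IPW coefficients and consistency of the variance bound estimator. -/

namespace SpatioTemporal.Study

variable {Ω S 𝒳 𝓡 : Type*} [MeasurableSpace S] {p L K : ℕ}
variable {D : Study Ω S 𝒳 𝓡 p L K}

theorem pseudoEffect_eq (t : ℕ) (γ : EuclideanSpace ℝ (Fin K)) (ω : Ω) (i : Fin p) :
    D.pseudoEffect t γ ω i =
      (D.weight D.f₂ t γ ω - D.weight D.f₁ t γ ω) * ((D.Yobs t ω).count (D.pixel i) : ℝ) :=
  (sub_mul _ _ _).symm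

variable [mΩ : MeasurableSpace Ω] [MeasurableSpace 𝒳] [MeasurableSpace 𝓡] {P : Measure Ω}

theorem Setting.measurable_weight (hS : D.Setting P) {f : PointPattern S → ℝ} (hf : Measurable f)
    {t : ℕ} (ht : D.M ≤ t) : Measurable[D.fullSigma t] (D.weight f t D.γs) := by
  have hM := hS.one_le_M
  refine Finset.measurable_fun_prod _ fun j hj => ?_
  rw [Finset.mem_Icc] at hj
  have hj1 : 1 ≤ j := by omega
  have h1 : Measurable[D.fullSigma t] fun ω => (D.hist j ω, D.W j ω) :=
    (hS.measurable_hist_W hj1).mono (fullSigma_mono hj.2) le_rfl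
  have h2 : Measurable[D.fullSigma t] fun ω => f (D.W j ω) :=
    hf.comp (measurable_W_fullSigma hj1 hj.2)
  exact h2.div ((hS.e_measurable j hj1 D.γs hS.γs_mem).comp h1)

theorem Setting.measurable_betaIPW (hS : D.Setting P) {t : ℕ} (ht : D.M ≤ t) (a : Fin L) :
    Measurable[D.fullSigma t] fun ω => D.betaIPW t D.γs ω a := by
  have hM := hS.one_le_M
  refine measurable_ols (fun i l => ?_) (fun i => ?_) a
  · have h1 : Measurable[D.fullSigma t] (D.Xobs (t + 1 - D.M)) :=
      hS.measurable_Xobs (by omega) (by omega)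
    exact (hS.measurable_z l).comp ((hS.measurable_R _ i).comp h1)
  · have h1 : Measurable[D.fullSigma t] fun ω => ((D.Yobs t ω).count (D.pixel i) : ℝ) :=
      (measurable_from_top (f := fun n : ℕ => (n : ℝ))).comp
        ((PointPattern.measurable_count (hS.measurable_pixel i)).comp
          (hS.measurable_Yobs (hM.trans ht) le_rfl))
    exact ((hS.measurable_weight hS.f₂_measurable ht).mul h1).sub
      ((hS.measurable_weight hS.f₁_measurable ht).mul h1)

/-- Overlap bounds each ratio by 1/δ where f is positive; where f vanishes the ratio is zero
whatever the denominator. -/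
theorem weight_mem_Icc {f : PointPattern S → ℝ} (hf : ∀ w, 0 ≤ f w) {δ : ℝ} (hδ : 0 < δ) {ω : Ω}
    {t : ℕ} (ht : D.M ≤ t) (h : ∀ j ∈ Finset.Icc (t + 1 - D.M) t,
      0 < f (D.W j ω) → δ * f (D.W j ω) < D.e j (D.hist j ω) (D.W j ω) D.γs) :
    0 ≤ D.weight f t D.γs ω ∧ D.weight f t D.γs ω ≤ (δ⁻¹) ^ D.M := by
  have hterm : ∀ j ∈ Finset.Icc (t + 1 - D.M) t,
      0 ≤ f (D.W j ω) / D.e j (D.hist j ω) (D.W j ω) D.γs ∧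
      f (D.W j ω) / D.e j (D.hist j ω) (D.W j ω) D.γs ≤ δ⁻¹ := fun j hj => by
    rcases (hf (D.W j ω)).eq_or_lt with h0 | h0
    · rw [← h0, zero_div]
      exact ⟨le_rfl, (inv_pos.mpr hδ).le⟩
    · have h1 := h j hj h0
      have h2 : 0 < D.e j (D.hist j ω) (D.W j ω) D.γs := lt_trans (by positivity) h1
      refine ⟨by positivity, ?_⟩
      rw [div_le_iff₀ h2, inv_mul_eq_div, le_div_iff₀ hδ, mul_comm]
      exact h1.le
  refine ⟨Finset.prod_nonneg fun j hj => (hterm j hj).1,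
    (Finset.prod_le_prod (fun j hj => (hterm j hj).1) fun j hj => (hterm j hj).2).trans_eq ?_⟩
  rw [Finset.prod_const, Nat.card_Icc]
  congr 1
  omega

/-- The products of the entries of `A_t` are uniformly bounded. -/
theorem exists_abs_betaIPW_mul_le (hS : D.Setting P) (hO : D.Overlap P) (hB : D.Bounded P)
    (hN : D.NonSingular P) : ∃ β : ℝ, ∀ᵐ ω ∂P, ∀ t, D.M ≤ t → ∀ a b,
      |D.betaIPW t D.γs ω a * D.betaIPW t D.γs ω b| ≤ β := by
  obtain ⟨δ, hδ, hO⟩ := hO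
  obtain ⟨δY, _, hB⟩ := hB
  obtain ⟨c, hc, hN⟩ := hN
  refine ⟨p * ((δ⁻¹) ^ D.M * δY) ^ 2 / c, ?_⟩
  filter_upwards [hO, hB, hN] with ω h1 h2 h3 t ht a b
  have hM := hS.one_le_M
  have hj : ∀ j ∈ Finset.Icc (t + 1 - D.M) t, 1 ≤ j := fun j hj => by
    rw [Finset.mem_Icc] at hj; omega
  have w1 := weight_mem_Icc (D := D) hS.f₁_nonneg hδ ht
    fun j hj' => (h1 j (hj j hj') (D.W j ω)).1
  have w2 := weight_mem_Icc (D := D) hS.f₂_nonneg hδ ht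
    fun j hj' => (h1 j (hj j hj') (D.W j ω)).2
  have hy : ∀ i, D.pseudoEffect t D.γs ω i * D.pseudoEffect t D.γs ω i ≤
      ((δ⁻¹) ^ D.M * δY) ^ 2 := fun i => by
    rw [← sq, ← sq_abs, pseudoEffect_eq, abs_mul]
    -- Both weights lie in the same interval starting at 0, so their difference is bounded by its
    -- length.
    have e1 : |D.weight D.f₂ t D.γs ω - D.weight D.f₁ t D.γs ω| ≤ (δ⁻¹) ^ D.M :=
      abs_le.mpr ⟨by linarith [w1.2, w2.1], by linarith [w1.1, w2.2]⟩
    have e2 : |((D.Yobs t ω).count (D.pixel i) : ℝ)| ≤ δY := by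
      rw [Nat.abs_cast]
      refine le_trans ?_ ((h2 t (hM.trans ht)).1 (D.Wbar t ω)).le
      exact_mod_cast PointPattern.count_le (D.pixel i) (D.Yobs t ω)
    exact pow_le_pow_left₀ (by positivity)
      (mul_le_mul e1 e2 (abs_nonneg _) (by positivity)) 2
  have hb := mul_dotProduct_ols_le (D.Z t ω) hc (h3 t ht) (D.pseudoEffect t D.γs ω)
  have hyy : D.pseudoEffect t D.γs ω ⬝ᵥ D.pseudoEffect t D.γs ω ≤
      p * ((δ⁻¹) ^ D.M * δY) ^ 2 := by
    refine (Finset.sum_le_sum fun i _ => hy i).trans_eq ?_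
    rw [Finset.sum_const, Finset.card_univ, Fintype.card_fin, nsmul_eq_mul]
  have hcoef : ∀ a, D.betaIPW t D.γs ω a ^ 2 ≤ p * ((δ⁻¹) ^ D.M * δY) ^ 2 / c := fun a => by
    rw [le_div_iff₀ hc, mul_comm]
    refine le_trans (mul_le_mul_of_nonneg_left ?_ hc.le) (hb.trans hyy)
    rw [sq]
    exact Finset.single_le_sum (f := fun a => D.betaIPW t D.γs ω a * D.betaIPW t D.γs ω a)
      (fun _ _ => mul_self_nonneg _) (Finset.mem_univ a)
  have ha := hcoef a
  have hb' := hcoef b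
  rw [abs_le]
  constructor
  · nlinarith [sq_nonneg (D.betaIPW t D.γs ω a + D.betaIPW t D.γs ω b)]
  · nlinarith [sq_nonneg (D.betaIPW t D.γs ω a - D.betaIPW t D.γs ω b)]

namespace LocalScore

variable {r C : ℝ} {B : (t : ℕ) → History S 𝒳 t → PointPattern S → ℝ}

/-- The parameter enters only through the denominators, which both interventions share, so changing
it multiplies every pseudo-outcome by one scalar; linearity of least squares pulls it out. -/
theorem betaIPW_eq_exp_smul (hL : D.LocalScore P r C B) (hS : D.Setting P)
    {γ : EuclideanSpace ℝ (Fin K)} (hγ : γ ∈ Metric.ball D.γs r) {t : ℕ} (ht : D.M ≤ t) (ω : Ω) :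
    D.betaIPW t γ ω = Real.exp (-∑ j ∈ Finset.Icc (t + 1 - D.M) t,
      (Real.log (D.e j (D.hist j ω) (D.W j ω) γ) -
        Real.log (D.e j (D.hist j ω) (D.W j ω) D.γs))) • D.betaIPW t D.γs ω := by
  have hM := hS.one_le_M
  have hw : ∀ f : PointPattern S → ℝ, D.weight f t γ ω =
      Real.exp (-∑ j ∈ Finset.Icc (t + 1 - D.M) t,
      (Real.log (D.e j (D.hist j ω) (D.W j ω) γ) -
        Real.log (D.e j (D.hist j ω) (D.W j ω) D.γs))) * D.weight f t D.γs ω := fun f => by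
    rw [← Finset.sum_neg_distrib, Real.exp_sum, weight, weight, ← Finset.prod_mul_distrib]
    refine Finset.prod_congr rfl fun j hj => ?_
    rw [Finset.mem_Icc] at hj
    conv_lhs => rw [hL.e_eq_mul_exp hS (by omega) (D.hist j ω) (D.W j ω) hγ]
    rw [Real.exp_neg, div_mul_eq_div_div, div_eq_mul_inv, mul_comm]
  rw [betaIPW, betaIPW, ← ols_smul]
  congr 1
  ext i
  rw [Pi.smul_apply, pseudoEffect_eq, pseudoEffect_eq, hw, hw, smul_eq_mul]
  ring

variable [IsProbabilityMeasure P] {Vps : Matrix (Fin K) (Fin K) ℝ}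

/-- Consistency of the variance bound estimator. -/
theorem tendstoInProb_Vhat (hL : D.LocalScore P r C B) (hS : D.Setting P)
    (hU : D.Unconfounded P) (hO : D.Overlap P) (hB : D.Bounded P) (hN : D.NonSingular P)
    (hR : D.ScoreRegular P Vps) (hV : Vps.PosDef) {γhat : ℕ → Ω → EuclideanSpace ℝ (Fin K)}
    (hsol : WithProbTendingToOne P fun T ω => D.SolvesScore T (γhat T ω) ω)
    (hcons : TendstoInMeasure P γhat atTop fun _ => D.γs) {Vs : Matrix (Fin L) (Fin L) ℝ}
    (hVs : D.IsVarianceBound P Vs) : TendstoInProb P (fun T => D.Vhat γhat T) Vs := by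
  intro a b
  obtain ⟨l, hl, hgood⟩ := hL.exists_of_scoreBounds hS hU hR hV
  obtain ⟨β, hβ⟩ := exists_abs_betaIPW_mul_le hS hO hB hN
  have hM := hS.one_le_M
  have hr := hL.pos
  refine tendstoInMeasure_of_withProbTendingToOne fun ε hε => hgood _ fun c hc => ?_
  obtain ⟨C', hC'⟩ := ScoreBounds.exists_sum_sq_log_le hL hS hl hc
  have hβ0 : 0 ≤ β := by
    obtain ⟨ω, hω⟩ := hβ.exists
    exact (abs_nonneg _).trans (hω D.M le_rfl a b)
  set κ := β * (2 * Real.exp (2 * √(D.M * C'))) with hκ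
  have hκ0 : 0 ≤ κ := by positivity
  -- The weight perturbation is to cost at most ε T/6: half through κ θ T, the other half through a
  -- constant absorbed for large T.
  set θ := ε / (12 * (κ + 1)) with hθ
  have hθ0 : 0 < θ := by positivity
  have hκθ : κ * θ ≤ ε / 12 := by
    rw [hθ, ← mul_div_assoc, div_le_div_iff₀ (by positivity) (by positivity)]
    nlinarith
  have hρ : 0 < min (min r 1) (l / 8 / c) := by positivity
  have hweak := abs_sum_sub_condExp_le (P := P) (F := D.fullSigma) hS.fullSigma_le fullSigma_mono
    hM (g := fun t ω => D.betaIPW t D.γs ω a * D.betaIPW t D.γs ω b) (β := β)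
    (fun t ht => (hS.measurable_betaIPW ht a).mul (hS.measurable_betaIPW ht b))
    (fun t ht => hβ.mono fun ω h => h t ht a b) (by positivity : 0 < ε / 6)
  have hlarge : ∀ᶠ T : ℕ in atTop, κ * (D.M ^ 2 * C' / θ) ≤ ε / 12 * T :=
    ((tendsto_natCast_atTop_atTop (R := ℝ)).const_mul_atTop
      (by positivity : 0 < ε / 12)).eventually_ge_atTop _
  refine (((hsol.and (WithProbTendingToOne.of_tendstoInMeasure hcons hρ)).and hweak).and
    (WithProbTendingToOne.of_tendstoInMeasure (hVs a b) (by positivity : 0 < ε / 3))).mono ?_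
  -- T ≥ 2M gives T − M + 1 ≥ T/2, so sums of size ε T/3 become averages of size at most 2ε/3.
  filter_upwards [hlarge, eventually_ge_atTop (2 * D.M)] with T hT1 hT2
  filter_upwards [hβ] with ω hβω ⟨⟨⟨h1, h2⟩, h3⟩, h4⟩ hb
  have hX := hC' T ω hb _ h1 h2
  have hγ : γhat T ω ∈ Metric.ball D.γs r :=
    Metric.mem_ball.mpr (h2.trans_le ((min_le_left _ _).trans (min_le_left _ _)))
  set X : ℕ → ℝ := fun j => Real.log (D.e j (D.hist j ω) (D.W j ω) (γhat T ω)) -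
    Real.log (D.e j (D.hist j ω) (D.W j ω) D.γs) with hXdef
  set g : ℕ → ℝ := fun t => D.betaIPW t D.γs ω a * D.betaIPW t D.γs ω b with hg
  set q : ℕ → ℝ := fun t => (P[fun ω => D.betaIPW t D.γs ω a * D.betaIPW t D.γs ω b |
    D.fullSigma (t - D.M)]) ω with hq
  have h5 := abs_sum_exp_sub_one_mul_le hM hβ0 hθ0 hX
    (g := g) fun t ht => hβω t (Finset.mem_Icc.mp ht).1 a b
  rw [← hκ] at h5
  -- Three parts: the effect of estimating γ, the centred products at γ*, and the conditional
  -- expectations whose average converges to the variance bound.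
  have h6 : ∑ t ∈ Finset.Icc D.M T,
      D.betaIPW t (γhat T ω) ω a * D.betaIPW t (γhat T ω) ω b =
      ∑ t ∈ Finset.Icc D.M T,
        (Real.exp (-2 * ∑ j ∈ Finset.Icc (t + 1 - D.M) t, X j) - 1) * g t +
      ∑ t ∈ Finset.Icc D.M T, (g t - q t) + ∑ t ∈ Finset.Icc D.M T, q t := by
    rw [← Finset.sum_add_distrib, ← Finset.sum_add_distrib]
    refine Finset.sum_congr rfl fun t ht => ?_
    rw [hL.betaIPW_eq_exp_smul hS hγ (Finset.mem_Icc.mp ht).1, Pi.smul_apply, Pi.smul_apply,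
      smul_eq_mul, smul_eq_mul, mul_mul_mul_comm, ← Real.exp_add, ← neg_add, ← two_mul, ← neg_mul]
    change _ * g t = _
    ring
  have hTM : (2 * D.M : ℝ) ≤ T := by exact_mod_cast hT2
  have hn : (T : ℝ) / 2 ≤ (T : ℝ) - D.M + 1 := by linarith
  have hTpos : (0 : ℝ) < T := by exact_mod_cast (by omega : 0 < T)
  have hn0 : 0 < (T : ℝ) - D.M + 1 := by linarith
  have h7 : dist ((∑ t ∈ Finset.Icc D.M T, q t) / ((T : ℝ) - D.M + 1)) (Vs a b) < ε / 3 := h4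
  rw [Real.dist_eq] at h7
  change |(∑ t ∈ Finset.Icc D.M T, D.betaIPW t (γhat T ω) ω a * D.betaIPW t (γhat T ω) ω b) /
    ((T : ℝ) - D.M + 1) - Vs a b| ≤ ε
  rw [h6, add_div, add_sub_assoc]
  have h8 : |(∑ t ∈ Finset.Icc D.M T,
        (Real.exp (-2 * ∑ j ∈ Finset.Icc (t + 1 - D.M) t, X j) - 1) * g t +
      ∑ t ∈ Finset.Icc D.M T, (g t - q t)) / ((T : ℝ) - D.M + 1)| ≤ 2 * ε / 3 := by
    rw [abs_div, abs_of_pos hn0, div_le_iff₀ hn0]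
    have e1 := (abs_add_le (∑ t ∈ Finset.Icc D.M T,
        (Real.exp (-2 * ∑ j ∈ Finset.Icc (t + 1 - D.M) t, X j) - 1) * g t)
        (∑ t ∈ Finset.Icc D.M T, (g t - q t))).trans (add_le_add h5 h3)
    have e2 : κ * (θ * T + D.M ^ 2 * C' / θ) ≤ ε / 6 * T := by
      have := mul_le_mul_of_nonneg_right hκθ hTpos.le
      rw [mul_add]
      linarith
    have e3 := mul_le_mul_of_nonneg_left hn (by positivity : 0 ≤ 2 * ε / 3)
    linarith
  refine (abs_add_le _ _).trans ?_
  linarith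

end LocalScore

end SpatioTemporal.Study

theorem mainTheorem11 {Ω S 𝒳 𝓡 : Type*} [MeasurableSpace Ω] [MeasurableSpace S]
    [MeasurableSpace 𝒳] [MeasurableSpace 𝓡] {p L K : ℕ}
    (D : SpatioTemporal.Study Ω S 𝒳 𝓡 p L K) (P : Measure Ω) [IsProbabilityMeasure P]
    (hSetting : D.Setting P)
    (hUnconf : D.Unconfounded P)
    (hOverlap : D.Overlap P)
    (hBounded : D.Bounded P)
    (hNonsing : D.NonSingular P)
    (Vt : Matrix (Fin L) (Fin L) ℝ) (hVt : Vt.PosDef) (hVarLim : D.VarianceLimit P Vt)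
    (Vps : Matrix (Fin K) (Fin K) ℝ) (hVps : Vps.PosDef) (hScore : D.ScoreRegular P Vps)
    (U : Matrix (Fin K) (Fin L) ℝ) (hU : D.CrossLimit P U)
    (hBlock : (Matrix.fromBlocks Vt U.transpose U Vps).PosDef)
    (hSDeriv : D.SDerivStable P) :
    (∀ N ∈ 𝓝 D.γs, Tendsto (fun T => P {ω | ¬ ∃ γ ∈ N, D.SolvesScore T γ ω}) atTop (𝓝 0)) ∧
    ∀ γhat : ℕ → Ω → EuclideanSpace ℝ (Fin K),
      Tendsto (fun T => P {ω | ¬ D.SolvesScore T (γhat T ω) ω}) atTop (𝓝 0) →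
      TendstoInMeasure P γhat atTop (fun _ => D.γs) →
      ∀ Vs : Matrix (Fin L) (Fin L) ℝ, D.IsVarianceBound P Vs →
        SpatioTemporal.TendstoInProb P (fun T => D.Vhat γhat T) Vs := by

  obtain ⟨r, C, B, hL⟩ := hScore.exists_localScore hSetting
  exact ⟨fun N hN => hL.withProb_exists_solvesScore hSetting hUnconf hScore hVps hN,
    fun γhat hsol hcons Vs hVs => hL.tendstoInProb_Vhat hSetting hUnconf hOverlap hBounded
      hNonsing hScore hVps hsol hcons hVs⟩
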